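/- Let $d\ge 2$, let $B\subset\mathbb R^d$ be the open unit ball with boundary $\partial B$, let all function spaces be complex-valued, and let $L^2_\diamond(\partial B)$ be the space of $g\in L^2(\partial B)$ with $\int_{\partial B} g\,dS=0$. For a coefficient $\gamma\in L^\infty(B)$ near $1$, let $\Lambda(\gamma)\colon L^2_\diamond(\partial B)\to L^2_\diamond(\partial B)$, $f\mapsto u|_{\partial B}$, be the Neumann-to-Dirichlet map, where $u\in H^1(B)$ with $u|_{\partial B}\in L^2_\diamond(\partial B)$ is the unique weak solution of $-\operatorname{div}(\gamma\nabla u)=0$ in $B$, $\gamma\,\partial u/\partial r=f$ on $\partial B$. Let $F\eta:=D\Lambda(1;\eta)$, $\eta\in L^\infty(B)$, be the Fréchet derivative of $\Lambda$ at $\gamma=1$. Let $\mathcal R\subset L^2(B)$ be the closed subspace of radial functions, $\eta(x)=\eta(r)$ with $r=|x|$. For $k\ge0$ put $$P_k(r)=\sqrt{2k+d}\,\sum_{q=0}^k(-1)^q\binom kq\binom{k+q+d-1}{k}r^q,\qquad a_k(\eta)=\int_0^1\eta(r)P_k(r)\,r^{d-1}\,dr .$$ For $\ell\ge1$ let $\{f_{\ell,m}\}_{m\in\mathcal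 I_\ell}$ be any orthonormal basis in $L^2(\partial B)$ of the space of spherical harmonics of degree $\ell$, that is, of the restrictions to $\partial B$ of the complex harmonic homogeneous polynomials of degree $\ell$ in $d$ variables. Theorem. The map $\Lambda$ is well defined for $\gamma$ in a neighbourhood of $1$ in $L^\infty(B)$ and Fréchet differentiable at $1$. The restriction of $F$ to $\mathcal R\cap L^\infty(B)$ has a unique continuous linear extension $F\colon\mathcal R\to\mathscr L(L^2_\diamond(\partial B))$, where $\mathcal R$ carries the $L^2(B)$-norm. For every $\eta\in\mathcal R$ and all spherical harmonics $f,g\in L^2_\diamond(\partial B)$ it satisfies $$\langle (F\eta)f,g\rangle_{L^2(\partial B)}=-\int_B\eta\,\nabla u_f\cdot\overline{\nabla u_g}\,dx ,$$ where the integrand is integrable and $u_f,u_g$ are the harmonic functions with Neumann data $f,g$. Moreover, for every $\eta\in\mathcal R$: 1. The integrands defining the $a_k(\eta)$ are integrable, and $\eta=\sum_{k=0}^\infty a_k(\eta)P_k$ with convergence in $L^2(B)$. 2. The $f_{\ell,m}$, $\ell\ge1$, $m\in\mathcal I_\ell$, form an orthonormal basis of $L^2_\diamond(\partial B)$ in which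 $F\eta$ is diagonal: $(F\eta)f_{\ell,m}=\lambda_\ell(\eta)f_{\ell,m}$, and $$(F\eta)g=\sum_{\ell\ge1}\sum_{m\in\mathcal I_\ell}\lambda_\ell(\eta)\,\langle g,f_{\ell,m}\rangle_{L^2(\partial B)}\,f_{\ell,m}\qquad\text{for all } g\in L^2_\diamond(\partial B),$$ with unconditional convergence in $L^2(\partial B)$, where the eigenvalues do not depend on $m$ and are given by $$\lambda_\ell(\eta)=\sum_{k=0}^{2\ell-2}(-1)^{k+1}a_k(\eta)\,\frac{\sqrt{2k+d}}{\ell}\,\frac{(2\ell-2+d)!\,(2\ell-2)!}{(2\ell-2+d+k)!\,(2\ell-2-k)!}.$$ 3. There is a constant $C_d$, depending only on $d$, such that $|\lambda_\ell(\eta)|\le C_d\,\|\eta\|_{L^2(B)}\,\ell^{-1/2}$ for all $\ell\ge1$ (and all $\eta\in\mathcal R$). 4. The operator $F\eta$ is compact on $L^2_\diamond(\partial B)$. -/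

import Mathlib

open MeasureTheory Filter Topology
open scoped ENNReal ContDiff

namespace RadialEIT

noncomputable section

/-- The space `ℝ^d` with its Euclidean norm. -/
abbrev Space (d : ℕ) : Type := EuclideanSpace ℝ (Fin d)

/-- The unit sphere, i.e. the boundary of the unit ball. -/
abbrev Sphere (d : ℕ) : Type := Metric.sphere (0 : Space d) 1

/-- Lebesgue measure on the open unit ball `B`. -/
abbrev ballMeasure (d : ℕ) : Measure (Space d) :=
  (volume : Measure (Space d)).restrict (Metric.ball 0 1)

instance (d : ℕ) : IsFiniteMeasure (ballMeasure d) :=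
  isFiniteMeasure_restrict.mpr Metric.isBounded_ball.measure_lt_top.ne

/-- The surface measure on the unit sphere. -/
abbrev surfaceMeasure (d : ℕ) : Measure (Sphere d) := (volume : Measure (Space d)).toSphere

/-- `L²(B)` (complex-valued). -/
abbrev L2Ball (d : ℕ) : Type := Lp ℂ 2 (ballMeasure d)

/-- `L²(B; ℂ^d)`. -/
abbrev L2Vec (d : ℕ) : Type := Lp (EuclideanSpace ℂ (Fin d)) 2 (ballMeasure d)

/-- `L^∞(B)` (complex-valued). -/
abbrev LInfBall (d : ℕ) : Type := Lp ℂ ∞ (ballMeasure d)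

/-- `L²(∂B)` (complex-valued). -/
abbrev L2Sphere (d : ℕ) : Type := Lp ℂ 2 (surfaceMeasure d)

/-- The square-integrable functions on the sphere that are orthogonal to the constants. -/
abbrev L2Mean (d : ℕ) : Submodule ℂ (L2Sphere d) :=
  (Submodule.span ℂ {Lp.const 2 (surfaceMeasure d) (1 : ℂ)})ᗮ

/-! ### The Neumann problem and the Neumann-to-Dirichlet map -/

/-- The gradient of a complex-valued function on `ℝ^d`, as a vector in `ℂ^d`. -/
def grad {d : ℕ} (φ : Space d → ℂ) (x : Space d) : EuclideanSpace ℂ (Fin d) :=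
  WithLp.toLp 2 fun i => fderiv ℝ φ x (EuclideanSpace.single i 1)

/-- A candidate for an element of `H¹(B)`: a function, its gradient and its boundary trace. -/
abbrev Triple (d : ℕ) : Type := L2Ball d × L2Vec d × L2Sphere d

/-- The triples `(φ, ∇φ, φ|_{∂B})` given by functions `φ` that are smooth up to the boundary. -/
def smoothTriples (d : ℕ) : Set (Triple d) :=
  {w | ∃ φ : Space d → ℂ, ContDiff ℝ ∞ φ ∧
    (∀ᵐ x ∂ballMeasure d, w.1 x = φ x) ∧
    (∀ᵐ x ∂ballMeasure d, w.2.1 x = grad φ x) ∧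
    (∀ᵐ θ ∂surfaceMeasure d, w.2.2 θ = φ θ)}

/-- The Sobolev space `H¹(B)`, as the closure of the smooth functions in the `H¹`-norm. Every
element `u` is recorded as `(u, ∇u, u|_{∂B})`, where the trace `u|_{∂B}` is, as usual, the
extension by continuity of the restriction of smooth functions to the boundary. (The restriction
is bounded from the `H¹`-norm to `L²(∂B)`, so that requiring convergence of the boundary values
too does not change the closure.) -/
def sobolevH1 (d : ℕ) : Set (Triple d) := closure (smoothTriples d)

/-- `w = (u, ∇u, u|_{∂B})` is a weak solution, in the space of `H¹(B)`-functions whose trace has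
zero mean, of `-div (γ ∇u) = 0` in `B` and `γ ∂u/∂r = f` on `∂B`, i.e.
`∫_B γ ∇u · conj (∇v) dx = ∫_{∂B} f conj v dS` for all `v ∈ H¹(B)`.
(Mathlib's `inner ℂ` is conjugate linear in its first argument.) -/
def IsNeumannSolution {d : ℕ} (γ : LInfBall d) (f : L2Sphere d) (w : Triple d) : Prop :=
  w ∈ sobolevH1 d ∧ w.2.2 ∈ L2Mean d ∧
    ∀ v ∈ sobolevH1 d,
      ∫ x, γ x * inner ℂ (v.2.1 x) (w.2.1 x) ∂ballMeasure d = inner ℂ v.2.2 f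

/-- The Neumann problem with coefficient `γ` is uniquely solvable for all mean-free currents, and
the bounded operator `T` sends each current to the boundary trace of the solution. -/
def IsNDMap {d : ℕ} (γ : LInfBall d) (T : L2Mean d →L[ℂ] L2Mean d) : Prop :=
  ∀ f : L2Mean d, (∃! w : Triple d, IsNeumannSolution γ f w) ∧
    ∀ w : Triple d, IsNeumannSolution γ f w → (T f : L2Sphere d) = w.2.2

open Classical in
/-- The (nonlinear) Neumann-to-Dirichlet map `γ ↦ Λ(γ)`; its value is set to `0` at coefficients
where the Neumann problem is not well posed. -/
def ndMap (d : ℕ) (γ : LInfBall d) : L2Mean d →L[ℂ] L2Mean d :=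
  if h : ∃ T : L2Mean d →L[ℂ] L2Mean d, IsNDMap γ T then h.choose else 0

/-- The constant coefficient `1`. -/
def oneCoeff (d : ℕ) : LInfBall d := Lp.const ∞ (ballMeasure d) (1 : ℂ)

/-- The Fréchet derivative `F = DΛ(1; ·)` of the Neumann-to-Dirichlet map at `γ = 1`. -/
def linearizedND (d : ℕ) : LInfBall d →L[ℂ] (L2Mean d →L[ℂ] L2Mean d) :=
  fderiv ℂ (ndMap d) (oneCoeff d)

/-! ### Radial perturbations -/

/-- `h` represents `η` as a function of the radial variable. -/
def IsRadialProfile {d : ℕ} (h : ℝ → ℂ) (η : L2Ball d) : Prop :=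
  Measurable h ∧ ∀ᵐ x ∂ballMeasure d, η x = h ‖x‖

/-- The space of radial perturbations: the functions in `L²(B)` that do not depend on the angular
variable. -/
def radial (d : ℕ) : Submodule ℂ (L2Ball d) where
  carrier := {η | ∃ h : ℝ → ℂ, IsRadialProfile h η}
  zero_mem' := ⟨fun _ => 0, measurable_const, Lp.coeFn_zero ℂ 2 (ballMeasure d)⟩
  add_mem' := by
    rintro η ξ ⟨h, hm, hh⟩ ⟨k, km, hk⟩
    refine ⟨fun r => h r + k r, hm.add km, ?_⟩
    filter_upwards [Lp.coeFn_add η ξ, hh, hk] with x h1 h2 h3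
    rw [h1, Pi.add_apply, h2, h3]
  smul_mem' := by
    rintro c η ⟨h, hm, hh⟩
    refine ⟨fun r => c * h r, hm.const_mul c, ?_⟩
    filter_upwards [Lp.coeFn_smul c η, hh] with x h1 h2
    rw [h1, Pi.smul_apply, h2, smul_eq_mul]

/-- `F`, defined on all radial square-integrable perturbations and continuous for the `L²(B)`-norm,
extends the Fréchet derivative of the Neumann-to-Dirichlet map on bounded radial perturbations. -/
def ExtendsLinearizedND {d : ℕ} (F : radial d →L[ℂ] (L2Mean d →L[ℂ] L2Mean d)) : Prop :=
  ∀ (η : radial d) (ξ : LInfBall d),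
    (∀ᵐ x ∂ballMeasure d, (η : L2Ball d) x = ξ x) → F η = linearizedND d ξ

/-! ### Jacobi polynomials and the eigenvalues -/

/-- The shifted and normalized Jacobi polynomials. -/
def jacobiP (d k : ℕ) (r : ℝ) : ℝ :=
  √(2 * k + d) * ∑ q ∈ Finset.range (k + 1),
    (-1 : ℝ) ^ q * (k.choose q : ℝ) * ((k + q + d - 1).choose k : ℝ) * r ^ q

/-- The `k`-th Jacobi coefficient of a radial profile. -/
def jacobiCoeff (d k : ℕ) (h : ℝ → ℂ) : ℂ :=
  ∫ r in (0 : ℝ)..1, h r * (jacobiP d k r : ℂ) * ((r ^ (d - 1) : ℝ) : ℂ)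

/-- The eigenvalue of degree `ℓ ≥ 1` for the perturbation with radial profile `h`. -/
def eigenvalue (d ℓ : ℕ) (h : ℝ → ℂ) : ℂ :=
  ∑ k ∈ Finset.range (2 * ℓ - 1),
    (-1 : ℂ) ^ (k + 1) * jacobiCoeff d k h *
      ((√(2 * k + d) / ℓ *
        (((2 * ℓ - 2 + d).factorial * (2 * ℓ - 2).factorial : ℝ) /
          ((2 * ℓ - 2 + d + k).factorial * (2 * ℓ - 2 - k).factorial)) : ℝ) : ℂ)

/-! ### Spherical harmonics -/

/-- The Laplacian on polynomials. -/
def polyLaplacian (d : ℕ) : MvPolynomial (Fin d) ℂ →ₗ[ℂ] MvPolynomial (Fin d) ℂ :=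
  ∑ i : Fin d, (MvPolynomial.pderiv (R := ℂ) i).toLinearMap ∘ₗ
    (MvPolynomial.pderiv (R := ℂ) i).toLinearMap

/-- The harmonic homogeneous polynomials of degree `ℓ` in `d` variables. -/
def harmonicPolys (d ℓ : ℕ) : Submodule ℂ (MvPolynomial (Fin d) ℂ) :=
  MvPolynomial.homogeneousSubmodule (Fin d) ℂ ℓ ⊓ LinearMap.ker (polyLaplacian d)

/-- The `i`-th coordinate as a continuous function on the sphere. -/
def sphereCoord (d : ℕ) (i : Fin d) : C(Sphere d, ℂ) where
  toFun θ := (((θ : Space d) i : ℝ) : ℂ)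
  continuous_toFun := by fun_prop

/-- The restriction of polynomials to the sphere, as elements of `L²(∂B)`. -/
def restrictToSphere (d : ℕ) : MvPolynomial (Fin d) ℂ →ₗ[ℂ] L2Sphere d :=
  (ContinuousMap.toLp (E := ℂ) 2 (surfaceMeasure d) ℂ).toLinearMap ∘ₗ
    (MvPolynomial.aeval (sphereCoord d)).toLinearMap

/-- The space of spherical harmonics of degree `ℓ`. -/
def sphericalHarmonics (d ℓ : ℕ) : Submodule ℂ (L2Sphere d) :=
  (harmonicPolys d ℓ).map (restrictToSphere d)

end

end RadialEIT

open RadialEIT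

namespace RadialEIT

/-! Everything rests on one computation. The Neumann solution for the restriction of a harmonic
homogeneous polynomial `p` of degree `ℓ ≥ 1` is `p / ℓ`, and `∇p · conj ∇q` is homogeneous of degree
`ℓ + ℓ' - 2`. Against a radial `η` with profile `h`, the integral over `B` therefore splits into a
radial moment and a sphere integral that does not involve `η`. Taking `η = 1` and using Green's
formula `∫_B ∇p · conj ∇q = ℓ ⟨p, q⟩`, the sphere integral is found to be `(ℓ + ℓ' - 2 + d) ℓ ⟨p,
q⟩`, which vanishes for `ℓ ≠ ℓ'`. So the form `-∫ η ∇u_f · conj ∇u_g` is diagonal in spherical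
harmonics, with eigenvalue `-((2ℓ - 2 + d)/ℓ) ∫ h r^(2ℓ-2) r^(d-1) dr`
(`integral_radial_mul_inner_grad`, `integral_mul_inner_polyTriple`).

The formula in the Jacobi coefficients is the expansion of `r^(2ℓ-2)` in the `P_k`
(`pow_eq_sum_jacobiP`). Its coefficients are moments of the `P_k`, evaluated by a partial fraction
identity (`sum_alternating_choose_prod_div`), which also gives orthonormality. Completeness is
Weierstrass approximation (`radial_mem_closure`). Cauchy-Schwarz applied to the moment gives the
decay `ℓ^(-1/2)`, since the norm of `r^(2ℓ-2)` has that order and `(2ℓ - 2 + d)/ℓ` is bounded.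

The extension is then defined as the diagonal operator with these eigenvalues (`radialND`). It
agrees with the derivative on bounded radial perturbations because the matrix entries agree, it is
the only extension because the `P_k` are bounded with dense span, and it is compact because the
eigenvalues tend to zero with finite multiplicities.

For the derivative itself, the gradient identifies the mean-free part of `H¹(B)` with a closed
subspace `V` of `L²(B; ℂ^d)` (`norm_le_norm_grad`). If `T` is the trace as a map on `V` and `A(γ)`
is multiplication by `γ` compressed to `V`, the weak equation reads `A(γ)∇u = T* f`
(`isNeumannSolution_iff`). Hence `Λ(γ) = T A(γ)⁻¹ T*` near `γ = 1`, where `A(1) = 1`, and `F ξ = -T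
A(ξ) T*`.

Two classical facts support this: the divergence theorem on the ball (`integral_ball_fderiv`) and
the density of spherical harmonics in `L²(∂B)` (`iSup_sphericalHarmonics_dense`). -/

/-! ### Polar coordinates and surface integrals -/

theorem integral_volumeIoiPow (n : ℕ) (f : ℝ → ℂ) :
    ∫ r : Set.Ioi (0 : ℝ), f r ∂Measure.volumeIoiPow n = ∫ r in Set.Ioi (0 : ℝ), (r ^ n : ℝ) * f r := by
  simp only [Measure.volumeIoiPow, ENNReal.ofReal]
  rw [integral_withDensity_eq_integral_smul,
    integral_subtype_comap measurableSet_Ioi fun a ↦ Real.toNNReal (a ^ n) • f a,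
    setIntegral_congr_fun measurableSet_Ioi fun x hx ↦ ?_]
  · rw [NNReal.smul_def, Real.coe_toNNReal _ (pow_nonneg hx.out.le _), Complex.real_smul]
  · exact (measurable_subtype_coe.pow_const _).real_toNNReal

theorem nontrivial_space {d : ℕ} (hd : 0 < d) : Nontrivial (Space d) := by
  have : Nonempty (Fin d) := ⟨⟨0, hd⟩⟩
  infer_instance

/-- Polar coordinates on the product of the sphere and the half-line. -/
theorem integral_polar {d : ℕ} (hd : 0 < d) (g : Space d → ℂ) :
    ∫ x, g x = ∫ p : Sphere d × Set.Ioi (0 : ℝ), g (p.2.1 • p.1.1)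
      ∂(surfaceMeasure d).prod (Measure.volumeIoiPow (d - 1)) := by
  have := nontrivial_space hd
  have h := (volume : Measure (Space d)).measurePreserving_homeomorphUnitSphereProd
  rw [finrank_euclideanSpace_fin] at h
  rw [← h.integral_comp (Homeomorph.measurableEmbedding _)]
  have : ∀ x : ({(0 : Space d)}ᶜ : Set (Space d)),
      g ((homeomorphUnitSphereProd (Space d) x).2.1 • (homeomorphUnitSphereProd (Space d) x).1.1)
        = g x := by
    intro x
    have : ‖(x : Space d)‖ ≠ 0 := norm_ne_zero_iff.mpr x.2
    simp [smul_smul, this]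
  simp_rw [this]
  rw [integral_subtype_comap (measurableSet_singleton _).compl g, restrict_compl_singleton]

theorem integrable_polar {d : ℕ} {g : Space d → ℂ} (hg : Integrable g) :
    Integrable (fun p : Sphere d × Set.Ioi (0 : ℝ) => g (p.2.1 • p.1.1))
      ((surfaceMeasure d).prod (Measure.volumeIoiPow (d - 1))) := by
  have h := (volume : Measure (Space d)).measurePreserving_homeomorphUnitSphereProd
  rw [finrank_euclideanSpace_fin] at h
  rw [← h.integrable_comp_emb (Homeomorph.measurableEmbedding _)]
  have : ((fun p : Sphere d × Set.Ioi (0 : ℝ) => g (p.2.1 • p.1.1)) ∘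
      homeomorphUnitSphereProd (Space d)) = fun x => g x.1 := by
    ext x
    have : ‖(x : Space d)‖ ≠ 0 := norm_ne_zero_iff.mpr x.2
    simp [smul_smul, this]
  rw [this]
  exact (integrableOn_iff_comap_subtypeVal (measurableSet_singleton _).compl).mp hg.integrableOn

theorem norm_smul_sphere {d : ℕ} (r : Set.Ioi (0 : ℝ)) (θ : Sphere d) :
    ‖r.1 • (θ : Space d)‖ = r.1 := by
  rw [norm_smul, norm_eq_of_mem_sphere, mul_one, Real.norm_of_nonneg (le_of_lt r.2)]

theorem setIntegral_Ioi_indicator (f : ℝ → ℂ) :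
    ∫ r in Set.Ioi (0 : ℝ), (Set.Iio (1 : ℝ)).indicator f r = ∫ r in (0 : ℝ)..1, f r := by
  rw [setIntegral_indicator measurableSet_Iio, intervalIntegral.integral_of_le zero_le_one,
    Set.Ioi_inter_Iio, integral_Ioc_eq_integral_Ioo]

/-- The integral over the ball of the product of a radial function and a homogeneous one. -/
theorem integral_ball_radial_mul {d : ℕ} (hd : 0 < d) (h : ℝ → ℂ) (q : Space d → ℂ) (m : ℕ)
    (hq : ∀ (r : ℝ) (x : Space d), 0 < r → q (r • x) = r ^ m * q x) :
    ∫ x, h ‖x‖ * q x ∂ballMeasure d =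
      (∫ r in (0 : ℝ)..1, h r * (r : ℂ) ^ m * ((r ^ (d - 1) : ℝ) : ℂ)) *
        ∫ θ, q θ ∂surfaceMeasure d := by
  rw [← integral_indicator measurableSet_ball, integral_polar hd]
  have : ∀ p : Sphere d × Set.Ioi (0 : ℝ),
      (Metric.ball (0 : Space d) 1).indicator (fun x => h ‖x‖ * q x) (p.2.1 • p.1.1) =
        q p.1 * (Set.Iio (1 : ℝ)).indicator (fun r => h r * (r : ℂ) ^ m) p.2 := by
    intro p
    simp only [Set.indicator, Metric.mem_ball, dist_zero_right, norm_smul_sphere, Set.mem_Iio]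
    split_ifs
    · rw [hq _ _ p.2.2]; ring
    · simp
  simp_rw [this]
  rw [integral_prod_mul (fun θ : Sphere d => q θ)
    (fun r : Set.Ioi (0 : ℝ) => (Set.Iio (1 : ℝ)).indicator (fun r => h r * (r : ℂ) ^ m) r.1),
    mul_comm]
  congr 1
  rw [integral_volumeIoiPow, ← setIntegral_Ioi_indicator]
  congr 1
  ext r
  simp only [Set.indicator]
  split_ifs
  · ring
  · simp

/-- Surface integrals as volume integrals. -/
theorem integral_sphere_eq {d : ℕ} (hd : 0 < d) {ψ : Space d → ℂ} (hψ : ContDiff ℝ 1 ψ) :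
    ∫ x, (d * ψ x + fderiv ℝ ψ x x) ∂ballMeasure d = ∫ θ, ψ θ ∂surfaceMeasure d := by
  have hc : Continuous fun x => (d * ψ x + fderiv ℝ ψ x x) := by
    have := hψ.continuous
    have := hψ.continuous_fderiv (by norm_num)
    fun_prop
  have hi : IntegrableOn (fun x => (d * ψ x + fderiv ℝ ψ x x)) (Metric.ball 0 1) :=
    (hc.continuousOn.integrableOn_compact (isCompact_closedBall (0 : Space d) 1)).mono_set
      Metric.ball_subset_closedBall
  rw [← integrable_indicator_iff measurableSet_ball] at hi
  rw [← integral_indicator measurableSet_ball, integral_polar hd,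
    integral_prod _ (integrable_polar hi)]
  congr 1
  ext θ
  have : ∀ r : Set.Ioi (0 : ℝ),
      (Metric.ball (0 : Space d) 1).indicator (fun x => (d * ψ x + fderiv ℝ ψ x x)) (r.1 • θ.1) =
        (Set.Iio (1 : ℝ)).indicator
          (fun r => (d * ψ (r • θ.1) + fderiv ℝ ψ (r • θ.1) (r • θ.1))) r := by
    intro r
    simp only [Set.indicator, Metric.mem_ball, dist_zero_right, norm_smul_sphere, Set.mem_Iio]
  simp_rw [this]
  rw [integral_volumeIoiPow]
  have : ∀ r : ℝ, ((r ^ (d - 1) : ℝ) : ℂ) * (Set.Iio (1 : ℝ)).indicator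
          (fun r => (d * ψ (r • θ.1) + fderiv ℝ ψ (r • θ.1) (r • θ.1))) r =
      (Set.Iio (1 : ℝ)).indicator
        (fun r => ((r ^ (d - 1) : ℝ) : ℂ) * (d * ψ (r • θ.1) + fderiv ℝ ψ (r • θ.1) (r • θ.1))) r := by
    intro r
    simp only [Set.indicator]
    split_ifs <;> simp
  simp_rw [this]
  -- On each ray the integrand is the derivative of `r^d ψ(rθ)`, which vanishes at `r = 0` because
  -- `d > 0`.
  rw [setIntegral_Ioi_indicator, intervalIntegral.integral_eq_sub_of_hasDerivAt
    (f := fun r : ℝ => ((r : ℂ) ^ d) * ψ (r • θ.1))]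
  · simp [hd.ne']
  · intro r _
    have h1 : HasDerivAt (fun r : ℝ => r • θ.1) θ.1 r := by
      simpa using (hasDerivAt_id r).smul_const θ.1
    have h2 := ((hψ.differentiable (by norm_num)) (r • θ.1)).hasFDerivAt.comp_hasDerivAt r h1
    have h3 : HasDerivAt (fun r : ℝ => (r : ℂ) ^ d) (d * (r : ℂ) ^ (d - 1)) r :=
      (hasDerivAt_pow d (r : ℂ)).comp_ofReal
    refine (h3.mul h2).congr_deriv ?_
    rw [map_smul, Complex.real_smul]
    have : (r : ℂ) ^ d = r ^ (d - 1) * r := by rw [← pow_succ, Nat.sub_add_cancel hd]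
    simp only [Function.comp_apply]
    rw [this]
    push_cast
    ring
  · apply Continuous.intervalIntegrable
    have := hψ.continuous
    have := hψ.continuous_fderiv (by norm_num)
    fun_prop

/-! ### The divergence theorem on the ball -/

theorem integral_fderiv_eq_zero {d : ℕ} {G : Space d → ℂ} (hG : ContDiff ℝ 1 G)
    (hs : HasCompactSupport G) (v : Space d) : ∫ x, fderiv ℝ G x v = 0 := by
  have h := integral_mul_fderiv_eq_neg_fderiv_mul_of_integrable (𝕜 := ℂ) (μ := volume)
    (f := fun _ : Space d => (1 : ℂ)) (g := G) (v := v) (by simp) ?_ ?_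
    (fun _ _ => differentiableAt_const _) (fun x _ => hG.differentiable (by norm_num) x)
  · simpa using h
  · simp only [one_mul]
    refine Continuous.integrable_of_hasCompactSupport ?_ ?_
    · exact (hG.continuous_fderiv (by norm_num)).clm_apply continuous_const
    · exact hs.fderiv_apply (𝕜 := ℝ) v
  · simpa using hG.continuous.integrable_of_hasCompactSupport hs

theorem sum_coord_smul {d : ℕ} (x : Space d) :
    ∑ j, x j • (EuclideanSpace.single j (1 : ℝ) : Space d) = x := by
  simpa using (EuclideanSpace.basisFun (Fin d) ℝ).sum_repr x

theorem map_eq_sum_coord {d : ℕ} (L : Space d →L[ℝ] ℂ) (x : Space d) :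
    L x = ∑ j, (x j : ℂ) * L (EuclideanSpace.single j 1) := by
  conv_lhs => rw [← sum_coord_smul x]
  simp [map_sum]

theorem contDiff_coord {d : ℕ} (j : Fin d) {n : WithTop ℕ∞} :
    ContDiff ℝ n (fun x : Space d => ((x j : ℝ) : ℂ)) :=
  Complex.ofRealCLM.contDiff.comp (EuclideanSpace.proj (𝕜 := ℝ) j).contDiff

theorem fderiv_coord {d : ℕ} (j : Fin d) (x v : Space d) :
    fderiv ℝ (fun x : Space d => ((x j : ℝ) : ℂ)) x v = v j := by
  let L : Space d →L[ℝ] ℂ := Complex.ofRealCLM ∘L EuclideanSpace.proj (𝕜 := ℝ) j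
  have h : fderiv ℝ L x v = L v := by rw [L.fderiv]
  exact h

/-- The integrand is the divergence of the compactly supported field `G(x) x`. -/
theorem integral_euler_eq_zero {d : ℕ} {G : Space d → ℂ} (hG : ContDiff ℝ 1 G)
    (hs : HasCompactSupport G) : ∫ x, (d * G x + fderiv ℝ G x x) = 0 := by
  have hd := hG.differentiable (by norm_num)
  have hj : ∀ (j : Fin d) (x : Space d), fderiv ℝ (fun x => ((x j : ℝ) : ℂ) * G x) x
      (EuclideanSpace.single j 1) = G x + x j * fderiv ℝ G x (EuclideanSpace.single j 1) := by
    intro j x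
    rw [fderiv_fun_mul ((contDiff_coord j (n := 1)).differentiable (by norm_num) x) (hd x)]
    simp [fderiv_coord]
    ring
  have key : ∀ x, d * G x + fderiv ℝ G x x = ∑ j, fderiv ℝ (fun x => ((x j : ℝ) : ℂ) * G x) x
      (EuclideanSpace.single j 1) := by
    intro x
    simp_rw [hj, Finset.sum_add_distrib, ← map_eq_sum_coord]
    simp
  have hcd : ∀ j : Fin d, ContDiff ℝ 1 (fun x : Space d => ((x j : ℝ) : ℂ) * G x) :=
    fun j => (contDiff_coord j).mul hG
  have hcs : ∀ j : Fin d, HasCompactSupport (fun x : Space d => ((x j : ℝ) : ℂ) * G x) :=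
    fun j => hs.mul_left
  simp_rw [key]
  rw [integral_finsetSum]
  · exact Finset.sum_eq_zero fun j _ => integral_fderiv_eq_zero (hcd j) (hcs j) _
  · intro j _
    refine Continuous.integrable_of_hasCompactSupport ?_ ?_
    · exact ((hcd j).continuous_fderiv (by norm_num)).clm_apply continuous_const
    · exact (hcs j).fderiv_apply (𝕜 := ℝ) _

/-- A smooth cutoff function of the unit ball. -/
noncomputable def cutoff (d n : ℕ) (x : Space d) : ℂ :=
  (Real.smoothTransition (n * (1 - ‖x‖ ^ 2)) : ℝ)

theorem contDiff_cutoff (d n : ℕ) : ContDiff ℝ 1 (cutoff d n) := by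
  refine Complex.ofRealCLM.contDiff.comp (Real.smoothTransition.contDiff.comp ?_)
  exact contDiff_const.mul (contDiff_const.sub (contDiff_norm_sq ℝ))

theorem cutoff_eq_zero {d n : ℕ} {x : Space d} (hx : 1 ≤ ‖x‖) : cutoff d n x = 0 := by
  rw [cutoff, Real.smoothTransition.zero_of_nonpos, Complex.ofReal_zero]
  have : 1 ≤ ‖x‖ ^ 2 := one_le_pow₀ hx
  exact mul_nonpos_of_nonneg_of_nonpos (by positivity) (by linarith)

theorem hasCompactSupport_cutoff (d n : ℕ) : HasCompactSupport (cutoff d n) := by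
  refine HasCompactSupport.intro (isCompact_closedBall (0 : Space d) 1) fun x hx => ?_
  refine cutoff_eq_zero ?_
  simp only [Metric.mem_closedBall, dist_zero_right, not_le] at hx
  exact hx.le

theorem fderiv_cutoff (d n : ℕ) (x v : Space d) :
    fderiv ℝ (cutoff d n) x v =
      -((2 * n * deriv Real.smoothTransition (n * (1 - ‖x‖ ^ 2)) * inner ℝ x v : ℝ) : ℂ) := by
  have h1 : HasFDerivAt (fun x : Space d => (n : ℝ) * (1 - ‖x‖ ^ 2))
      ((n : ℝ) • (-(2 • innerSL ℝ x) : Space d →L[ℝ] ℝ)) x :=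
    (((hasStrictFDerivAt_norm_sq x).hasFDerivAt).const_sub 1).const_mul _
  have h2 : HasDerivAt Real.smoothTransition
      (deriv Real.smoothTransition (n * (1 - ‖x‖ ^ 2))) (n * (1 - ‖x‖ ^ 2)) :=
    ((Real.smoothTransition.contDiff (n := 1)).differentiable (by norm_num) _).hasDerivAt
  have h3 := Complex.ofRealCLM.hasFDerivAt.comp x (h2.comp_hasFDerivAt x h1)
  have h4 : fderiv ℝ (cutoff d n) x = _ := h3.fderiv
  rw [h4]
  simp
  ring

theorem integrableOn_ball_of_continuous {d : ℕ} {K : Space d → ℂ} (hK : Continuous K) :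
    Integrable K (ballMeasure d) :=
  (hK.continuousOn.integrableOn_compact (isCompact_closedBall (0 : Space d) 1)).mono_set
    Metric.ball_subset_closedBall

/-- The derivative is supported in `[0, 1]`, so compactness applies. The bound dominates the
boundary-layer term in the divergence theorem, where `n` appears only through `t = n(1 - |x|²)`. -/
theorem exists_bound_mul_deriv_smoothTransition :
    ∃ M : ℝ, ∀ t : ℝ, |t * deriv Real.smoothTransition t| ≤ M := by
  have hc : Continuous (deriv Real.smoothTransition) :=
    (Real.smoothTransition.contDiff (n := 1)).continuous_deriv (by norm_num)
  obtain ⟨M, hM⟩ := isCompact_Icc.exists_bound_of_continuousOn (s := Set.Icc (0 : ℝ) 1)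
    (continuous_id.mul hc).continuousOn
  refine ⟨M, fun t => ?_⟩
  by_cases ht : t ∈ Set.Icc (0 : ℝ) 1
  · exact hM t ht
  · have h0 : deriv Real.smoothTransition t = 0 := by
      rw [Set.mem_Icc, not_and_or, not_le, not_le] at ht
      rcases ht with ht | ht
      · have : Real.smoothTransition =ᶠ[𝓝 t] fun _ => 0 := by
          filter_upwards [Iio_mem_nhds ht] with s hs
          exact Real.smoothTransition.zero_of_nonpos (le_of_lt hs)
        rw [this.deriv_eq, deriv_const]
      · have : Real.smoothTransition =ᶠ[𝓝 t] fun _ => 1 := by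
          filter_upwards [Ioi_mem_nhds ht] with s hs
          exact Real.smoothTransition.one_of_one_le (le_of_lt hs)
        rw [this.deriv_eq, deriv_const]
    rw [h0, mul_zero, abs_zero]
    exact (norm_nonneg _).trans (hM 0 (by simp))

/-- The divergence theorem on the unit ball, for fields of constant direction. -/
theorem integral_ball_fderiv {d : ℕ} (hd : 0 < d) {ψ : Space d → ℂ} (hψ : ContDiff ℝ 1 ψ)
    (e : Space d) :
    ∫ x, fderiv ℝ ψ x e ∂ballMeasure d =
      ∫ θ, ((inner ℝ (θ : Space d) e : ℝ) : ℂ) * ψ θ ∂surfaceMeasure d := by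
  have hin : ContDiff ℝ 1 (fun x : Space d => ((inner ℝ x e : ℝ) : ℂ)) :=
    Complex.ofRealCLM.contDiff.comp (contDiff_id.inner ℝ contDiff_const)
  -- By `integral_sphere_eq`, the surface integral is the integral over the ball of the divergence
  -- of `Ψ(x) x`. It remains to treat the field `ψ e - Ψ x`, which is tangential on the sphere and
  -- so should have no flux.
  set Ψ : Space d → ℂ := fun x => ((inner ℝ x e : ℝ) : ℂ) * ψ x with hΨdef
  have hΨ : ContDiff ℝ 1 Ψ := hin.mul hψ
  have hK₁ : Continuous fun x => fderiv ℝ ψ x e :=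
    (hψ.continuous_fderiv (by norm_num)).clm_apply continuous_const
  have hK₂ : Continuous fun x => (d * Ψ x + fderiv ℝ Ψ x x) := by
    have h1 := hΨ.continuous
    have h2 := hΨ.continuous_fderiv (by norm_num)
    fun_prop
  rw [← integral_sphere_eq hd hΨ, ← sub_eq_zero, ← integral_sub
    (integrableOn_ball_of_continuous hK₁) (integrableOn_ball_of_continuous hK₂)]
  set K : Space d → ℂ := fun x => fderiv ℝ ψ x e - (d * Ψ x + fderiv ℝ Ψ x x) with hKdef
  have hK : Continuous K := hK₁.sub hK₂
  set κ : ℝ → ℝ := fun t => t * deriv Real.smoothTransition t with hκdef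
  -- This is the divergence of the cut-off field. Differentiating the cutoff yields `-2n s'(n(1 -
  -- |x|²)) (1 - |x|²) Ψ`, where `s` is the transition function. Tangentiality supplies the factor
  -- `1 - |x|²`, which absorbs the `n`.
  let R : ℕ → Space d → ℂ := fun n x =>
    cutoff d n x * K x - 2 * ((κ (n * (1 - ‖x‖ ^ 2)) : ℝ) : ℂ) * Ψ x
  have hcut : ∀ n x, DifferentiableAt ℝ (cutoff d n) x := fun n x =>
    (contDiff_cutoff d n).differentiable (by norm_num) x
  have hR : ∀ n x, R n x = fderiv ℝ (fun x => cutoff d n x * ψ x) x e -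
      (d * (cutoff d n x * Ψ x) + fderiv ℝ (fun x => cutoff d n x * Ψ x) x x) := by
    intro n x
    rw [fderiv_fun_mul (hcut n x) (hψ.differentiable (by norm_num) x),
      fderiv_fun_mul (hcut n x) (hΨ.differentiable (by norm_num) x)]
    simp only [R, hKdef, add_apply, smul_apply, smul_eq_mul,
      fderiv_cutoff, hκdef, real_inner_self_eq_norm_sq]
    simp only [hΨdef]
    push_cast
    ring
  have hmulψ : ∀ n, ContDiff ℝ 1 (fun x => cutoff d n x * ψ x) :=
    fun n => (contDiff_cutoff d n).mul hψ
  have hmulΨ : ∀ n, ContDiff ℝ 1 (fun x => cutoff d n x * Ψ x) :=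
    fun n => (contDiff_cutoff d n).mul hΨ
  have hsψ : ∀ n, HasCompactSupport (fun x => cutoff d n x * ψ x) :=
    fun n => (hasCompactSupport_cutoff d n).mul_right
  have hsΨ : ∀ n, HasCompactSupport (fun x => cutoff d n x * Ψ x) :=
    fun n => (hasCompactSupport_cutoff d n).mul_right
  have hi1 : ∀ n, Integrable fun x => fderiv ℝ (fun x => cutoff d n x * ψ x) x e := fun n =>
    (((hmulψ n).continuous_fderiv (by norm_num)).clm_apply
      continuous_const).integrable_of_hasCompactSupport ((hsψ n).fderiv_apply (𝕜 := ℝ) _)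
  have hi2 : ∀ n, Integrable fun x =>
      d * (cutoff d n x * Ψ x) + fderiv ℝ (fun x => cutoff d n x * Ψ x) x x := by
    intro n
    refine Continuous.integrable_of_hasCompactSupport ?_ ?_
    · have h1 := (hmulΨ n).continuous
      have h2 := (hmulΨ n).continuous_fderiv (by norm_num)
      exact (continuous_const.mul h1).add (h2.clm_apply continuous_id)
    · refine HasCompactSupport.intro ((hsΨ n).isCompact) fun x hx => ?_
      have h3 : x ∉ tsupport (fderiv ℝ fun x => cutoff d n x * Ψ x) := fun h =>
        hx (tsupport_fderiv_subset ℝ h)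
      rw [image_eq_zero_of_notMem_tsupport h3]
      have h4 := image_eq_zero_of_notMem_tsupport hx
      simp [h4]
  have hR0 : ∀ n, ∫ x, R n x = 0 := by
    intro n
    simp_rw [hR]
    rw [integral_sub (hi1 n) (hi2 n), integral_fderiv_eq_zero (hmulψ n) (hsψ n),
      integral_euler_eq_zero (hmulΨ n) (hsΨ n), sub_zero]
  have hout : ∀ n x, 1 ≤ ‖x‖ → R n x = 0 := by
    intro n x hx
    have hx2 : (n : ℝ) * (1 - ‖x‖ ^ 2) ≤ 0 :=
      mul_nonpos_of_nonneg_of_nonpos (by positivity) (by linarith [one_le_pow₀ hx (n := 2)])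
    have : κ (n * (1 - ‖x‖ ^ 2)) = 0 := by
      rcases hx2.lt_or_eq with h | h
      · have : Real.smoothTransition =ᶠ[𝓝 (n * (1 - ‖x‖ ^ 2))] fun _ => 0 := by
          filter_upwards [Iio_mem_nhds h] with s hs
          exact Real.smoothTransition.zero_of_nonpos (le_of_lt hs)
        simp only [hκdef]
        rw [this.deriv_eq, deriv_const, mul_zero]
      · simp [hκdef, h]
    simp [R, cutoff_eq_zero hx, this]
  obtain ⟨M, hM⟩ := exists_bound_mul_deriv_smoothTransition
  obtain ⟨A, hA⟩ := (isCompact_closedBall (0 : Space d) 1).exists_bound_of_continuousOn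
    hK.continuousOn
  obtain ⟨A', hA'⟩ := (isCompact_closedBall (0 : Space d) 1).exists_bound_of_continuousOn
    hΨ.continuous.continuousOn
  have hcont : ∀ n, Continuous (R n) := by
    intro n
    have h1 := (contDiff_cutoff d n).continuous
    have hc : Continuous (deriv Real.smoothTransition) :=
      (Real.smoothTransition.contDiff (n := 1)).continuous_deriv (by norm_num)
    have h2 := hΨ.continuous
    have h3 : Continuous κ := continuous_id.mul hc
    fun_prop
  have hball : ∀ n, ∫ x, R n x ∂ballMeasure d = 0 := by
    intro n
    rw [setIntegral_eq_integral_of_forall_compl_eq_zero, hR0]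
    intro x hx
    exact hout n x (by simpa using hx)
  have hlim : Tendsto (fun n => ∫ x, R n x ∂ballMeasure d) atTop
      (𝓝 (∫ x, K x ∂ballMeasure d)) := by
    refine tendsto_integral_of_dominated_convergence (fun _ => A + 2 * M * A')
      (fun n => (hcont n).aestronglyMeasurable) (integrable_const _) ?_ ?_
    · intro n
      filter_upwards [ae_restrict_mem measurableSet_ball] with x hx
      have hx' := Metric.ball_subset_closedBall hx
      have hc1 : ‖cutoff d n x‖ ≤ 1 := by
        rw [cutoff, Complex.norm_real, Real.norm_of_nonneg (Real.smoothTransition.nonneg _)]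
        exact Real.smoothTransition.le_one _
      have hM0 : 0 ≤ M := (abs_nonneg _).trans (hM 0)
      calc ‖R n x‖ ≤ ‖cutoff d n x * K x‖ + ‖2 * ((κ (n * (1 - ‖x‖ ^ 2)) : ℝ) : ℂ) * Ψ x‖ :=
            norm_sub_le _ _
        _ = ‖cutoff d n x‖ * ‖K x‖ + 2 * |κ (n * (1 - ‖x‖ ^ 2))| * ‖Ψ x‖ := by
            simp only [norm_mul, Complex.norm_real, Real.norm_eq_abs, Complex.norm_ofNat]
        _ ≤ 1 * A + 2 * M * A' := by
            gcongr
            · exact hA x hx'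
            · exact hM _
            · exact hA' x hx'
        _ = _ := by ring
    · filter_upwards [ae_restrict_mem measurableSet_ball] with x hx
      have hx1 : 0 < 1 - ‖x‖ ^ 2 := by
        have : ‖x‖ < 1 := by simpa using hx
        nlinarith [norm_nonneg x]
      refine tendsto_const_nhds.congr' ?_
      have : Tendsto (fun n : ℕ => (n : ℝ) * (1 - ‖x‖ ^ 2)) atTop atTop :=
        tendsto_natCast_atTop_atTop.atTop_mul_const hx1
      -- Once `n(1 - |x|²) > 1`, the cutoff is locally constant equal to one, so the correction term
      -- vanishes.
      filter_upwards [this.eventually_gt_atTop 1] with n hn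
      have h1 : Real.smoothTransition =ᶠ[𝓝 (n * (1 - ‖x‖ ^ 2))] fun _ => 1 := by
        filter_upwards [Ioi_mem_nhds hn] with s hs
        exact Real.smoothTransition.one_of_one_le (le_of_lt hs)
      simp only [R, cutoff, hκdef]
      rw [h1.deriv_eq, deriv_const, Real.smoothTransition.one_of_one_le hn.le]
      simp
  simp_rw [hball] at hlim
  exact (tendsto_nhds_unique hlim tendsto_const_nhds)

/-! ### Harmonic decomposition of polynomials and density on the sphere -/

/-- The polynomial `|x|²`. -/
noncomputable def normSqPoly (d : ℕ) : MvPolynomial (Fin d) ℂ := ∑ i, MvPolynomial.X i ^ 2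

theorem polyLaplacian_apply {d : ℕ} (p : MvPolynomial (Fin d) ℂ) :
    polyLaplacian d p = ∑ i, MvPolynomial.pderiv i (MvPolynomial.pderiv i p) := by
  simp [polyLaplacian]

theorem pderiv_normSqPoly {d : ℕ} (i : Fin d) :
    MvPolynomial.pderiv i (normSqPoly d) = 2 * MvPolynomial.X i := by
  simp only [normSqPoly, map_sum, MvPolynomial.pderiv_pow, MvPolynomial.pderiv_X]
  rw [Finset.sum_eq_single i]
  · simp
  · intro j _ hj
    simp [hj]
  · simp

theorem isHomogeneous_normSqPoly (d : ℕ) : (normSqPoly d).IsHomogeneous 2 :=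
  MvPolynomial.IsHomogeneous.sum _ _ _ fun i _ => MvPolynomial.isHomogeneous_X_pow i 2

/-- The Leibniz rule produces the terms `4 x · ∇q` and `2d q`; Euler's identity turns the first into
`4n q`. -/
theorem polyLaplacian_normSqPoly_mul {d n : ℕ} {q : MvPolynomial (Fin d) ℂ}
    (hq : q.IsHomogeneous n) :
    polyLaplacian d (normSqPoly d * q) =
      normSqPoly d * polyLaplacian d q + ((4 * n + 2 * d : ℕ) : ℂ) • q := by
  have hE := hq.sum_X_mul_pderiv
  simp only [polyLaplacian_apply, Derivation.leibniz, pderiv_normSqPoly, map_add,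
    smul_eq_mul, MvPolynomial.pderiv_X_self]
  have h2 : ∀ i : Fin d, MvPolynomial.pderiv i (2 : MvPolynomial (Fin d) ℂ) = 0 := fun i => by
    have := MvPolynomial.pderiv_C (i := i) (a := (2 : ℂ))
    rwa [map_ofNat] at this
  have : ∀ i : Fin d,
      normSqPoly d * MvPolynomial.pderiv i (MvPolynomial.pderiv i q) +
        MvPolynomial.pderiv i q * (2 * MvPolynomial.X i) +
      (q * (2 * 1 + MvPolynomial.X i * MvPolynomial.pderiv i 2) +
        2 * MvPolynomial.X i * MvPolynomial.pderiv i q) =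
      normSqPoly d * MvPolynomial.pderiv i (MvPolynomial.pderiv i q) +
        4 * (MvPolynomial.X i * MvPolynomial.pderiv i q) + 2 * q := by
    intro i
    rw [h2]
    ring
  rw [Finset.sum_congr rfl fun i _ => this i, Finset.sum_add_distrib, Finset.sum_add_distrib,
    ← Finset.mul_sum, ← Finset.mul_sum, hE, add_assoc]
  congr 1
  simp only [Finset.sum_const, Finset.card_univ, Fintype.card_fin, nsmul_eq_mul]
  rw [Nat.cast_smul_eq_nsmul, nsmul_eq_mul]
  push_cast
  ring

/-- The constant is the sum of `4(2i + m) + 2d` over `i ≤ j`, one term for each factor `|x|²`. -/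
theorem polyLaplacian_normSqPoly_pow_mul {d m : ℕ} {h : MvPolynomial (Fin d) ℂ}
    (hh : h ∈ harmonicPolys d m) (j : ℕ) :
    polyLaplacian d (normSqPoly d ^ (j + 1) * h) =
      ((2 * (j + 1) * (2 * j + 2 * m + d) : ℕ) : ℂ) • (normSqPoly d ^ j * h) := by
  have hhom : ∀ j, (normSqPoly d ^ j * h).IsHomogeneous (2 * j + m) := fun j =>
    ((isHomogeneous_normSqPoly d).pow j).mul hh.1
  induction j with
  | zero =>
    have h0 : polyLaplacian d h = 0 := hh.2
    rw [pow_succ', mul_assoc, polyLaplacian_normSqPoly_mul (hhom 0)]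
    simp only [pow_zero, one_mul, h0, mul_zero, zero_add]
    congr 2
    ring
  | succ j ih =>
    rw [pow_succ', mul_assoc, polyLaplacian_normSqPoly_mul (hhom (j + 1)), ih, mul_smul_comm,
      ← mul_assoc, ← pow_succ', ← add_smul]
    congr 1
    push_cast
    ring

/-- The polynomials `∑ |x|^{2j} h_j` with `h_j` harmonic and homogeneous, `2j + deg h_j = n`. -/
noncomputable def harmonicSums (d n : ℕ) : Submodule ℂ (MvPolynomial (Fin d) ℂ) :=
  Submodule.span ℂ {q | ∃ j m h, h ∈ harmonicPolys d m ∧ 2 * j + m = n ∧ q = normSqPoly d ^ j * h}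

/-- The Laplacian sends each generator to a multiple of a generator two degrees lower, with a
nonzero constant because `d > 0`. -/
theorem exists_polyLaplacian_eq {d n : ℕ} (hd : 0 < d) {p : MvPolynomial (Fin d) ℂ}
    (hp : p ∈ harmonicSums d n) :
    ∃ q ∈ harmonicSums d (n + 2), polyLaplacian d q = p := by
  induction hp using Submodule.span_induction with
  | mem x hx =>
    obtain ⟨j, m, h, hh, hn, rfl⟩ := hx
    refine ⟨((2 * (j + 1) * (2 * j + 2 * m + d) : ℕ) : ℂ)⁻¹ • (normSqPoly d ^ (j + 1) * h),
      Submodule.smul_mem _ _ (Submodule.subset_span ⟨j + 1, m, h, hh, by omega, rfl⟩), ?_⟩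
    rw [map_smul, polyLaplacian_normSqPoly_pow_mul hh, inv_smul_smul₀]
    exact_mod_cast (by positivity : 2 * (j + 1) * (2 * j + 2 * m + d) ≠ 0)
  | zero => exact ⟨0, Submodule.zero_mem _, map_zero _⟩
  | add x y _ _ hx hy =>
    obtain ⟨a, ha, rfl⟩ := hx
    obtain ⟨b, hb, rfl⟩ := hy
    exact ⟨a + b, Submodule.add_mem _ ha hb, map_add _ _ _⟩
  | smul c x _ hx =>
    obtain ⟨a, ha, rfl⟩ := hx
    exact ⟨c • a, Submodule.smul_mem _ c ha, map_smul _ _ _⟩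

theorem isHomogeneous_of_mem_harmonicSums {d n : ℕ} {p : MvPolynomial (Fin d) ℂ}
    (hp : p ∈ harmonicSums d n) : p.IsHomogeneous n := by
  have : harmonicSums d n ≤ MvPolynomial.homogeneousSubmodule (Fin d) ℂ n := by
    refine Submodule.span_le.mpr ?_
    rintro q ⟨j, m, h, hh, hn, rfl⟩
    have := ((isHomogeneous_normSqPoly d).pow j).mul hh.1
    rw [hn] at this
    exact this
  exact this hp

theorem harmonicPolys_le_harmonicSums (d n : ℕ) : harmonicPolys d n ≤ harmonicSums d n := by
  intro h hh
  exact Submodule.subset_span ⟨0, n, h, hh, by omega, by simp⟩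

theorem isHomogeneous_polyLaplacian {d n : ℕ} {p : MvPolynomial (Fin d) ℂ}
    (hp : p.IsHomogeneous n) : (polyLaplacian d p).IsHomogeneous (n - 1 - 1) := by
  rw [polyLaplacian_apply]
  exact MvPolynomial.IsHomogeneous.sum _ _ _ fun i _ => hp.pderiv.pderiv

/-- By induction `Δp` is a harmonic sum, hence `Δp = Δq` for a harmonic sum `q` of the right degree,
and `p - q` is harmonic. Degrees below two are harmonic outright. -/
theorem mem_harmonicSums {d : ℕ} (hd : 0 < d) (n : ℕ) :
    ∀ p : MvPolynomial (Fin d) ℂ, p.IsHomogeneous n → p ∈ harmonicSums d n := by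
  induction n using Nat.strong_induction_on with
  | _ n ih =>
    intro p hp
    rcases lt_or_ge n 2 with hn | hn
    · refine harmonicPolys_le_harmonicSums d n ⟨hp, ?_⟩
      change polyLaplacian d p = 0
      rw [polyLaplacian_apply]
      refine Finset.sum_eq_zero fun i _ => ?_
      have h0 : (MvPolynomial.pderiv i p).IsHomogeneous 0 := by
        have := hp.pderiv (i := i)
        rwa [show n - 1 = 0 by omega] at this
      rw [MvPolynomial.totalDegree_eq_zero_iff_eq_C.mp (Nat.le_zero.mp h0.totalDegree_le),
        MvPolynomial.pderiv_C]
    · obtain ⟨k, rfl⟩ := Nat.exists_eq_add_of_le' hn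
      have h1 := ih k (by omega) _ (isHomogeneous_polyLaplacian hp)
      obtain ⟨q, hq, hqp⟩ := exists_polyLaplacian_eq hd h1
      have h2 : p - q ∈ harmonicPolys d (k + 2) := by
        refine ⟨Submodule.sub_mem _ hp (isHomogeneous_of_mem_harmonicSums hq), ?_⟩
        change polyLaplacian d (p - q) = 0
        rw [map_sub, hqp, sub_self]
      have := Submodule.add_mem _ (harmonicPolys_le_harmonicSums d _ h2) hq
      simpa using this

theorem aeval_sphereCoord_apply {d : ℕ} (p : MvPolynomial (Fin d) ℂ) (θ : Sphere d) :
    MvPolynomial.aeval (sphereCoord d) p θ =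
      MvPolynomial.eval (fun i => (((θ : Space d) i : ℝ) : ℂ)) p := by
  induction p using MvPolynomial.induction_on with
  | C a => simp
  | add p q hp hq => simp [hp, hq]
  | mul_X p i hp => simp [hp, sphereCoord]

theorem aeval_normSqPoly (d : ℕ) : MvPolynomial.aeval (sphereCoord d) (normSqPoly d) = 1 := by
  ext θ
  have h : ∑ i, (θ : Space d) i ^ 2 = 1 := by
    have := EuclideanSpace.norm_sq_eq (θ : Space d)
    rw [norm_eq_of_mem_sphere] at this
    simpa using this.symm
  simp only [normSqPoly, map_sum, map_pow, MvPolynomial.aeval_X]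
  simp only [ContinuousMap.coe_sum, Finset.sum_apply,
    ContinuousMap.one_apply, sphereCoord, ContinuousMap.coe_mk, Pi.pow_apply, ContinuousMap.coe_pow]
  exact_mod_cast h

/-- The factors `|x|²` in the harmonic decomposition become `1` on the sphere. -/
theorem restrictToSphere_mem_iSup {d : ℕ} (hd : 0 < d) (p : MvPolynomial (Fin d) ℂ) :
    restrictToSphere d p ∈ ⨆ ℓ, sphericalHarmonics d ℓ := by
  have hhom : ∀ n, ∀ p : MvPolynomial (Fin d) ℂ, p.IsHomogeneous n →
      restrictToSphere d p ∈ ⨆ ℓ, sphericalHarmonics d ℓ := by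
    intro n p hp
    have h : harmonicSums d n ≤
        (⨆ ℓ, sphericalHarmonics d ℓ).comap (restrictToSphere d) := by
      refine Submodule.span_le.mpr ?_
      rintro q ⟨j, m, h, hh, -, rfl⟩
      have h1 : restrictToSphere d (normSqPoly d ^ j * h) = restrictToSphere d h := by
        simp [restrictToSphere, aeval_normSqPoly]
      simp only [SetLike.mem_coe, Submodule.mem_comap, h1]
      exact Submodule.mem_iSup_of_mem m (Submodule.mem_map_of_mem hh)
    exact h (mem_harmonicSums hd n p hp)
  rw [← MvPolynomial.sum_homogeneousComponent p, map_sum]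
  exact Submodule.sum_mem _ fun i _ => hhom i _ (MvPolynomial.homogeneousComponent_isHomogeneous i p)

/-- The polynomial functions on the sphere. -/
noncomputable def spherePolys (d : ℕ) : StarSubalgebra ℂ C(Sphere d, ℂ) where
  toSubalgebra := (MvPolynomial.aeval (R := ℂ) (sphereCoord d)).range
  star_mem' := by
    rintro _ ⟨p, rfl⟩
    induction p using MvPolynomial.induction_on with
    | C a =>
      refine ⟨MvPolynomial.C (star a), ?_⟩
      ext θ
      simp
    | add p q hp hq =>
      have := Subalgebra.add_mem _ hp hq
      simpa using this
    | mul_X p i hp =>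
      have hs : star (sphereCoord d i) = sphereCoord d i := by
        ext θ
        simp [sphereCoord]
      have h2 : sphereCoord d i ∈ (MvPolynomial.aeval (R := ℂ) (sphereCoord d)).range :=
        ⟨MvPolynomial.X i, by simp⟩
      have := Subalgebra.mul_mem _ hp h2
      have h3 : star (MvPolynomial.aeval (sphereCoord d) (p * MvPolynomial.X i)) =
          star (MvPolynomial.aeval (sphereCoord d) p) * sphereCoord d i := by
        rw [map_mul, MvPolynomial.aeval_X, star_mul', hs]
      exact h3 ▸ this

/-- Stone-Weierstrass: the coordinate functions separate points. -/
theorem spherePolys_dense (d : ℕ) : (spherePolys d).topologicalClosure = ⊤ := by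
  refine ContinuousMap.starSubalgebra_topologicalClosure_eq_top_of_separatesPoints _ ?_
  intro x y hxy
  have : ∃ i, (x : Space d) i ≠ (y : Space d) i := by
    by_contra! h
    exact hxy (Subtype.ext (by ext i; exact h i))
  obtain ⟨i, hi⟩ := this
  refine ⟨_, ⟨sphereCoord d i, ⟨MvPolynomial.X i, by simp⟩, rfl⟩, ?_⟩
  simpa [sphereCoord] using hi

theorem iSup_sphericalHarmonics_dense {d : ℕ} (hd : 0 < d) :
    (⨆ ℓ, sphericalHarmonics d ℓ).topologicalClosure = ⊤ := by
  have h1 : DenseRange (ContinuousMap.toLp (E := ℂ) 2 (surfaceMeasure d) ℂ) :=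
    ContinuousMap.toLp_denseRange ℂ (surfaceMeasure d) ℂ (by norm_num)
  have h2 : Dense (spherePolys d : Set C(Sphere d, ℂ)) := by
    rw [dense_iff_closure_eq, ← StarSubalgebra.topologicalClosure_coe, spherePolys_dense]
    rfl
  have h3 := h1.dense_image (ContinuousMap.toLp (E := ℂ) 2 (surfaceMeasure d) ℂ).continuous h2
  rw [← Submodule.dense_iff_topologicalClosure_eq_top]
  refine h3.mono ?_
  rintro _ ⟨_, ⟨p, rfl⟩, rfl⟩
  exact restrictToSphere_mem_iSup hd p

/-! ### Alternating binomial sums and moments of the Jacobi polynomials -/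

theorem sum_alternating_choose_eq_fwdDiff (f : ℝ → ℝ) (k : ℕ) (x : ℝ) :
    ∑ q ∈ Finset.range (k + 1), (-1 : ℝ) ^ q * (k.choose q : ℝ) * f (x + q) =
      (-1) ^ k * (fwdDiff 1)^[k] f x := by
  rw [fwdDiff_iter_eq_sum_shift, Finset.mul_sum]
  refine Finset.sum_congr rfl fun q hq => ?_
  have hqk : q ≤ k := Nat.lt_succ_iff.mp (Finset.mem_range.mp hq)
  obtain ⟨j, rfl⟩ := Nat.exists_eq_add_of_le hqk
  rw [Nat.add_sub_cancel_left, zsmul_eq_mul, pow_add, nsmul_eq_mul, mul_one]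
  push_cast
  have : ((-1 : ℝ) ^ j) * (-1) ^ j = 1 := by rw [← mul_pow]; simp
  linear_combination (-(-1 : ℝ) ^ q * ((q + j).choose q : ℝ) * f (x + q)) * this

theorem fwdDiff_iter_inv (k : ℕ) (x : ℝ) (hx : 0 < x) :
    (fwdDiff (1 : ℝ))^[k] (fun y : ℝ => y⁻¹) x =
      (-1) ^ k * k.factorial / ∏ i ∈ Finset.range (k + 1), (x + i) := by
  induction k generalizing x with
  | zero => simp
  | succ k ih =>
    rw [Function.iterate_succ_apply', fwdDiff, ih x hx, ih (x + 1) (by linarith)]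
    have h1 : ∏ i ∈ Finset.range (k + 1), (x + 1 + (i : ℝ)) =
        ∏ i ∈ Finset.range (k + 1), (x + ((i + 1 : ℕ) : ℝ)) :=
      Finset.prod_congr rfl fun i _ => by push_cast; ring
    -- Both denominators divide the product of `k + 2` factors: one lacks the factor `x`, the other
    -- the factor `x + k + 1`. The difference of these two factors is the new `k + 1` in the
    -- factorial.
    have h2 : ∏ i ∈ Finset.range (k + 2), (x + (i : ℝ)) =
        (∏ i ∈ Finset.range (k + 1), (x + 1 + (i : ℝ))) * x := by
      rw [Finset.prod_range_succ', h1]; simp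
    have h3 : ∏ i ∈ Finset.range (k + 2), (x + (i : ℝ)) =
        (∏ i ∈ Finset.range (k + 1), (x + (i : ℝ))) * (x + (k + 1 : ℕ)) := by
      rw [Finset.prod_range_succ]
    have p1 : 0 < ∏ i ∈ Finset.range (k + 1), (x + 1 + (i : ℝ)) :=
      Finset.prod_pos fun i _ => by positivity
    have p2 : 0 < ∏ i ∈ Finset.range (k + 1), (x + (i : ℝ)) :=
      Finset.prod_pos fun i _ => by positivity
    have p3 : 0 < ∏ i ∈ Finset.range (k + 2), (x + (i : ℝ)) :=
      Finset.prod_pos fun i _ => by positivity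
    rw [div_sub_div _ _ p1.ne' p2.ne', div_eq_div_iff (mul_pos p1 p2).ne' p3.ne',
      Nat.factorial_succ]
    have h4 := h2.symm.trans h3
    push_cast at h3 h4 ⊢
    rw [h3]
    linear_combination (-(-1 : ℝ) ^ k * k.factorial *
      (∏ i ∈ Finset.range (k + 1), (x + (i : ℝ)))) * h4

theorem sum_alternating_choose_inv (k : ℕ) (x : ℝ) (hx : 0 < x) :
    ∑ q ∈ Finset.range (k + 1), (-1 : ℝ) ^ q * (k.choose q : ℝ) * (x + q)⁻¹ =
      k.factorial / ∏ i ∈ Finset.range (k + 1), (x + i) := by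
  rw [sum_alternating_choose_eq_fwdDiff (fun y => y⁻¹), fwdDiff_iter_inv k x hx, mul_div_assoc,
    ← mul_assoc, ← mul_pow]
  simp

/-- The `k`-th difference annihilates polynomials of degree below `k`. -/
theorem sum_alternating_choose_prod_eq_zero {k m : ℕ} (hm : m < k) (a : ℝ) :
    ∑ q ∈ Finset.range (k + 1), (-1 : ℝ) ^ q * (k.choose q : ℝ) *
      ∏ i ∈ Finset.range m, ((q : ℝ) + a + i) = 0 := by
  set P : Polynomial ℝ := ∏ i ∈ Finset.range m, (Polynomial.X + Polynomial.C (a + i)) with hP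
  have hdeg : P.natDegree < k := by
    refine lt_of_le_of_lt ((Polynomial.natDegree_prod_le _ _).trans ?_) hm
    simp_rw [Polynomial.natDegree_X_add_C]
    simp
  have h := sum_alternating_choose_eq_fwdDiff P.eval k 0
  rw [Polynomial.fwdDiff_iter_eq_zero_of_degree_lt hdeg] at h
  simp only [Pi.zero_apply, mul_zero, zero_add] at h
  rw [← h]
  refine Finset.sum_congr rfl fun q _ => ?_
  rw [hP, Polynomial.eval_prod]
  simp [add_assoc]

/-- A partial fraction identity: with `Q(q)` the product in the numerator, the sum equals `Q(-x)`
times its value for `Q = 1`, as long as `deg Q ≤ k`. -/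
theorem sum_alternating_choose_prod_div {k m : ℕ} (hm : m ≤ k) (a x : ℝ) (hx : 0 < x) :
    ∑ q ∈ Finset.range (k + 1), (-1 : ℝ) ^ q * (k.choose q : ℝ) *
      (∏ i ∈ Finset.range m, ((q : ℝ) + a + i)) * (x + q)⁻¹ =
      (∏ i ∈ Finset.range m, (a - x + i)) *
        (k.factorial / ∏ i ∈ Finset.range (k + 1), (x + i)) := by
  induction m with
  | zero => simpa using sum_alternating_choose_inv k x hx
  | succ m ih =>
    rw [Finset.prod_range_succ, mul_right_comm, ← ih (by omega), Finset.sum_mul]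
    -- The new factor is `(a - x + m) + (x + q)`. Its second summand cancels the denominator and
    -- leaves a polynomial of degree `m < k`, which contributes nothing.
    have h0 := sum_alternating_choose_prod_eq_zero (show m < k by omega) a
    rw [← add_zero (∑ q ∈ Finset.range (k + 1), _ * (a - x + m)), ← h0, ← Finset.sum_add_distrib]
    refine Finset.sum_congr rfl fun q _ => ?_
    have : x + q ≠ 0 := by positivity
    rw [Finset.prod_range_succ]
    field_simp
    ring

theorem continuous_jacobiP (d k : ℕ) : Continuous (jacobiP d k) := by
  unfold jacobiP
  fun_prop

theorem choose_eq_prod_div {d : ℕ} (hd : 0 < d) (k q : ℕ) :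
    ((k + q + d - 1).choose k : ℝ) = (∏ i ∈ Finset.range k, ((q : ℝ) + d + i)) / k.factorial := by
  have h := Nat.ascFactorial_eq_factorial_mul_choose' (q + d) k
  rw [Nat.ascFactorial_eq_prod_range, show q + d + k - 1 = k + q + d - 1 by omega] at h
  have h' : (∏ i ∈ Finset.range k, ((q : ℝ) + d + i)) =
      k.factorial * ((k + q + d - 1).choose k : ℝ) := by exact_mod_cast h
  rw [h']
  field_simp

/-- The moments of the Jacobi polynomials. -/
theorem integral_pow_mul_jacobiP {d : ℕ} (hd : 0 < d) (n k : ℕ) :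
    ∫ r in (0 : ℝ)..1, r ^ n * jacobiP d k r * r ^ (d - 1) =
      √(2 * k + d) * ((∏ i ∈ Finset.range k, (-(n : ℝ) + i)) /
        ∏ i ∈ Finset.range (k + 1), ((n : ℝ) + d + i)) := by
  have h1 : ∀ r : ℝ, r ^ n * jacobiP d k r * r ^ (d - 1) =
      ∑ q ∈ Finset.range (k + 1), (√(2 * k + d) * ((-1 : ℝ) ^ q * (k.choose q : ℝ) *
        ((k + q + d - 1).choose k : ℝ))) * r ^ (n + q + d - 1) := by
    intro r
    rw [jacobiP, mul_left_comm, Finset.mul_sum, Finset.mul_sum, Finset.sum_mul]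
    refine Finset.sum_congr rfl fun q _ => ?_
    rw [show n + q + d - 1 = n + q + (d - 1) by omega, pow_add, pow_add]
    ring
  simp_rw [h1]
  rw [intervalIntegral.integral_finsetSum
    (fun q _ => (Continuous.intervalIntegrable (by fun_prop) _ _))]
  -- Integration turns `r^(n+q+d-1)` into `1/(n + d + q)`, and the second binomial in `P_k` is a
  -- product of `k` linear factors in `q`. With `a - x = -n`, the numerator vanishes exactly when `n
  -- < k`.
  have h2 := sum_alternating_choose_prod_div (le_refl k) (d : ℝ) (n + d) (by positivity)
  have h3 : ∀ i ∈ Finset.range k, (-(n : ℝ) + i) = (d : ℝ) - (n + d) + i := fun i _ => by ring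
  rw [Finset.prod_congr rfl h3]
  have h4 : ∀ (A B : ℝ), A / B = (A * (k.factorial / B)) / k.factorial := by
    intro A B; field_simp
  rw [h4, ← h2, Finset.sum_div, Finset.mul_sum]
  refine Finset.sum_congr rfl fun q _ => ?_
  rw [intervalIntegral.integral_const_mul, integral_pow, choose_eq_prod_div hd]
  have h5 : ((n + q + d - 1 : ℕ) : ℝ) + 1 = n + d + q := by
    have : n + q + d - 1 + 1 = n + d + q := by omega
    exact_mod_cast this
  rw [h5, show n + q + d - 1 + 1 = (n + q + d - 1).succ from rfl]
  simp only [one_pow, zero_pow (Nat.succ_ne_zero _), sub_zero]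
  field_simp

theorem integral_pow_mul_jacobiP_of_lt {d : ℕ} (hd : 0 < d) {n k : ℕ} (h : n < k) :
    ∫ r in (0 : ℝ)..1, r ^ n * jacobiP d k r * r ^ (d - 1) = 0 := by
  rw [integral_pow_mul_jacobiP hd, Finset.prod_eq_zero (Finset.mem_range.mpr h) (by simp)]
  simp

theorem integral_pow_mul_jacobiP_of_le {d : ℕ} (hd : 0 < d) {n k : ℕ} (h : k ≤ n) :
    ∫ r in (0 : ℝ)..1, r ^ n * jacobiP d k r * r ^ (d - 1) =
      (-1) ^ k * √(2 * k + d) * ((n + d - 1).factorial * n.factorial /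
        ((n + d + k).factorial * (n - k).factorial)) := by
  rw [integral_pow_mul_jacobiP hd]
  have h1 : (∏ i ∈ Finset.range k, (-(n : ℝ) + i)) = (-1) ^ k * (n.descFactorial k : ℝ) := by
    have hpow : (-1 : ℝ) ^ k = ∏ _i ∈ Finset.range k, (-1 : ℝ) := by
      rw [Finset.prod_const, Finset.card_range]
    rw [Nat.descFactorial_eq_prod_range, Nat.cast_prod, hpow, ← Finset.prod_mul_distrib]
    refine Finset.prod_congr rfl fun i hi => ?_
    have : i ≤ n := (Finset.mem_range.mp hi).le.trans h
    push_cast [this]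
    ring
  have h2 : (∏ i ∈ Finset.range (k + 1), ((n : ℝ) + d + i)) = ((n + d).ascFactorial (k + 1) : ℝ) := by
    rw [Nat.ascFactorial_eq_prod_range]; push_cast; rfl
  have h3 : ((n - k).factorial : ℝ) * (n.descFactorial k : ℝ) = n.factorial := by
    exact_mod_cast Nat.factorial_mul_descFactorial h
  have h4 : ((n + d - 1).factorial : ℝ) * ((n + d).ascFactorial (k + 1) : ℝ) =
      (n + d + k).factorial := by
    exact_mod_cast Nat.factorial_mul_ascFactorial' (n + d) (k + 1) (by omega)
  rw [h1, h2, ← h3, ← h4]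
  have p1 : ((n - k).factorial : ℝ) ≠ 0 := by positivity
  have p2 : ((n + d - 1).factorial : ℝ) ≠ 0 := by positivity
  have p3 : ((n + d).ascFactorial (k + 1) : ℝ) ≠ 0 := by
    intro h0
    rw [h0, mul_zero] at h4
    exact (by positivity : ((n + d + k).factorial : ℝ) ≠ 0) h4.symm
  field_simp

theorem integral_jacobiP_mul_of_lt {d : ℕ} (hd : 0 < d) {j k : ℕ} (h : j < k) :
    ∫ r in (0 : ℝ)..1, jacobiP d j r * jacobiP d k r * r ^ (d - 1) = 0 := by
  have hc := continuous_jacobiP d k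
  have h1 : ∀ r : ℝ, jacobiP d j r * jacobiP d k r * r ^ (d - 1) =
      ∑ q ∈ Finset.range (j + 1), (√(2 * j + d) * ((-1 : ℝ) ^ q * (j.choose q : ℝ) *
        ((j + q + d - 1).choose j : ℝ))) * (r ^ q * jacobiP d k r * r ^ (d - 1)) := by
    intro r
    rw [jacobiP.eq_def d j, Finset.mul_sum, Finset.sum_mul, Finset.sum_mul]
    exact Finset.sum_congr rfl fun q _ => by ring
  simp_rw [h1]
  rw [intervalIntegral.integral_finsetSum
    (fun q _ => (Continuous.intervalIntegrable (by fun_prop) _ _))]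
  refine Finset.sum_eq_zero fun q hq => ?_
  rw [intervalIntegral.integral_const_mul, integral_pow_mul_jacobiP_of_lt hd, mul_zero]
  have := Finset.mem_range.mp hq
  omega

/-- Only the leading monomial of one factor pairs nontrivially with `P_k`, so the integral is the
leading coefficient times the `k`-th moment. The factor `√(2k + d)` in `P_k` makes this one. -/
theorem integral_jacobiP_mul_self {d : ℕ} (hd : 0 < d) (k : ℕ) :
    ∫ r in (0 : ℝ)..1, jacobiP d k r * jacobiP d k r * r ^ (d - 1) = 1 := by
  have hc := continuous_jacobiP d k
  have h1 : ∀ r : ℝ, jacobiP d k r * jacobiP d k r * r ^ (d - 1) =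
      ∑ q ∈ Finset.range (k + 1), (√(2 * k + d) * ((-1 : ℝ) ^ q * (k.choose q : ℝ) *
        ((k + q + d - 1).choose k : ℝ))) * (r ^ q * jacobiP d k r * r ^ (d - 1)) := by
    intro r
    nth_rw 1 [jacobiP]
    rw [Finset.mul_sum, Finset.sum_mul, Finset.sum_mul]
    exact Finset.sum_congr rfl fun q _ => by ring
  simp_rw [h1]
  rw [intervalIntegral.integral_finsetSum
    (fun q _ => (Continuous.intervalIntegrable (by fun_prop) _ _)), Finset.sum_range_succ,
    Finset.sum_eq_zero, zero_add, intervalIntegral.integral_const_mul,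
    integral_pow_mul_jacobiP_of_le hd le_rfl]
  · have hs : √(2 * (k : ℝ) + d) * √(2 * (k : ℝ) + d) = 2 * k + d :=
      Real.mul_self_sqrt (by positivity)
    have hch : ((k + k + d - 1).choose k : ℝ) * (k.factorial * (k + d - 1).factorial) =
        (k + k + d - 1).factorial := by
      have := Nat.choose_mul_factorial_mul_factorial (show k ≤ k + k + d - 1 by omega)
      rw [show k + k + d - 1 - k = k + d - 1 by omega] at this
      rw [← mul_assoc]
      exact_mod_cast this
    have hf : ((k + d + k).factorial : ℝ) = (2 * k + d) * (k + k + d - 1).factorial := by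
      rw [show k + d + k = (k + k + d - 1) + 1 by omega, Nat.factorial_succ,
        show k + k + d - 1 + 1 = 2 * k + d by omega]
      push_cast
      ring
    have hpow : ((-1 : ℝ) ^ k) * (-1) ^ k = 1 := by rw [← mul_pow]; simp
    have p : ((k + k + d - 1).factorial : ℝ) ≠ 0 := by positivity
    have p' : (2 * (k : ℝ) + d) ≠ 0 := by positivity
    rw [Nat.sub_self, Nat.factorial_zero, Nat.cast_one, mul_one, Nat.choose_self, Nat.cast_one,
      mul_one, hf]
    rw [← mul_div_assoc, ← mul_div_assoc, div_eq_one_iff_eq (by positivity)]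
    linear_combination (2 * (k : ℝ) + d) * hch + ((k + k + d - 1).choose k : ℝ) *
      (k.factorial * (k + d - 1).factorial) * ((-1) ^ k * (-1) ^ k * hs + (2 * (k : ℝ) + d) * hpow)
  · intro q hq
    rw [intervalIntegral.integral_const_mul, integral_pow_mul_jacobiP_of_lt hd
      (Finset.mem_range.mp hq), mul_zero]

theorem integral_jacobiP_mul {d : ℕ} (hd : 0 < d) (j k : ℕ) :
    ∫ r in (0 : ℝ)..1, jacobiP d j r * jacobiP d k r * r ^ (d - 1) = if j = k then 1 else 0 := by
  rcases lt_trichotomy j k with h | h | h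
  · rw [integral_jacobiP_mul_of_lt hd h, if_neg h.ne]
  · subst h
    rw [integral_jacobiP_mul_self hd, if_pos rfl]
  · rw [if_neg h.ne']
    refine Eq.trans ?_ (integral_jacobiP_mul_of_lt hd h)
    exact intervalIntegral.integral_congr fun r _ => by ring

/-- The change of basis is triangular with nonzero diagonal, the leading coefficients of the `P_k`.
-/
theorem pow_mem_span_jacobiP {d : ℕ} (hd : 0 < d) (n : ℕ) :
    (fun r : ℝ => r ^ n) ∈ Submodule.span ℝ (jacobiP d '' (Finset.range (n + 1))) := by
  induction n using Nat.strong_induction_on with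
  | _ n ih =>
    set c : ℕ → ℝ := fun q => √(2 * n + d) * ((-1 : ℝ) ^ q * (n.choose q : ℝ) *
        ((n + q + d - 1).choose n : ℝ)) with hcdef
    have hc : c n ≠ 0 := by
      have h1 : 0 < (n + n + d - 1).choose n := Nat.choose_pos (by omega)
      have h2 : 0 < √(2 * (n : ℝ) + d) := Real.sqrt_pos.mpr (by positivity)
      have h3 : ((-1 : ℝ)) ^ n ≠ 0 := pow_ne_zero _ (by norm_num)
      simp only [hcdef, Nat.choose_self, Nat.cast_one, mul_one]
      have : ((n + n + d - 1).choose n : ℝ) ≠ 0 := by exact_mod_cast h1.ne'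
      exact mul_ne_zero h2.ne' (mul_ne_zero h3 this)
    have h : (fun r : ℝ => r ^ n) =
        (c n)⁻¹ • (jacobiP d n - ∑ q ∈ Finset.range n, c q • fun r : ℝ => r ^ q) := by
      ext r
      have : jacobiP d n r = ∑ q ∈ Finset.range n, c q * r ^ q + c n * r ^ n := by
        rw [← Finset.sum_range_succ (fun q => c q * r ^ q), jacobiP, Finset.mul_sum]
        exact Finset.sum_congr rfl fun q _ => by simp only [hcdef]; ring
      simp only [Pi.smul_apply, Pi.sub_apply, Finset.sum_apply, smul_eq_mul, this]
      field_simp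
      ring
    rw [h]
    refine Submodule.smul_mem _ _ (Submodule.sub_mem _ (Submodule.subset_span
      ⟨n, by simp, rfl⟩) (Submodule.sum_mem _ fun q hq => Submodule.smul_mem _ _ ?_))
    have hq' := Finset.mem_range.mp hq
    refine Submodule.span_mono (Set.image_mono ?_) (ih q hq')
    intro i hi
    simp only [Finset.coe_range, Set.mem_Iio] at hi ⊢
    omega

/-- The expansion of the monomials in Jacobi polynomials. -/
theorem pow_eq_sum_jacobiP {d : ℕ} (hd : 0 < d) (n : ℕ) (r : ℝ) :
    (n + d) * r ^ n = ∑ k ∈ Finset.range (n + 1), (-1) ^ k * √(2 * k + d) *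
      ((n + d).factorial * n.factorial / ((n + d + k).factorial * (n - k).factorial)) *
        jacobiP d k r := by
  obtain ⟨c, hc⟩ := Submodule.mem_span_image_finset_iff_exists_fun' (R := ℝ) |>.mp
    (pow_mem_span_jacobiP hd n)
  have hcr : ∀ r : ℝ, r ^ n = ∑ j ∈ Finset.range (n + 1), c j * jacobiP d j r := by
    intro r
    have := congrFun hc r
    simpa using this.symm
  -- Orthonormality identifies each coefficient with a moment already computed.
  have hck : ∀ k ∈ Finset.range (n + 1), c k = (-1) ^ k * √(2 * k + d) *
      ((n + d - 1).factorial * n.factorial / ((n + d + k).factorial * (n - k).factorial)) := by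
    intro k hk
    have hk' := Nat.lt_succ_iff.mp (Finset.mem_range.mp hk)
    rw [← integral_pow_mul_jacobiP_of_le hd hk']
    have : ∀ r : ℝ, r ^ n * jacobiP d k r * r ^ (d - 1) = ∑ j ∈ Finset.range (n + 1),
        c j * (jacobiP d j r * jacobiP d k r * r ^ (d - 1)) := by
      intro r
      rw [hcr r, Finset.sum_mul, Finset.sum_mul]
      exact Finset.sum_congr rfl fun j _ => by ring
    simp_rw [this]
    rw [intervalIntegral.integral_finsetSum]
    · simp_rw [intervalIntegral.integral_const_mul, integral_jacobiP_mul hd]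
      simp only [mul_ite, mul_one, mul_zero, Finset.sum_ite_eq']
      rw [if_pos hk]
    · intro j _
      have h1 := continuous_jacobiP d k
      have h2 := continuous_jacobiP d j
      exact Continuous.intervalIntegrable (by fun_prop) _ _
  rw [hcr r, Finset.mul_sum]
  refine Finset.sum_congr rfl fun k hk => ?_
  rw [hck k hk]
  -- The prefactor `n + d` on the left-hand side completes `(n + d - 1)!` to `(n + d)!`; it is the
  -- factor `2ℓ - 2 + d` of the eigenvalue.
  have : ((n + d).factorial : ℝ) = (n + d) * (n + d - 1).factorial := by
    rw [← Nat.mul_factorial_pred (show n + d ≠ 0 by omega)]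
    push_cast
    ring
  rw [this]
  ring

/-! ### The Jacobi expansion of radial functions -/

/-- The surface area of the unit sphere. -/
noncomputable def sphereArea (d : ℕ) : ℝ := (surfaceMeasure d).real Set.univ

theorem sphereArea_pos {d : ℕ} (hd : 0 < d) : 0 < sphereArea d := by
  have := nontrivial_space hd
  rw [sphereArea, measureReal_def, ENNReal.toReal_pos_iff]
  refine ⟨?_, measure_lt_top _ _⟩
  rw [Measure.measure_univ_pos]
  exact Measure.toSphere_ne_zero _

theorem integral_ball_radial {d : ℕ} (hd : 0 < d) (h : ℝ → ℂ) :
    ∫ x, h ‖x‖ ∂ballMeasure d =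
      sphereArea d * ∫ r in (0 : ℝ)..1, h r * ((r ^ (d - 1) : ℝ) : ℂ) := by
  have := integral_ball_radial_mul hd h (fun _ => 1) 0 (by simp)
  simp only [mul_one, pow_zero] at this
  rw [this, mul_comm]
  simp [sphereArea]

theorem intervalIntegrable_radial {d : ℕ} (hd : 0 < d) {h : ℝ → ℂ}
    (hi : Integrable (fun x => h ‖x‖) (ballMeasure d)) :
    IntervalIntegrable (fun r => h r * ((r ^ (d - 1) : ℝ) : ℂ)) volume 0 1 := by
  have := nontrivial_space hd
  have h1 := (integrableOn_fun_norm_addHaar (volume : Measure (Space d)) (f := h) (r := 1)).mp hi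
  rw [intervalIntegrable_iff_integrableOn_Ioo_of_le zero_le_one]
  rw [finrank_euclideanSpace_fin] at h1
  refine h1.congr_fun (fun r _ => ?_) measurableSet_Ioo
  simp only [Complex.real_smul]
  ring

theorem memLp_radial {d : ℕ} (ψ : C(ℝ, ℂ)) (p : ℝ≥0∞) :
    MemLp (fun x : Space d => ψ ‖x‖) p (ballMeasure d) := by
  obtain ⟨C, hC⟩ := (isCompact_Icc (a := (0 : ℝ)) (b := 1)).exists_bound_of_continuousOn
    ψ.continuous.continuousOn
  refine MemLp.of_bound (by fun_prop) C ?_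
  filter_upwards [ae_restrict_mem measurableSet_ball] with x hx
  have : ‖x‖ < 1 := by simpa using hx
  exact hC _ ⟨norm_nonneg _, this.le⟩

/-- The radial function on the ball with a continuous profile. -/
noncomputable def radialLp (d : ℕ) : C(ℝ, ℂ) →ₗ[ℂ] L2Ball d where
  toFun ψ := (memLp_radial ψ 2).toLp _
  map_add' _ _ := rfl
  map_smul' _ _ := rfl

theorem coeFn_radialLp {d : ℕ} (ψ : C(ℝ, ℂ)) :
    radialLp d ψ =ᵐ[ballMeasure d] fun x => ψ ‖x‖ :=
  MemLp.coeFn_toLp (memLp_radial ψ 2)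

theorem isRadialProfile_radialLp {d : ℕ} (ψ : C(ℝ, ℂ)) : IsRadialProfile ψ (radialLp d ψ) :=
  ⟨ψ.continuous.measurable, coeFn_radialLp ψ⟩

theorem norm_radialLp_le {d : ℕ} (ψ : C(ℝ, ℂ)) (ε : ℝ) (hε : 0 ≤ ε)
    (h : ∀ r ∈ Set.Icc (0 : ℝ) 1, ‖ψ r‖ ≤ ε) :
    ‖radialLp d ψ‖ ≤ (measureUnivNNReal (ballMeasure d)) ^ (2 : ℝ≥0∞).toReal⁻¹ * ε := by
  refine Lp.norm_le_of_ae_bound hε ?_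
  filter_upwards [coeFn_radialLp ψ, ae_restrict_mem measurableSet_ball] with x hx hxb
  rw [hx]
  have : ‖x‖ < 1 := by simpa using hxb
  exact h _ ⟨norm_nonneg _, this.le⟩

theorem integrable_profile_mul {d : ℕ} {h : ℝ → ℂ} {η : L2Ball d} (hη : IsRadialProfile h η)
    (ψ : C(ℝ, ℂ)) : Integrable (fun x => h ‖x‖ * ψ ‖x‖) (ballMeasure d) := by
  have h1 : Integrable (fun x => η x * ψ ‖x‖) (ballMeasure d) :=
    (Lp.memLp η).integrable_mul (memLp_radial ψ 2)
  refine h1.congr ?_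
  filter_upwards [hη.2] with x hx
  rw [hx]

theorem intervalIntegrable_profile_mul {d : ℕ} (hd : 0 < d) {h : ℝ → ℂ} {η : L2Ball d}
    (hη : IsRadialProfile h η) (ψ : C(ℝ, ℂ)) :
    IntervalIntegrable (fun r => h r * ψ r * ((r ^ (d - 1) : ℝ) : ℂ)) volume 0 1 :=
  intervalIntegrable_radial hd (h := fun r => h r * ψ r) (integrable_profile_mul hη ψ)

theorem inner_radialLp {d : ℕ} (hd : 0 < d) {h : ℝ → ℂ} {η : L2Ball d}
    (hη : IsRadialProfile h η) (ψ : C(ℝ, ℂ)) :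
    inner ℂ (radialLp d ψ) η =
      sphereArea d * ∫ r in (0 : ℝ)..1, h r * star (ψ r) * ((r ^ (d - 1) : ℝ) : ℂ) := by
  rw [← integral_ball_radial hd (fun r => h r * star (ψ r)), L2.inner_def]
  refine integral_congr_ae ?_
  filter_upwards [coeFn_radialLp ψ, hη.2] with x h1 h2
  rw [h1, h2]
  rfl

/-- The Jacobi polynomials as complex-valued functions. -/
noncomputable def jacobiC (d k : ℕ) : C(ℝ, ℂ) :=
  ⟨fun r => (jacobiP d k r : ℂ), Complex.continuous_ofReal.comp (continuous_jacobiP d k)⟩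

/-- The monomials as complex-valued functions. -/
noncomputable def monomialC (n : ℕ) : C(ℝ, ℂ) := ⟨fun r => (r : ℂ) ^ n, by fun_prop⟩

theorem inner_radialLp_jacobiC {d : ℕ} (hd : 0 < d) {h : ℝ → ℂ} {η : L2Ball d}
    (hη : IsRadialProfile h η) (k : ℕ) :
    inner ℂ (radialLp d (jacobiC d k)) η = sphereArea d * jacobiCoeff d k h := by
  rw [inner_radialLp hd hη, jacobiCoeff]
  simp [jacobiC]

/-- The normalized Jacobi polynomials as radial functions on the ball. -/
noncomputable def jacobiLp (d k : ℕ) : L2Ball d :=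
  ((√(sphereArea d) : ℝ) : ℂ)⁻¹ • radialLp d (jacobiC d k)

theorem inner_jacobiLp {d : ℕ} (hd : 0 < d) {h : ℝ → ℂ} {η : L2Ball d}
    (hη : IsRadialProfile h η) (k : ℕ) :
    inner ℂ (jacobiLp d k) η = ((√(sphereArea d) : ℝ) : ℂ) * jacobiCoeff d k h := by
  have h0 : ((√(sphereArea d) : ℝ) : ℂ) ≠ 0 := by
    exact_mod_cast (Real.sqrt_pos.mpr (sphereArea_pos hd)).ne'
  have h1 : ((√(sphereArea d) : ℝ) : ℂ) * ((√(sphereArea d) : ℝ) : ℂ) = sphereArea d := by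
    exact_mod_cast Real.mul_self_sqrt (sphereArea_pos hd).le
  rw [jacobiLp, inner_smul_left, inner_radialLp_jacobiC hd hη, map_inv₀, Complex.conj_ofReal, ← h1]
  field_simp

theorem inner_jacobiLp_smul {d : ℕ} (hd : 0 < d) {h : ℝ → ℂ} {η : L2Ball d}
    (hη : IsRadialProfile h η) (k : ℕ) :
    inner ℂ (jacobiLp d k) η • jacobiLp d k = jacobiCoeff d k h • radialLp d (jacobiC d k) := by
  have h0 : ((√(sphereArea d) : ℝ) : ℂ) ≠ 0 := by
    exact_mod_cast (Real.sqrt_pos.mpr (sphereArea_pos hd)).ne'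
  rw [inner_jacobiLp hd hη, jacobiLp, smul_smul]
  congr 1
  field_simp

theorem jacobiCoeff_jacobiC {d : ℕ} (hd : 0 < d) (j k : ℕ) :
    jacobiCoeff d j (jacobiC d k) = if j = k then 1 else 0 := by
  have h := integral_jacobiP_mul hd k j
  simp only [eq_comm (a := k)] at h
  rw [jacobiCoeff]
  have : ∀ r : ℝ, jacobiC d k r * (jacobiP d j r : ℂ) * ((r ^ (d - 1) : ℝ) : ℂ) =
      ((jacobiP d k r * jacobiP d j r * r ^ (d - 1) : ℝ) : ℂ) := by
    intro r
    simp [jacobiC]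
  simp_rw [this]
  rw [intervalIntegral.integral_ofReal, h]
  split_ifs <;> simp

theorem orthonormal_jacobiLp {d : ℕ} (hd : 0 < d) : Orthonormal ℂ (jacobiLp d) := by
  have h0 : ((√(sphereArea d) : ℝ) : ℂ) ≠ 0 := by
    exact_mod_cast (Real.sqrt_pos.mpr (sphereArea_pos hd)).ne'
  classical
  rw [orthonormal_iff_ite]
  intro j k
  conv_lhs => rw [jacobiLp.eq_def d k]
  rw [inner_smul_right, inner_jacobiLp hd (isRadialProfile_radialLp _), jacobiCoeff_jacobiC hd]
  field_simp

theorem radialLp_monomialC_mem_span {d : ℕ} (hd : 0 < d) (n : ℕ) :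
    radialLp d (monomialC n) ∈ Submodule.span ℂ (Set.range (jacobiLp d)) := by
  have h0 : ((√(sphereArea d) : ℝ) : ℂ) ≠ 0 := by
    exact_mod_cast (Real.sqrt_pos.mpr (sphereArea_pos hd)).ne'
  have h1 : ∀ k, radialLp d (jacobiC d k) ∈ Submodule.span ℂ (Set.range (jacobiLp d)) := by
    intro k
    have : radialLp d (jacobiC d k) = ((√(sphereArea d) : ℝ) : ℂ) • jacobiLp d k := by
      rw [jacobiLp, smul_inv_smul₀ h0]
    rw [this]
    exact Submodule.smul_mem _ _ (Submodule.subset_span ⟨k, rfl⟩)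
  have h2 : (((n + d : ℝ) : ℂ)) ≠ 0 := by
    have : (n + d : ℝ) ≠ 0 := by positivity
    exact_mod_cast this
  have h3 : monomialC n = (((n + d : ℝ) : ℂ))⁻¹ • ∑ k ∈ Finset.range (n + 1),
      (((-1) ^ k * √(2 * k + d) * ((n + d).factorial * n.factorial /
        ((n + d + k).factorial * (n - k).factorial)) : ℝ) : ℂ) • jacobiC d k := by
    rw [eq_inv_smul_iff₀ h2]
    ext r
    have := pow_eq_sum_jacobiP hd n r
    simp only [ContinuousMap.smul_apply, ContinuousMap.coe_sum, Finset.sum_apply, monomialC,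
      jacobiC, ContinuousMap.coe_mk, smul_eq_mul]
    exact_mod_cast congrArg (fun t : ℝ => (t : ℂ)) this
  rw [h3, map_smul, map_sum]
  refine Submodule.smul_mem _ _ (Submodule.sum_mem _ fun k _ => ?_)
  rw [map_smul]
  exact Submodule.smul_mem _ _ (h1 k)

/-- A real polynomial as a complex-valued function. -/
noncomputable def polyC (p : Polynomial ℝ) : C(ℝ, ℂ) :=
  ⟨fun r => ((p.eval r : ℝ) : ℂ), Complex.continuous_ofReal.comp p.continuous⟩

theorem radialLp_polyC_mem_span {d : ℕ} (hd : 0 < d) (p : Polynomial ℝ) :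
    radialLp d (polyC p) ∈ Submodule.span ℂ (Set.range (jacobiLp d)) := by
  have : polyC p = ∑ i ∈ Finset.range (p.natDegree + 1), (p.coeff i : ℂ) • monomialC i := by
    ext r
    simp [polyC, monomialC, Polynomial.eval_eq_sum_range]
  rw [this, map_sum]
  refine Submodule.sum_mem _ fun k _ => ?_
  rw [map_smul]
  exact Submodule.smul_mem _ _ (radialLp_monomialC_mem_span hd k)

/-- Weierstrass approximation on `[0, 1]`, separately for real and imaginary parts; uniform
closeness controls the `L²(B)`-norm because the ball has finite measure. -/
theorem radialLp_mem_closure {d : ℕ} (hd : 0 < d) (ψ : C(ℝ, ℂ)) :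
    radialLp d ψ ∈ (Submodule.span ℂ (Set.range (jacobiLp d))).topologicalClosure := by
  set A : ℝ := (measureUnivNNReal (ballMeasure d)) ^ (2 : ℝ≥0∞).toReal⁻¹ with hA
  have hA0 : 0 ≤ A := by positivity
  rw [← SetLike.mem_coe, Submodule.topologicalClosure_coe, Metric.mem_closure_iff]
  intro ε hε
  -- The two approximations give a uniform error `2δ`, hence an `L²`-error at most `ε A/(A + 1) <
  -- ε`; the `1` avoids dividing by a vanishing `A`.
  set δ : ℝ := ε / (2 * (A + 1)) with hδdef
  have hδ : 0 < δ := by positivity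
  have hre : ContinuousOn (fun r => (ψ r).re) (Set.Icc (0 : ℝ) 1) := by fun_prop
  have him : ContinuousOn (fun r => (ψ r).im) (Set.Icc (0 : ℝ) 1) := by fun_prop
  obtain ⟨p, hp⟩ := exists_polynomial_near_of_continuousOn 0 1 _ hre δ hδ
  obtain ⟨q, hq⟩ := exists_polynomial_near_of_continuousOn 0 1 _ him δ hδ
  refine ⟨radialLp d (polyC p + Complex.I • polyC q), ?_, ?_⟩
  · rw [map_add, map_smul]
    exact Submodule.add_mem _ (radialLp_polyC_mem_span hd p)
      (Submodule.smul_mem _ _ (radialLp_polyC_mem_span hd q))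
  · rw [dist_eq_norm, ← map_sub]
    refine (norm_radialLp_le _ (2 * δ) (by positivity) ?_).trans_lt ?_
    · intro r hr
      refine (Complex.norm_le_abs_re_add_abs_im _).trans ?_
      have h1 : ((ψ - (polyC p + Complex.I • polyC q)) r).re = -(p.eval r - (ψ r).re) := by
        simp [polyC]
      have h2 : ((ψ - (polyC p + Complex.I • polyC q)) r).im = -(q.eval r - (ψ r).im) := by
        simp [polyC]
      rw [h1, h2, abs_neg, abs_neg]
      linarith [hp r hr, hq r hr]
    · rw [← hA]
      have : A * (2 * δ) = ε * (A / (A + 1)) := by rw [hδdef]; field_simp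
      rw [this]
      have h3 : A / (A + 1) < 1 := by rw [div_lt_one (by positivity)]; linarith
      nlinarith

theorem radial_mem_closure {d : ℕ} (hd : 0 < d) {h : ℝ → ℂ} {η : L2Ball d}
    (hη : IsRadialProfile h η) :
    η ∈ (Submodule.span ℂ (Set.range (jacobiLp d))).topologicalClosure := by
  have hcl : IsClosed ((Submodule.span ℂ (Set.range (jacobiLp d))).topologicalClosure :
      Set (L2Ball d)) := Submodule.isClosed_topologicalClosure _
  rw [← SetLike.mem_coe, ← hcl.closure_eq, Metric.mem_closure_iff]
  intro ε hε
  have hmeas : Measurable (fun x : Space d => ‖x‖) := measurable_norm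
  have hmem : MemLp (fun x : Space d => h ‖x‖) 2 (ballMeasure d) := by
    refine (memLp_congr_ae ?_).mp (Lp.memLp η)
    exact hη.2
  -- Pushing the measure forward under the norm reduces the claim to density of bounded continuous
  -- functions in `L²` on the line, which keeps the approximants radial.
  have hmap : MemLp h 2 ((ballMeasure d).map (fun x => ‖x‖)) :=
    (memLp_map_measure_iff hη.1.aestronglyMeasurable hmeas.aemeasurable).mpr hmem
  obtain ⟨g, hg, -⟩ := hmap.exists_boundedContinuous_eLpNorm_sub_le (by norm_num)
    (ε := ENNReal.ofReal (ε / 2)) (by simpa using hε)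
  refine ⟨radialLp d g.toContinuousMap, radialLp_mem_closure hd _, ?_⟩
  have h1 : eLpNorm (h - ⇑g) 2 ((ballMeasure d).map (fun x => ‖x‖)) =
      eLpNorm (fun x : Space d => h ‖x‖ - g ‖x‖) 2 (ballMeasure d) := by
    rw [eLpNorm_map_measure (hη.1.aestronglyMeasurable.sub g.continuous.aestronglyMeasurable)
      hmeas.aemeasurable]
    rfl
  have h2 : eLpNorm (⇑η - ⇑(radialLp d g.toContinuousMap)) 2 (ballMeasure d) ≤
      ENNReal.ofReal (ε / 2) := by
    refine le_trans (le_of_eq ?_) (h1 ▸ hg)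
    refine eLpNorm_congr_ae ?_
    filter_upwards [hη.2, coeFn_radialLp (d := d) g.toContinuousMap] with x hx1 hx2
    rw [Pi.sub_apply, hx1, hx2]
    rfl
  rw [dist_comm, Lp.dist_def, ← eLpNorm_neg, neg_sub]
  refine (ENNReal.toReal_le_of_le_ofReal (by positivity) h2).trans_lt (by linarith)

/-- The Jacobi expansion of a radial function. -/
theorem hasSum_jacobi {d : ℕ} (hd : 0 < d) {h : ℝ → ℂ} {η : L2Ball d}
    (hη : IsRadialProfile h η) :
    HasSum (fun k => jacobiCoeff d k h • radialLp d (jacobiC d k)) η := by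
  have ho := orthonormal_jacobiLp hd
  have hV := ho.orthogonalFamily
  -- The closed span of the orthonormal family is the isometric image of `ℓ²`, so `η` is the sum of
  -- a series in the family, whose coefficients are then read off by inner products.
  have hmem : η ∈ LinearMap.range hV.linearIsometry.toLinearMap := by
    rw [hV.range_linearIsometry]
    have hle : Submodule.span ℂ (Set.range (jacobiLp d)) ≤
        ⨆ i, LinearMap.range (LinearIsometry.toSpanSingleton ℂ (L2Ball d) (ho.1 i)).toLinearMap := by
      refine Submodule.span_le.mpr ?_
      rintro _ ⟨k, rfl⟩
      exact Submodule.mem_iSup_of_mem k ⟨1, by simp⟩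
    exact Submodule.topologicalClosure_mono hle (radial_mem_closure hd hη)
  obtain ⟨f, rfl⟩ := hmem
  have hs := hV.hasSum_linearIsometry f
  have hf : ∀ k, inner ℂ (jacobiLp d k) (hV.linearIsometry f) = f k := by
    intro k
    have h1 := hs.mapL (innerSL ℂ (jacobiLp d k))
    refine h1.unique ?_
    have h2 := hasSum_single (f := fun i => innerSL ℂ (jacobiLp d k)
      (LinearIsometry.toSpanSingleton ℂ (L2Ball d) (ho.1 i) (f i))) k ?_
    · simpa [inner_smul_right, inner_self_eq_norm_sq_to_K, ho.1 k] using h2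
    · intro i hi
      simp [ho.2 (Ne.symm hi)]
  refine hs.congr_fun ?_
  intro k
  rw [← inner_jacobiLp_smul hd hη]
  erw [hf k]
  simp

theorem tendsto_jacobi {d : ℕ} (hd : 0 < d) {h : ℝ → ℂ} {η : L2Ball d}
    (hη : IsRadialProfile h η) :
    Tendsto (fun n : ℕ => eLpNorm (fun x => η x -
        ∑ k ∈ Finset.range n, jacobiCoeff d k h * (jacobiP d k ‖x‖ : ℂ)) 2 (ballMeasure d))
      atTop (𝓝 0) := by
  have h1 := (hasSum_jacobi hd hη).tendsto_sum_nat
  have h2 := (tendsto_iff_edist_tendsto_0.mp h1)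
  refine h2.congr fun n => ?_
  rw [edist_comm, Lp.edist_def]
  refine eLpNorm_congr_ae ?_
  have h3 : ∑ k ∈ Finset.range n, jacobiCoeff d k h • radialLp d (jacobiC d k) =
      radialLp d (∑ k ∈ Finset.range n, jacobiCoeff d k h • jacobiC d k) := by
    simp
  rw [h3]
  filter_upwards [coeFn_radialLp (d := d) (∑ k ∈ Finset.range n, jacobiCoeff d k h • jacobiC d k)]
    with x hx
  rw [Pi.sub_apply, hx]
  simp [jacobiC]

/-- The eigenvalues as moments of the radial profile. -/
theorem eigenvalue_eq {d : ℕ} (hd : 0 < d) {h : ℝ → ℂ} {η : L2Ball d}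
    (hη : IsRadialProfile h η) {ℓ : ℕ} (hℓ : 1 ≤ ℓ) :
    eigenvalue d ℓ h = -(((2 * ℓ - 2 : ℕ) + d : ℝ) / ℓ : ℝ) *
      ∫ r in (0 : ℝ)..1, h r * (r : ℂ) ^ (2 * ℓ - 2) * ((r ^ (d - 1) : ℝ) : ℂ) := by
  -- As `ℓ ≥ 1`, the truncated subtractions are harmless and the summation range has `n + 1` terms,
  -- exactly those of the expansion of `r^n`.
  obtain ⟨n, hn⟩ : ∃ n, n = 2 * ℓ - 2 := ⟨_, rfl⟩
  rw [eigenvalue, ← hn, show 2 * ℓ - 1 = n + 1 by omega]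
  have h1 : ∀ r : ℝ, ((n + d : ℝ) : ℂ) * (h r * (r : ℂ) ^ n * ((r ^ (d - 1) : ℝ) : ℂ)) =
      ∑ k ∈ Finset.range (n + 1), (((-1) ^ k * √(2 * k + d) *
      ((n + d).factorial * n.factorial / ((n + d + k).factorial * (n - k).factorial)) : ℝ) : ℂ) *
        (h r * jacobiC d k r * ((r ^ (d - 1) : ℝ) : ℂ)) := by
    intro r
    have h2 := congrArg (fun t : ℝ => (t : ℂ)) (pow_eq_sum_jacobiP hd n r)
    simp only [Complex.ofReal_sum, Complex.ofReal_mul (r := (n + d : ℝ)),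
      Complex.ofReal_pow (r := r)] at h2
    calc _ = (((n + d : ℝ) : ℂ) * (r : ℂ) ^ n) * (h r * ((r ^ (d - 1) : ℝ) : ℂ)) := by ring
      _ = _ := by
        rw [h2, Finset.sum_mul]
        refine Finset.sum_congr rfl fun k _ => ?_
        rw [Complex.ofReal_mul]
        simp only [jacobiC, ContinuousMap.coe_mk]
        ring
  have h3 : ((n + d : ℝ) : ℂ) *
      ∫ r in (0 : ℝ)..1, h r * (r : ℂ) ^ n * ((r ^ (d - 1) : ℝ) : ℂ) =
      ∑ k ∈ Finset.range (n + 1), (((-1) ^ k * √(2 * k + d) *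
      ((n + d).factorial * n.factorial / ((n + d + k).factorial * (n - k).factorial)) : ℝ) : ℂ) *
        jacobiCoeff d k h := by
    rw [← intervalIntegral.integral_const_mul]
    simp_rw [h1]
    rw [intervalIntegral.integral_finsetSum
      (fun k _ => (intervalIntegrable_profile_mul hd hη (jacobiC d k)).const_mul _)]
    simp_rw [intervalIntegral.integral_const_mul]
    rfl
  have h4 : ∀ I : ℂ, -(((n : ℝ) + d : ℝ) / ℓ : ℝ) * I = -(ℓ : ℂ)⁻¹ * (((n + d : ℝ) : ℂ) * I) := by
    intro I
    push_cast
    ring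
  rw [h4, h3, Finset.mul_sum]
  refine Finset.sum_congr rfl fun k _ => ?_
  rw [pow_succ]
  push_cast
  ring

/-! ### Green's formula for harmonic polynomials -/

/-- The function on `ℝ^d` given by a polynomial. -/
noncomputable def polyFun {d : ℕ} (p : MvPolynomial (Fin d) ℂ) (x : Space d) : ℂ :=
  MvPolynomial.eval (fun i => ((x i : ℝ) : ℂ)) p

theorem contDiff_polyFun {d : ℕ} (p : MvPolynomial (Fin d) ℂ) {n : WithTop ℕ∞} :
    ContDiff ℝ n (polyFun p) := by
  induction p using MvPolynomial.induction_on with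
  | C a =>
    have : polyFun (MvPolynomial.C a) = fun _ : Space d => a := by ext x; simp [polyFun]
    rw [this]
    exact contDiff_const
  | add p q hp hq =>
    have : polyFun (p + q) = fun x => polyFun p x + polyFun q x := by ext x; simp [polyFun]
    rw [this]
    exact hp.add hq
  | mul_X p i hp =>
    have : polyFun (p * MvPolynomial.X i) = fun x => polyFun p x * ((x i : ℝ) : ℂ) := by
      ext x; simp [polyFun]
    rw [this]
    exact hp.mul (contDiff_coord i)

theorem fderiv_polyFun {d : ℕ} (p : MvPolynomial (Fin d) ℂ) (x : Space d) (i : Fin d) :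
    fderiv ℝ (polyFun p) x (EuclideanSpace.single i 1) =
      polyFun (MvPolynomial.pderiv i p) x := by
  induction p using MvPolynomial.induction_on with
  | C a =>
    have : polyFun (MvPolynomial.C a) = fun _ : Space d => a := by ext x; simp [polyFun]
    rw [this, fderiv_fun_const]
    simp [polyFun]
  | add p q hp hq =>
    have : polyFun (p + q) = fun x => polyFun p x + polyFun q x := by ext x; simp [polyFun]
    rw [this, fderiv_fun_add ((contDiff_polyFun p (n := 1)).differentiable (by norm_num) x)
      ((contDiff_polyFun q (n := 1)).differentiable (by norm_num) x), add_apply, hp, hq]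
    simp [polyFun]
  | mul_X p j hp =>
    have : polyFun (p * MvPolynomial.X j) = fun x => polyFun p x * ((x j : ℝ) : ℂ) := by
      ext x; simp [polyFun]
    rw [this, fderiv_fun_mul ((contDiff_polyFun p (n := 1)).differentiable (by norm_num) x)
      ((contDiff_coord j (n := 1)).differentiable (by norm_num) x), add_apply, smul_apply,
      smul_apply, hp, fderiv_coord, MvPolynomial.pderiv_mul]
    by_cases hij : i = j
    · subst hij
      simp [polyFun]
      ring
    · simp [polyFun, MvPolynomial.pderiv_X, Ne.symm hij]
      ring

theorem grad_polyFun {d : ℕ} (p : MvPolynomial (Fin d) ℂ) (x : Space d) :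
    grad (polyFun p) x = WithLp.toLp 2 fun i => polyFun (MvPolynomial.pderiv i p) x := by
  simp only [grad, fderiv_polyFun]

theorem polyFun_smul {d n : ℕ} {p : MvPolynomial (Fin d) ℂ} (hp : p.IsHomogeneous n) (r : ℝ)
    (x : Space d) : polyFun p (r • x) = (r : ℂ) ^ n * polyFun p x := by
  rw [polyFun, polyFun, MvPolynomial.eval_eq', MvPolynomial.eval_eq', Finset.mul_sum]
  refine Finset.sum_congr rfl fun m hm => ?_
  have hn : ∑ i, m i = n := by
    by_contra h
    refine MvPolynomial.mem_support_iff.mp hm (hp.coeff_eq_zero ?_)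
    rwa [Finsupp.degree_eq_sum]
  rw [← hn, ← Finset.prod_pow_eq_pow_sum]
  simp only [PiLp.smul_apply, smul_eq_mul, Complex.ofReal_mul, mul_pow, Finset.prod_mul_distrib]
  ring

theorem inner_single_one {d : ℕ} (x : Space d) (i : Fin d) :
    inner ℝ x (EuclideanSpace.single i 1) = x i := by
  rw [EuclideanSpace.inner_single_right]
  simp

/-- Green's formula for harmonic homogeneous polynomials. -/
theorem integral_grad_mul_grad {d ℓ : ℕ} (hd : 0 < d) {p : MvPolynomial (Fin d) ℂ}
    (hp : p ∈ harmonicPolys d ℓ) {χ : Space d → ℂ} (hχ : ContDiff ℝ 1 χ) :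
    ∫ x, ∑ i, fderiv ℝ χ x (EuclideanSpace.single i 1) * polyFun (MvPolynomial.pderiv i p) x
      ∂ballMeasure d = ℓ * ∫ θ, χ θ * polyFun p θ ∂surfaceMeasure d := by
  have hψ : ∀ i, ContDiff ℝ 1 fun x => χ x * polyFun (MvPolynomial.pderiv i p) x :=
    fun i => hχ.mul (contDiff_polyFun _)
  have hΔ : ∀ x, ∑ i, polyFun (MvPolynomial.pderiv i (MvPolynomial.pderiv i p)) x = 0 := by
    intro x
    have h : polyLaplacian d p = 0 := hp.2
    rw [polyLaplacian_apply] at h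
    have := congrArg (fun q => polyFun q x) h
    simpa [polyFun] using this
  have hE : ∀ x : Space d, ∑ i, ((x i : ℝ) : ℂ) * polyFun (MvPolynomial.pderiv i p) x =
      ℓ * polyFun p x := by
    intro x
    have h : p.IsHomogeneous ℓ := hp.1
    have := congrArg (fun q => polyFun q x) h.sum_X_mul_pderiv
    simpa [polyFun] using this
  -- Since `p` is harmonic, the integrand is the divergence of `χ ∇p`. By Euler's identity the
  -- normal component of this field on the sphere is `ℓ χ p`.
  have h1 : ∀ x, ∑ i, fderiv ℝ χ x (EuclideanSpace.single i 1) *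
      polyFun (MvPolynomial.pderiv i p) x =
      ∑ i, fderiv ℝ (fun x => χ x * polyFun (MvPolynomial.pderiv i p) x) x
        (EuclideanSpace.single i 1) := by
    intro x
    have h2 : ∀ i, fderiv ℝ (fun x => χ x * polyFun (MvPolynomial.pderiv i p) x) x
        (EuclideanSpace.single i 1) = fderiv ℝ χ x (EuclideanSpace.single i 1) *
          polyFun (MvPolynomial.pderiv i p) x +
          χ x * polyFun (MvPolynomial.pderiv i (MvPolynomial.pderiv i p)) x := by
      intro i
      rw [fderiv_fun_mul (hχ.differentiable (by norm_num) x)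
        ((contDiff_polyFun _ (n := 1)).differentiable (by norm_num) x), add_apply, smul_apply,
        smul_apply, fderiv_polyFun, smul_eq_mul, smul_eq_mul]
      ring
    simp_rw [h2]
    rw [Finset.sum_add_distrib, ← Finset.mul_sum, hΔ, mul_zero, add_zero]
  simp_rw [h1]
  rw [integral_finsetSum]
  · simp_rw [fun i => integral_ball_fderiv hd (hψ i)]
    rw [← integral_finsetSum, ← integral_const_mul]
    · congr 1
      ext θ
      have := hE θ
      calc _ = χ θ * ∑ i, (((θ : Space d) i : ℝ) : ℂ) *
            polyFun (MvPolynomial.pderiv i p) θ := by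
            rw [Finset.mul_sum]
            refine Finset.sum_congr rfl fun i _ => ?_
            rw [inner_single_one]
            ring
        _ = _ := by rw [this]; ring
    · intro i _
      refine Continuous.integrable_of_hasCompactSupport ?_ (HasCompactSupport.of_compactSpace _)
      have h3 := (hψ i).continuous
      exact (Complex.continuous_ofReal.comp (continuous_subtype_val.inner continuous_const)).mul
        (h3.comp continuous_subtype_val)
  · intro i _
    exact integrableOn_ball_of_continuous
      (((hψ i).continuous_fderiv (by norm_num)).clm_apply continuous_const)

/-! ### Smooth triples and Green's formula in `H¹` -/

theorem continuous_grad {d : ℕ} {φ : Space d → ℂ} (hφ : ContDiff ℝ 1 φ) :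
    Continuous (grad φ) := by
  refine (PiLp.continuous_toLp 2 _).comp (continuous_pi fun i => ?_)
  exact (hφ.continuous_fderiv (by norm_num)).clm_apply continuous_const

theorem memLp_ball_of_continuous {d : ℕ} {E : Type*} [NormedAddCommGroup E]
    {K : Space d → E} (hK : Continuous K) (p : ℝ≥0∞) : MemLp K p (ballMeasure d) := by
  obtain ⟨C, hC⟩ := (isCompact_closedBall (0 : Space d) 1).exists_bound_of_continuousOn
    hK.continuousOn
  refine MemLp.of_bound hK.aestronglyMeasurable C ?_
  filter_upwards [ae_restrict_mem measurableSet_ball] with x hx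
  exact hC _ (Metric.ball_subset_closedBall hx)

theorem memLp_sphere_of_continuous {d : ℕ} {K : Sphere d → ℂ} (hK : Continuous K) (p : ℝ≥0∞) :
    MemLp K p (surfaceMeasure d) := by
  obtain ⟨C, hC⟩ := isCompact_univ.exists_bound_of_continuousOn hK.continuousOn
  exact MemLp.of_bound hK.aestronglyMeasurable C (.of_forall fun θ => hC θ trivial)

/-- The triple `(φ, ∇φ, φ|_{∂B})` of a smooth function. -/
noncomputable def smoothTriple {d : ℕ} (φ : Space d → ℂ) (hφ : ContDiff ℝ ∞ φ) : Triple d :=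
  (MemLp.toLp φ (memLp_ball_of_continuous hφ.continuous 2),
    MemLp.toLp (grad φ) (memLp_ball_of_continuous (continuous_grad (hφ.of_le (by simp))) 2),
    MemLp.toLp (fun θ : Sphere d => φ θ)
      (memLp_sphere_of_continuous (hφ.continuous.comp continuous_subtype_val) 2))

theorem coeFn_smoothTriple_fst {d : ℕ} {φ : Space d → ℂ} (hφ : ContDiff ℝ ∞ φ) :
    (smoothTriple φ hφ).1 =ᵐ[ballMeasure d] φ :=
  MemLp.coeFn_toLp (memLp_ball_of_continuous hφ.continuous 2)

theorem coeFn_smoothTriple_grad {d : ℕ} {φ : Space d → ℂ} (hφ : ContDiff ℝ ∞ φ) :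
    (smoothTriple φ hφ).2.1 =ᵐ[ballMeasure d] grad φ :=
  MemLp.coeFn_toLp (memLp_ball_of_continuous (continuous_grad (hφ.of_le (by simp))) 2)

theorem coeFn_smoothTriple_trace {d : ℕ} {φ : Space d → ℂ} (hφ : ContDiff ℝ ∞ φ) :
    (smoothTriple φ hφ).2.2 =ᵐ[surfaceMeasure d] fun θ => φ θ :=
  MemLp.coeFn_toLp (memLp_sphere_of_continuous (hφ.continuous.comp continuous_subtype_val) 2)

theorem smoothTriple_mem {d : ℕ} (φ : Space d → ℂ) (hφ : ContDiff ℝ ∞ φ) :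
    smoothTriple φ hφ ∈ smoothTriples d :=
  ⟨φ, hφ, coeFn_smoothTriple_fst hφ, coeFn_smoothTriple_grad hφ, coeFn_smoothTriple_trace hφ⟩

theorem smoothTriple_mem_sobolevH1 {d : ℕ} (φ : Space d → ℂ) (hφ : ContDiff ℝ ∞ φ) :
    smoothTriple φ hφ ∈ sobolevH1 d :=
  subset_closure (smoothTriple_mem φ hφ)

/-- The triple of a polynomial. -/
noncomputable def polyTriple {d : ℕ} (p : MvPolynomial (Fin d) ℂ) : Triple d :=
  smoothTriple (polyFun p) (contDiff_polyFun p)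

theorem polyTriple_trace {d : ℕ} (p : MvPolynomial (Fin d) ℂ) :
    (polyTriple p).2.2 = restrictToSphere d p := by
  refine Lp.ext ?_
  have h1 : (polyTriple p).2.2 =ᵐ[surfaceMeasure d] fun θ => polyFun p θ :=
    coeFn_smoothTriple_trace _
  have h2 : restrictToSphere d p =ᵐ[surfaceMeasure d] MvPolynomial.aeval (sphereCoord d) p :=
    ContinuousMap.coeFn_toLp _ _
  filter_upwards [h1, h2] with θ h1 h2
  rw [h1, h2, aeval_sphereCoord_apply, polyFun]

theorem coeFn_polyTriple_grad {d : ℕ} (p : MvPolynomial (Fin d) ℂ) :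
    (polyTriple p).2.1 =ᵐ[ballMeasure d] grad (polyFun p) :=
  coeFn_smoothTriple_grad _

theorem fderiv_star {d : ℕ} {φ : Space d → ℂ} (x v : Space d) (hφ : DifferentiableAt ℝ φ x) :
    fderiv ℝ (fun x => star (φ x)) x v = star (fderiv ℝ φ x v) := by
  have h := (Complex.conjCLE.toContinuousLinearMap.hasFDerivAt).comp x hφ.hasFDerivAt
  have h2 : fderiv ℝ (fun x => star (φ x)) x = _ := h.fderiv
  rw [h2]
  rfl

theorem contDiff_star {d : ℕ} {φ : Space d → ℂ} {n : WithTop ℕ∞} (hφ : ContDiff ℝ n φ) :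
    ContDiff ℝ n fun x => star (φ x) :=
  Complex.conjCLE.contDiff.comp hφ

/-- Green's formula in `H¹`. -/
theorem inner_grad_polyTriple {d ℓ : ℕ} (hd : 0 < d) {p : MvPolynomial (Fin d) ℂ}
    (hp : p ∈ harmonicPolys d ℓ) {w : Triple d} (hw : w ∈ sobolevH1 d) :
    inner ℂ w.2.1 (polyTriple p).2.1 = ℓ * inner ℂ w.2.2 (restrictToSphere d p) := by
  -- Both sides depend continuously on the gradient and the trace, so smooth functions suffice.
  have hcl : IsClosed {w : Triple d | inner ℂ w.2.1 (polyTriple p).2.1 =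
      ℓ * inner ℂ w.2.2 (restrictToSphere d p)} :=
    isClosed_eq (by fun_prop) (by fun_prop)
  refine closure_minimal (fun w hw => ?_) hcl hw
  obtain ⟨φ, hφ, -, h1, h2⟩ := hw
  have hG := integral_grad_mul_grad hd hp (contDiff_star (hφ.of_le (by simp) : ContDiff ℝ 1 φ))
  simp only [Set.mem_ofPred_eq, L2.inner_def]
  rw [← polyTriple_trace]
  have h3 : (polyTriple p).2.2 =ᵐ[surfaceMeasure d] fun θ => polyFun p θ :=
    coeFn_smoothTriple_trace _
  convert hG using 1
  · refine integral_congr_ae ?_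
    filter_upwards [h1, coeFn_polyTriple_grad p] with x hx1 hx2
    rw [hx1, hx2, grad_polyFun, PiLp.inner_apply]
    refine Finset.sum_congr rfl fun i _ => ?_
    rw [fderiv_star _ _ (hφ.differentiable (by simp) x)]
    simp [grad, mul_comm]
  · congr 1
    refine integral_congr_ae ?_
    filter_upwards [h2, h3] with x hx1 hx2
    rw [hx1, hx2]
    simp [mul_comm]

theorem polyTriple_mem {d : ℕ} (p : MvPolynomial (Fin d) ℂ) : polyTriple p ∈ sobolevH1 d :=
  smoothTriple_mem_sobolevH1 _ _

theorem inner_polyTriple_grad {d ℓ : ℕ} (hd : 0 < d) {p q : MvPolynomial (Fin d) ℂ}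
    (hp : p ∈ harmonicPolys d ℓ) :
    inner ℂ (polyTriple q).2.1 (polyTriple p).2.1 =
      ℓ * inner ℂ (restrictToSphere d q) (restrictToSphere d p) := by
  rw [inner_grad_polyTriple hd hp (polyTriple_mem q), polyTriple_trace]

/-! ### Orthogonality and completeness of spherical harmonics -/

/-- Green's formula evaluates `⟨∇q, ∇p⟩` in two ways, as `ℓ ⟨q, p⟩` and as `ℓ' ⟨q, p⟩`. -/
theorem inner_restrictToSphere_of_ne {d ℓ ℓ' : ℕ} (hd : 0 < d) {p q : MvPolynomial (Fin d) ℂ}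
    (hp : p ∈ harmonicPolys d ℓ) (hq : q ∈ harmonicPolys d ℓ') (h : ℓ ≠ ℓ') :
    inner ℂ (restrictToSphere d q) (restrictToSphere d p) = 0 := by
  have h1 := inner_polyTriple_grad hd hp (q := q)
  have h2 := congrArg star (inner_polyTriple_grad hd hq (q := p))
  rw [star_mul', ← starRingEnd_apply, ← starRingEnd_apply, ← starRingEnd_apply, inner_conj_symm,
    inner_conj_symm, map_natCast, h1] at h2
  have h3 : ((ℓ : ℂ) - ℓ') * inner ℂ (restrictToSphere d q) (restrictToSphere d p) = 0 := by
    linear_combination h2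
  rcases mul_eq_zero.mp h3 with h4 | h4
  · exact absurd (by exact_mod_cast sub_eq_zero.mp h4) h
  · exact h4

theorem restrictToSphere_C {d : ℕ} (c : ℂ) :
    restrictToSphere d (MvPolynomial.C c) = c • Lp.const 2 (surfaceMeasure d) (1 : ℂ) := by
  have h : restrictToSphere d (MvPolynomial.C c) = c • restrictToSphere d 1 := by
    rw [← map_smul, MvPolynomial.smul_eq_C_mul, mul_one]
  rw [h]
  congr 1
  refine Lp.ext ?_
  have h2 : restrictToSphere d 1 =ᵐ[surfaceMeasure d] MvPolynomial.aeval (sphereCoord d) 1 :=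
    ContinuousMap.coeFn_toLp _ _
  filter_upwards [h2, Lp.coeFn_const 2 (surfaceMeasure d) (1 : ℂ)] with θ h3 h4
  rw [h3, h4]
  simp

theorem one_mem_harmonicPolys (d : ℕ) : (MvPolynomial.C 1 : MvPolynomial (Fin d) ℂ) ∈
    harmonicPolys d 0 := by
  refine ⟨MvPolynomial.isHomogeneous_C _ _, ?_⟩
  change polyLaplacian d _ = 0
  simp [polyLaplacian_apply]

theorem sphericalHarmonics_zero_le (d : ℕ) :
    sphericalHarmonics d 0 ≤ Submodule.span ℂ {Lp.const 2 (surfaceMeasure d) (1 : ℂ)} := by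
  rintro _ ⟨p, hp, rfl⟩
  have h0 : p.IsHomogeneous 0 := hp.1
  rw [MvPolynomial.totalDegree_eq_zero_iff_eq_C.mp (Nat.le_zero.mp h0.totalDegree_le),
    restrictToSphere_C]
  exact Submodule.smul_mem _ _ (Submodule.mem_span_singleton_self _)

theorem eq_zero_of_mem_L2Mean {d : ℕ} {f : L2Sphere d} (hf : f ∈ L2Mean d)
    (hf' : f ∈ sphericalHarmonics d 0) : f = 0 := by
  have := hf f (sphericalHarmonics_zero_le d hf')
  exact inner_self_eq_zero.mp this

theorem sphericalHarmonics_le_L2Mean {d ℓ : ℕ} (hd : 0 < d) (hℓ : 1 ≤ ℓ) :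
    sphericalHarmonics d ℓ ≤ L2Mean d := by
  rintro _ ⟨p, hp, rfl⟩
  rw [Submodule.mem_orthogonal_singleton_iff_inner_right]
  have := inner_restrictToSphere_of_ne hd hp (one_mem_harmonicPolys d) (by omega)
  rwa [restrictToSphere_C, one_smul] at this

instance (d ℓ : ℕ) : FiniteDimensional ℂ (sphericalHarmonics d ℓ) := by
  have : FiniteDimensional ℂ (MvPolynomial.homogeneousSubmodule (Fin d) ℂ ℓ) :=
    Module.Finite.iff_fg.mpr (MvPolynomial.homogeneousSubmodule_fg _ _ ℓ)
  have : FiniteDimensional ℂ (harmonicPolys d ℓ) :=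
    Submodule.finiteDimensional_of_le (inf_le_left : harmonicPolys d ℓ ≤ _)
  unfold sphericalHarmonics
  infer_instance

section Basis

variable {d : ℕ} {ι : ℕ+ → Type*} [∀ ℓ, Fintype (ι ℓ)]

/-- The elements of orthonormal bases of the spaces of spherical harmonics of positive degree. -/
noncomputable def harmonicFamily (hd : 0 < d) (f : ∀ ℓ : ℕ+, OrthonormalBasis (ι ℓ) ℂ (sphericalHarmonics d ℓ))
    (i : Σ ℓ : ℕ+, ι ℓ) : L2Mean d :=
  ⟨f i.1 i.2, sphericalHarmonics_le_L2Mean hd i.1.2 (f i.1 i.2).2⟩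

theorem orthonormal_harmonicFamily (hd : 0 < d)
    (f : ∀ ℓ : ℕ+, OrthonormalBasis (ι ℓ) ℂ (sphericalHarmonics d ℓ)) :
    Orthonormal ℂ (harmonicFamily hd f) := by
  refine ⟨fun i => (f i.1).orthonormal.1 i.2, ?_⟩
  rintro ⟨ℓ, m⟩ ⟨ℓ', m'⟩ hne
  by_cases h : ℓ = ℓ'
  · subst h
    exact (f ℓ).orthonormal.2 (fun hm => hne (congrArg (Sigma.mk ℓ) hm))
  · obtain ⟨p, hp, hp'⟩ := (f ℓ m).2
    obtain ⟨q, hq, hq'⟩ := (f ℓ' m').2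
    change inner ℂ (f ℓ m : L2Sphere d) (f ℓ' m' : L2Sphere d) = 0
    rw [← hp', ← hq']
    exact inner_restrictToSphere_of_ne hd hq hp fun h' => h (PNat.eq h'.symm)

/-- A mean-free function orthogonal to the family is also orthogonal to degree zero, hence to a
dense subspace that includes all degrees. -/
theorem harmonicFamily_orthogonal (hd : 0 < d)
    (f : ∀ ℓ : ℕ+, OrthonormalBasis (ι ℓ) ℂ (sphericalHarmonics d ℓ)) :
    (Submodule.span ℂ (Set.range (harmonicFamily hd f)))ᗮ = ⊥ := by
  rw [Submodule.eq_bot_iff]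
  intro g hg
  have h1 : ∀ ℓ, sphericalHarmonics d ℓ ≤ (Submodule.span ℂ {(g : L2Sphere d)})ᗮ := by
    intro ℓ
    rcases Nat.eq_zero_or_pos ℓ with rfl | hℓ
    · intro y hy
      rw [Submodule.mem_orthogonal_singleton_iff_inner_left]
      exact g.2 y (sphericalHarmonics_zero_le d hy)
    · intro y hy
      lift ℓ to ℕ+ using hℓ
      have hy2 : y = ∑ m, (f ℓ).repr ⟨y, hy⟩ m • (f ℓ m : L2Sphere d) := by
        have := congrArg Subtype.val ((f ℓ).sum_repr ⟨y, hy⟩)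
        simpa using this.symm
      rw [hy2]
      refine Submodule.sum_mem _ fun m _ => Submodule.smul_mem _ _ ?_
      rw [Submodule.mem_orthogonal_singleton_iff_inner_left]
      exact hg (harmonicFamily hd f ⟨ℓ, m⟩) (Submodule.subset_span ⟨_, rfl⟩)
  have h2 : (⊤ : Submodule ℂ (L2Sphere d)) ≤ (Submodule.span ℂ {(g : L2Sphere d)})ᗮ := by
    rw [← iSup_sphericalHarmonics_dense hd]
    exact Submodule.topologicalClosure_minimal _ (iSup_le h1) (Submodule.isClosed_orthogonal _)
  have h3 : (g : L2Sphere d) ∈ (Submodule.span ℂ {(g : L2Sphere d)})ᗮ := h2 trivial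
  rw [Submodule.mem_orthogonal_singleton_iff_inner_left] at h3
  exact Subtype.ext (inner_self_eq_zero.mp h3)

/-- The Hilbert basis of the mean-free functions on the sphere given by orthonormal bases of the
spaces of spherical harmonics. -/
noncomputable def harmonicBasis (hd : 0 < d)
    (f : ∀ ℓ : ℕ+, OrthonormalBasis (ι ℓ) ℂ (sphericalHarmonics d ℓ)) :
    HilbertBasis (Σ ℓ : ℕ+, ι ℓ) ℂ (L2Mean d) :=
  HilbertBasis.mkOfOrthogonalEqBot (orthonormal_harmonicFamily hd f)
    (harmonicFamily_orthogonal hd f)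

theorem harmonicBasis_apply (hd : 0 < d)
    (f : ∀ ℓ : ℕ+, OrthonormalBasis (ι ℓ) ℂ (sphericalHarmonics d ℓ)) (i : Σ ℓ : ℕ+, ι ℓ) :
    (harmonicBasis hd f i : L2Sphere d) = f i.1 i.2 := by
  rw [harmonicBasis, HilbertBasis.coe_mkOfOrthogonalEqBot]
  rfl

theorem exists_harmonicPoly (hd : 0 < d)
    (f : ∀ ℓ : ℕ+, OrthonormalBasis (ι ℓ) ℂ (sphericalHarmonics d ℓ)) (i : Σ ℓ : ℕ+, ι ℓ) :
    ∃ p ∈ harmonicPolys d i.1, restrictToSphere d p = harmonicBasis hd f i := by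
  rw [harmonicBasis_apply]
  exact (f i.1 i.2).2

end Basis

/-- A choice of orthonormal bases of the spaces of spherical harmonics. -/
noncomputable def stdHarmonics (d : ℕ) (ℓ : ℕ+) :
    OrthonormalBasis (Fin (Module.finrank ℂ (sphericalHarmonics d ℓ))) ℂ (sphericalHarmonics d ℓ) :=
  stdOrthonormalBasis ℂ _

/-! ### Trace and Poincaré inequalities -/

/-- The trace inequality for functions with mean-free trace. -/
theorem norm_trace_le {d : ℕ} (hd : 0 < d) {w : Triple d} (hw : w ∈ sobolevH1 d)
    (hw' : w.2.2 ∈ L2Mean d) : ‖w.2.2‖ ≤ ‖w.2.1‖ := by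
  set b := harmonicBasis hd (stdHarmonics d) with hb
  choose p hp hpb using exists_harmonicPoly hd (stdHarmonics d)
  -- By Green's formula these fields are orthonormal, and the coefficients of `∇w` against them have
  -- modulus `√ℓ ≥ 1` times that of the trace coefficients. Parseval for the trace and Bessel for
  -- `∇w` then compare the norms.
  let g := fun i => ((√((i.1 : ℕ) : ℝ) : ℝ) : ℂ)⁻¹ • (polyTriple (p i)).2.1
  have hs0 : ∀ i : (Σ ℓ : ℕ+, Fin (Module.finrank ℂ (sphericalHarmonics d ℓ))),
      ((√((i.1 : ℕ) : ℝ) : ℝ) : ℂ) ≠ 0 := by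
    intro i
    exact_mod_cast (Real.sqrt_pos.mpr (by exact_mod_cast i.1.pos)).ne'
  have hs1 : ∀ i : (Σ ℓ : ℕ+, Fin (Module.finrank ℂ (sphericalHarmonics d ℓ))),
      ((√((i.1 : ℕ) : ℝ) : ℝ) : ℂ) * ((√((i.1 : ℕ) : ℝ) : ℝ) : ℂ) = ((i.1 : ℕ) : ℂ) := by
    intro i
    exact_mod_cast Real.mul_self_sqrt (Nat.cast_nonneg ((i.1 : ℕ)))
  have hg : Orthonormal ℂ g := by
    classical
    rw [orthonormal_iff_ite]
    intro i j
    simp only [g]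
    rw [inner_smul_left, inner_smul_right, inner_polyTriple_grad hd (hp j), hpb, hpb,
      ← Submodule.coe_inner, orthonormal_iff_ite.mp b.orthonormal i j, map_inv₀,
      Complex.conj_ofReal]
    by_cases hij : i = j
    · subst hij
      have := hs0 i
      rw [if_pos rfl, ← hs1 i]
      field_simp
    · simp [hij]
  let t : L2Mean d := ⟨w.2.2, hw'⟩
  have hin : ∀ i, ‖inner ℂ (b i) t‖ ^ 2 ≤ ‖inner ℂ (g i) w.2.1‖ ^ 2 := by
    intro i
    have h1 : inner ℂ w.2.1 (g i) = ((√((i.1 : ℕ) : ℝ) : ℝ) : ℂ) * inner ℂ w.2.2 (b i : L2Sphere d) := by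
      simp only [g]
      have := hs0 i
      rw [inner_smul_right, inner_grad_polyTriple hd (hp i) hw, hpb, ← hs1 i, hb]
      field_simp
    have h2 : 1 ≤ √((i.1 : ℕ) : ℝ) := Real.one_le_sqrt.mpr (by exact_mod_cast i.1.pos)
    have h3 : ‖inner ℂ (b i) t‖ = ‖inner ℂ w.2.2 (b i : L2Sphere d)‖ := by
      rw [← inner_conj_symm, RCLike.norm_conj]
      rfl
    have h4 : ‖inner ℂ (g i) w.2.1‖ = ‖inner ℂ w.2.1 (g i)‖ := by
      rw [← inner_conj_symm, RCLike.norm_conj]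
    rw [h3, h4, h1, norm_mul, Complex.norm_real, Real.norm_of_nonneg (by linarith)]
    gcongr
    exact le_mul_of_one_le_left (norm_nonneg _) h2
  have hsum : HasSum (fun i => ‖inner ℂ (b i) t‖ ^ 2) (‖t‖ ^ 2) := by
    have h1 := b.hasSum_inner_mul_inner t t
    rw [inner_self_eq_norm_sq_to_K] at h1
    have h2 : ∀ i, inner ℂ t (b i) * inner ℂ (b i) t = ((‖inner ℂ (b i) t‖ ^ 2 : ℝ) : ℂ) := by
      intro i
      rw [← inner_conj_symm t (b i), RCLike.conj_mul]
      push_cast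
      rfl
    simp_rw [h2] at h1
    exact Complex.hasSum_ofReal.mp (by simpa using h1)
  have hle : ‖t‖ ^ 2 ≤ ‖w.2.1‖ ^ 2 := by
    refine hasSum_le_of_sum_le hsum fun s => ?_
    exact (Finset.sum_le_sum fun i _ => hin i).trans (hg.sum_inner_products_le w.2.1)
  exact (pow_le_pow_iff_left₀ (norm_nonneg _) (norm_nonneg _) two_ne_zero).mp hle

theorem norm_fderiv_self_le {d : ℕ} (φ : Space d → ℂ) (x : Space d) :
    ‖fderiv ℝ φ x x‖ ≤ ‖x‖ * ‖grad φ x‖ := by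
  have h1 : fderiv ℝ φ x x =
      inner ℂ (WithLp.toLp 2 fun i => ((x i : ℝ) : ℂ) : EuclideanSpace ℂ (Fin d)) (grad φ x) := by
    rw [map_eq_sum_coord, PiLp.inner_apply]
    simp [grad, mul_comm]
  have h2 : ‖(WithLp.toLp 2 fun i => ((x i : ℝ) : ℂ) : EuclideanSpace ℂ (Fin d))‖ = ‖x‖ := by
    rw [EuclideanSpace.norm_eq, EuclideanSpace.norm_eq]
    simp
  rw [h1, ← h2]
  exact norm_inner_le_norm _ _

/-- For smooth `φ`, integrating `div(|φ|² x) = d|φ|² + x · ∇|φ|²` over the ball gives `‖φ‖²` on the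
sphere; Cauchy-Schwarz with `|x| < 1` bounds the last term. -/
theorem norm_fst_sq_le {d : ℕ} (hd : 0 < d) {w : Triple d} (hw : w ∈ sobolevH1 d) :
    d * ‖w.1‖ ^ 2 ≤ ‖w.2.2‖ ^ 2 + 2 * (‖w.1‖ * ‖w.2.1‖) := by
  have hcl : IsClosed {w : Triple d | d * ‖w.1‖ ^ 2 ≤ ‖w.2.2‖ ^ 2 + 2 * (‖w.1‖ * ‖w.2.1‖)} :=
    isClosed_le (by fun_prop) (by fun_prop)
  refine closure_minimal (fun w hw => ?_) hcl hw
  obtain ⟨φ, hφ, h1, h2, h3⟩ := hw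
  have hφ1 : ContDiff ℝ 1 φ := hφ.of_le (by simp)
  have hR := integral_sphere_eq hd ((contDiff_star hφ1).mul hφ1)
  have hcE : Continuous fun x => fderiv ℝ φ x x :=
    (hφ1.continuous_fderiv (by norm_num)).clm_apply continuous_id
  let D : L2Ball d := MemLp.toLp _ (memLp_ball_of_continuous hcE 2)
  have hD : D =ᵐ[ballMeasure d] fun x => fderiv ℝ φ x x := MemLp.coeFn_toLp _
  have hDn : ‖D‖ ≤ ‖w.2.1‖ := by
    refine Lp.norm_le_norm_of_ae_le ?_
    filter_upwards [hD, h2, ae_restrict_mem measurableSet_ball] with x hx1 hx2 hx3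
    rw [hx1, hx2]
    have : ‖x‖ < 1 := by simpa using hx3
    exact (norm_fderiv_self_le φ x).trans (mul_le_of_le_one_left (norm_nonneg _) this.le)
  have key : inner ℂ w.2.2 w.2.2 = d * inner ℂ w.1 w.1 + (inner ℂ D w.1 + inner ℂ w.1 D) := by
    simp only [L2.inner_def]
    rw [← integral_const_mul, ← integral_add (L2.integrable_inner _ _) (L2.integrable_inner _ _),
      ← integral_add ((L2.integrable_inner _ _).const_mul _)
        ((L2.integrable_inner _ _).add (L2.integrable_inner _ _))]
    have e1 : ∫ a, inner ℂ (w.2.2 a) (w.2.2 a) ∂surfaceMeasure d =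
        ∫ θ, (star (φ θ) * φ θ) ∂surfaceMeasure d := by
      refine integral_congr_ae ?_
      filter_upwards [h3] with θ hθ
      rw [hθ, RCLike.inner_apply, starRingEnd_apply, mul_comm]
    rw [e1]
    refine hR.symm.trans (integral_congr_ae ?_)
    filter_upwards [h1, hD] with x hx1 hx2
    rw [hx1, hx2, fderiv_fun_mul ((contDiff_star hφ1).differentiable (by norm_num) x)
      (hφ1.differentiable (by norm_num) x), add_apply, smul_apply, smul_apply,
      fderiv_star _ _ (hφ1.differentiable (by norm_num) x)]
    simp only [RCLike.inner_apply, starRingEnd_apply, smul_eq_mul]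
    ring
  have hre := congrArg Complex.re key
  have hn : (d : ℂ) * inner ℂ w.1 w.1 = ((d * ‖w.1‖ ^ 2 : ℝ) : ℂ) := by
    rw [inner_self_eq_norm_sq_to_K]; push_cast; rfl
  have hn2 : inner ℂ w.2.2 w.2.2 = ((‖w.2.2‖ ^ 2 : ℝ) : ℂ) := by
    rw [inner_self_eq_norm_sq_to_K]; push_cast; rfl
  rw [hn, hn2] at hre
  simp only [Complex.add_re, Complex.ofReal_re] at hre
  have b1 : -(‖w.1‖ * ‖w.2.1‖) ≤ (inner ℂ D w.1).re := by
    have := (Complex.abs_re_le_norm (inner ℂ D w.1)).trans (norm_inner_le_norm D w.1)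
    have := (abs_le.mp this).1
    nlinarith [norm_nonneg w.1]
  have b2 : -(‖w.1‖ * ‖w.2.1‖) ≤ (inner ℂ w.1 D).re := by
    have := (Complex.abs_re_le_norm (inner ℂ w.1 D)).trans (norm_inner_le_norm w.1 D)
    have := (abs_le.mp this).1
    nlinarith [norm_nonneg w.1]
  simp only [Set.mem_ofPred_eq]
  linarith

/-- The gradient controls the `H¹`-norm of functions with mean-free trace. -/
theorem norm_le_norm_grad {d : ℕ} (hd : 0 < d) {w : Triple d} (hw : w ∈ sobolevH1 d)
    (hw' : w.2.2 ∈ L2Mean d) : ‖w‖ ≤ 3 * ‖w.2.1‖ := by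
  have h1 := norm_trace_le hd hw hw'
  have h2 := norm_fst_sq_le hd hw
  have hd1 : (1 : ℝ) ≤ d := by exact_mod_cast hd
  have h3 : ‖w.1‖ ^ 2 ≤ ‖w.2.1‖ ^ 2 + 2 * (‖w.1‖ * ‖w.2.1‖) := by
    nlinarith [norm_nonneg w.2.2, sq_nonneg ‖w.1‖]
  -- From `a² ≤ b² + 2ab` follows `a ≤ (1 + √2) b`, and `1 + √2 < 3`.
  have h4 : ‖w.1‖ ≤ 3 * ‖w.2.1‖ := by
    by_contra! h
    nlinarith [norm_nonneg w.2.1, norm_nonneg w.1]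
  have h5 := norm_nonneg w.2.1
  rw [Prod.norm_def, Prod.norm_def]
  exact max_le h4 (max_le (by linarith) (by linarith))

/-! ### Matrix entries of a radial perturbation -/

theorem integrable_mul_inner_polyTriple {d : ℕ} (η : L2Ball d) (p q : MvPolynomial (Fin d) ℂ) :
    Integrable (fun x => η x * inner ℂ ((polyTriple q).2.1 x) ((polyTriple p).2.1 x))
      (ballMeasure d) := by
  have hc : Continuous fun x : Space d => inner ℂ (grad (polyFun q) x) (grad (polyFun p) x) :=
    (continuous_grad (contDiff_polyFun q)).inner (continuous_grad (contDiff_polyFun p))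
  have h1 := (Lp.memLp η).integrable_mul (memLp_ball_of_continuous hc 2)
  refine h1.congr ?_
  filter_upwards [coeFn_polyTriple_grad p, coeFn_polyTriple_grad q] with x h2 h3
  rw [Pi.mul_apply, h2, h3]

/-- Homogeneity separates the radial integral from the spherical one. The latter is never computed
directly: it is solved for from the case `h = 1`, where Green's formula gives the left-hand side and
the radial integral is `1/(m + d)`, with `m` the degree of homogeneity. -/
theorem integral_radial_mul_inner_grad {d ℓ ℓ' : ℕ} (hd : 0 < d) (h : ℝ → ℂ)
    {p q : MvPolynomial (Fin d) ℂ} (hp : p ∈ harmonicPolys d ℓ) (hq : q ∈ harmonicPolys d ℓ') :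
    ∫ x, h ‖x‖ * inner ℂ (grad (polyFun q) x) (grad (polyFun p) x) ∂ballMeasure d =
      (∫ r in (0 : ℝ)..1, h r * (r : ℂ) ^ (ℓ' - 1 + (ℓ - 1)) * ((r ^ (d - 1) : ℝ) : ℂ)) *
        (((ℓ' - 1 + (ℓ - 1) : ℕ) + d) *
          (ℓ * inner ℂ (restrictToSphere d q) (restrictToSphere d p))) := by
  have hhom : ∀ (r : ℝ) (x : Space d), 0 < r →
      inner ℂ (grad (polyFun q) (r • x)) (grad (polyFun p) (r • x)) =
        (r : ℂ) ^ (ℓ' - 1 + (ℓ - 1)) * inner ℂ (grad (polyFun q) x) (grad (polyFun p) x) := by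
    intro r x _
    have hp' : p.IsHomogeneous ℓ := hp.1
    have hq' : q.IsHomogeneous ℓ' := hq.1
    simp only [grad_polyFun, PiLp.inner_apply, polyFun_smul hp'.pderiv, polyFun_smul hq'.pderiv,
      Finset.mul_sum]
    refine Finset.sum_congr rfl fun i _ => ?_
    simp [pow_add]
    ring
  let G : Space d → ℂ := fun x => inner ℂ (grad (polyFun q) x) (grad (polyFun p) x)
  have h1 := integral_ball_radial_mul hd h G _ hhom
  have h2 := integral_ball_radial_mul hd (fun _ => 1) G _ hhom
  have h3 : ∫ x, (1 : ℂ) * inner ℂ (grad (polyFun q) x) (grad (polyFun p) x) ∂ballMeasure d =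
      ℓ * inner ℂ (restrictToSphere d q) (restrictToSphere d p) := by
    rw [← inner_polyTriple_grad hd hp, L2.inner_def]
    refine integral_congr_ae ?_
    filter_upwards [coeFn_polyTriple_grad p, coeFn_polyTriple_grad q] with x h2 h3
    rw [h2, h3, one_mul]
  set m := ℓ' - 1 + (ℓ - 1) with hm
  have h4 : ∫ r in (0 : ℝ)..1, (1 : ℂ) * (r : ℂ) ^ m * ((r ^ (d - 1) : ℝ) : ℂ) =
      ((m : ℂ) + d)⁻¹ := by
    have : ∀ r : ℝ, (1 : ℂ) * (r : ℂ) ^ m * ((r ^ (d - 1) : ℝ) : ℂ) =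
        ((r ^ (m + (d - 1)) : ℝ) : ℂ) := by
      intro r
      push_cast
      ring
    simp_rw [this]
    rw [intervalIntegral.integral_ofReal, integral_pow]
    have h5 : ((m + (d - 1) : ℕ) : ℝ) + 1 = m + d := by
      have : m + (d - 1) + 1 = m + d := by omega
      exact_mod_cast this
    rw [h5, zero_pow (Nat.succ_ne_zero _)]
    push_cast
    simp
  have h2' := h3.symm.trans h2
  rw [h4] at h2'
  have hmd : (m : ℂ) + d ≠ 0 := by exact_mod_cast (by omega : m + d ≠ 0)
  rw [h1, h2', mul_inv_cancel_left₀ hmd]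

theorem integral_mul_inner_polyTriple {d ℓ ℓ' : ℕ} (hd : 0 < d) {η : L2Ball d} {h : ℝ → ℂ}
    (hη : IsRadialProfile h η) {p q : MvPolynomial (Fin d) ℂ} (hp : p ∈ harmonicPolys d ℓ)
    (hq : q ∈ harmonicPolys d ℓ') (hℓ : 1 ≤ ℓ) :
    ∫ x, η x * inner ℂ ((polyTriple q).2.1 x) ((polyTriple p).2.1 x) ∂ballMeasure d =
      -(ℓ : ℂ) ^ 2 * eigenvalue d ℓ h *
        inner ℂ (restrictToSphere d q) (restrictToSphere d p) := by
  have h1 : ∫ x, η x * inner ℂ ((polyTriple q).2.1 x) ((polyTriple p).2.1 x) ∂ballMeasure d =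
      ∫ x, h ‖x‖ * inner ℂ (grad (polyFun q) x) (grad (polyFun p) x) ∂ballMeasure d := by
    refine integral_congr_ae ?_
    filter_upwards [coeFn_polyTriple_grad p, coeFn_polyTriple_grad q, hη.2] with x h2 h3 h4
    rw [h2, h3, h4]
  rw [h1, integral_radial_mul_inner_grad hd h hp hq]
  by_cases hne : ℓ = ℓ'
  · subst hne
    rw [eigenvalue_eq hd hη hℓ, show ℓ - 1 + (ℓ - 1) = 2 * ℓ - 2 by omega]
    have : (ℓ : ℂ) ≠ 0 := by exact_mod_cast (by omega : ℓ ≠ 0)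
    push_cast
    field_simp
  · rw [inner_restrictToSphere_of_ne hd hp hq hne]
    simp

/-! ### The Neumann problem on the space of gradients -/

/-- The subspace of smooth triples. -/
noncomputable def smoothSubmodule (d : ℕ) : Submodule ℂ (Triple d) where
  carrier := smoothTriples d
  zero_mem' := by
    refine ⟨fun _ => 0, contDiff_const, Lp.coeFn_zero ℂ 2 _, ?_, Lp.coeFn_zero ℂ 2 _⟩
    filter_upwards [Lp.coeFn_zero (EuclideanSpace ℂ (Fin d)) 2 (ballMeasure d)] with x hx
    refine hx.trans ?_
    ext i
    simp [grad]
  add_mem' := by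
    rintro v w ⟨φ, hφ, h1, h2, h3⟩ ⟨ψ, hψ, k1, k2, k3⟩
    refine ⟨fun x => φ x + ψ x, hφ.add hψ, ?_, ?_, ?_⟩
    · filter_upwards [Lp.coeFn_add v.1 w.1, h1, k1] with x e1 e2 e3
      rw [Prod.fst_add, e1, Pi.add_apply, e2, e3]
    · filter_upwards [Lp.coeFn_add v.2.1 w.2.1, h2, k2] with x e1 e2 e3
      rw [Prod.snd_add, Prod.fst_add, e1, Pi.add_apply, e2, e3]
      ext i
      simp only [grad, PiLp.add_apply]
      rw [fderiv_fun_add (hφ.differentiable (by simp) x) (hψ.differentiable (by simp) x)]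
      rfl
    · filter_upwards [Lp.coeFn_add v.2.2 w.2.2, h3, k3] with x e1 e2 e3
      rw [Prod.snd_add, Prod.snd_add, e1, Pi.add_apply, e2, e3]
  smul_mem' := by
    rintro c v ⟨φ, hφ, h1, h2, h3⟩
    refine ⟨fun x => c * φ x, contDiff_const.mul hφ, ?_, ?_, ?_⟩
    · filter_upwards [Lp.coeFn_smul c v.1, h1] with x e1 e2
      rw [Prod.smul_fst, e1, Pi.smul_apply, e2, smul_eq_mul]
    · filter_upwards [Lp.coeFn_smul c v.2.1, h2] with x e1 e2
      rw [Prod.smul_snd, Prod.smul_fst, e1, Pi.smul_apply, e2]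
      ext i
      simp only [grad, PiLp.smul_apply]
      rw [fderiv_const_mul (hφ.differentiable (by simp) x)]
      rfl
    · filter_upwards [Lp.coeFn_smul c v.2.2, h3] with x e1 e2
      rw [Prod.smul_snd, Prod.smul_snd, e1, Pi.smul_apply, e2, smul_eq_mul]

/-- The gradient of a triple. -/
noncomputable def gradCLM (d : ℕ) : Triple d →L[ℂ] L2Vec d :=
  ContinuousLinearMap.fst ℂ _ _ ∘L ContinuousLinearMap.snd ℂ _ _

/-- The trace of a triple. -/
noncomputable def traceCLM (d : ℕ) : Triple d →L[ℂ] L2Sphere d :=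
  ContinuousLinearMap.snd ℂ _ _ ∘L ContinuousLinearMap.snd ℂ _ _

/-- The elements of `H¹(B)` with mean-free trace. -/
noncomputable def meanFreeH1 (d : ℕ) : Submodule ℂ (Triple d) :=
  (smoothSubmodule d).topologicalClosure ⊓ (L2Mean d).comap (traceCLM d).toLinearMap

theorem mem_meanFreeH1 {d : ℕ} {w : Triple d} :
    w ∈ meanFreeH1 d ↔ w ∈ sobolevH1 d ∧ w.2.2 ∈ L2Mean d := Iff.rfl

theorem isClosed_meanFreeH1 (d : ℕ) : IsClosed (meanFreeH1 d : Set (Triple d)) :=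
  (Submodule.isClosed_topologicalClosure _).inter
    ((Submodule.isClosed_orthogonal _).preimage (traceCLM d).continuous)

instance (d : ℕ) : CompleteSpace (meanFreeH1 d) := (isClosed_meanFreeH1 d).completeSpace_coe

/-- The gradient on the elements of `H¹(B)` with mean-free trace. -/
noncomputable def meanFreeGrad (d : ℕ) : meanFreeH1 d →L[ℂ] L2Vec d := gradCLM d ∘L (meanFreeH1 d).subtypeL

/-- The gradient is bounded below, so its range is closed and a Hilbert space on which projections
and adjoints are available. -/
theorem antilipschitz_meanFreeGrad {d : ℕ} (hd : 0 < d) :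
    AntilipschitzWith 3 (meanFreeGrad d) := by
  refine AddMonoidHomClass.antilipschitz_of_bound _ fun w => ?_
  exact norm_le_norm_grad hd w.2.1 w.2.2

/-- The space of gradients of elements of `H¹(B)` with mean-free trace. -/
noncomputable abbrev gradSpace (d : ℕ) : Submodule ℂ (L2Vec d) := (meanFreeGrad d).range

theorem isClosed_range_meanFreeGrad {d : ℕ} (hd : 0 < d) :
    IsClosed (Set.range (meanFreeGrad d)) :=
  (antilipschitz_meanFreeGrad hd).isClosed_range (meanFreeGrad d).uniformContinuous

theorem completeSpace_gradSpace {d : ℕ} (hd : 0 < d) : CompleteSpace (gradSpace d) :=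
  (isClosed_range_meanFreeGrad hd).completeSpace_coe

/-- The gradient as an isomorphism onto its range. -/
noncomputable def gradEquiv {d : ℕ} (hd : 0 < d) : meanFreeH1 d ≃L[ℂ] gradSpace d :=
  (meanFreeGrad d).equivRange (antilipschitz_meanFreeGrad hd).injective
    (isClosed_range_meanFreeGrad hd)

theorem gradEquiv_coe {d : ℕ} (hd : 0 < d) (w : meanFreeH1 d) :
    (gradEquiv hd w : L2Vec d) = (w : Triple d).2.1 := rfl

/-- The trace of a function with given gradient. -/
noncomputable def gradTrace {d : ℕ} (hd : 0 < d) : gradSpace d →L[ℂ] L2Mean d :=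
  (traceCLM d ∘L (meanFreeH1 d).subtypeL ∘L
    (gradEquiv hd).symm.toContinuousLinearMap).codRestrict (L2Mean d)
    fun v => ((gradEquiv hd).symm v).2.2

theorem gradTrace_gradEquiv {d : ℕ} (hd : 0 < d) (w : meanFreeH1 d) :
    (gradTrace hd (gradEquiv hd w) : L2Sphere d) = (w : Triple d).2.2 := by
  change ((((gradEquiv hd).symm (gradEquiv hd w) : meanFreeH1 d) : Triple d)).2.2 = _
  rw [ContinuousLinearEquiv.symm_apply_apply]

/-- Multiplication of a vector field by a coefficient. -/
noncomputable def mulCoeff (d : ℕ) : LInfBall d →L[ℂ] L2Vec d →L[ℂ] L2Vec d :=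
  (ContinuousLinearMap.lsmul ℂ ℂ : ℂ →L[ℂ] EuclideanSpace ℂ (Fin d) →L[ℂ]
    EuclideanSpace ℂ (Fin d)).holderL (ballMeasure d) ∞ 2 2

theorem inner_mulCoeff {d : ℕ} (γ : LInfBall d) (v w : L2Vec d) :
    inner ℂ v (mulCoeff d γ w) = ∫ x, γ x * inner ℂ (v x) (w x) ∂ballMeasure d := by
  rw [L2.inner_def]
  refine integral_congr_ae ?_
  have h : mulCoeff d γ w =ᵐ[ballMeasure d] fun x => γ x • w x :=
    ContinuousLinearMap.coeFn_holder _ γ w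
  filter_upwards [h] with x hx
  rw [hx, inner_smul_right]

/-- The derivative of inversion at the identity is negation; the rest is the chain rule. -/
theorem exists_hasFDerivAt_comp_inverse {X V M : Type*} [NormedAddCommGroup X] [NormedSpace ℂ X]
    [NormedAddCommGroup V] [NormedSpace ℂ V] [CompleteSpace V] [NormedAddCommGroup M]
    [NormedSpace ℂ M] (A : X →L[ℂ] V →L[ℂ] V) (T : V →L[ℂ] M) (S : M →L[ℂ] V) {x : X}
    (hx : A x = 1) :
    ∃ L : X →L[ℂ] M →L[ℂ] M, HasFDerivAt (fun y => T ∘L Ring.inverse (A y) ∘L S) L x ∧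
      ∀ ξ f, L ξ f = -T (A ξ (S f)) := by
  have h1 := hasFDerivAt_ringInverse (𝕜 := ℂ) (R := V →L[ℂ] V) 1
  rw [Units.val_one, ← hx] at h1
  have h2 := h1.comp x A.hasFDerivAt
  let Φ : (V →L[ℂ] V) →L[ℂ] M →L[ℂ] M :=
    ContinuousLinearMap.postcomp M T ∘L ContinuousLinearMap.precomp V S
  refine ⟨_, Φ.hasFDerivAt.comp x h2, fun ξ f => ?_⟩
  simp [Φ]

theorem gradSpace_one_apply {d : ℕ} (v : gradSpace d) :
    (1 : gradSpace d →L[ℂ] gradSpace d) v = v := rfl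

theorem gradSpace_mul_apply {d : ℕ} (S T : gradSpace d →L[ℂ] gradSpace d) (v : gradSpace d) :
    (S * T) v = S (T v) := rfl

section

variable {d : ℕ} (hd : 0 < d)

/-- The operator of the Neumann problem with coefficient `γ` on the space of gradients. -/
noncomputable def neumannOp : LInfBall d →L[ℂ] gradSpace d →L[ℂ] gradSpace d :=
  haveI := completeSpace_gradSpace hd
  ContinuousLinearMap.postcomp (gradSpace d) (gradSpace d).orthogonalProjectionOnto ∘L
    ContinuousLinearMap.precomp (L2Vec d) (gradSpace d).subtypeL ∘L mulCoeff d

theorem inner_neumannOp (γ : LInfBall d) (v w : gradSpace d) :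
    inner ℂ v (neumannOp hd γ w) =
      ∫ x, γ x * inner ℂ ((v : L2Vec d) x) ((w : L2Vec d) x) ∂ballMeasure d := by
  have := completeSpace_gradSpace hd
  rw [← inner_mulCoeff, Submodule.coe_inner]
  change inner ℂ (v : L2Vec d)
    ((gradSpace d).orthogonalProjectionOnto (mulCoeff d γ w) : L2Vec d) = _
  rw [← Submodule.coe_inner, Submodule.inner_orthogonalProjectionOnto_eq_of_mem_left]

theorem neumannOp_one : neumannOp hd (oneCoeff d) = 1 := by
  ext1 w
  refine ext_inner_left ℂ fun v => ?_
  rw [inner_neumannOp, gradSpace_one_apply, Submodule.coe_inner, L2.inner_def]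
  refine integral_congr_ae ?_
  filter_upwards [Lp.coeFn_const ∞ (ballMeasure d) (1 : ℂ)] with x hx
  rw [oneCoeff, hx]
  simp

/-- The adjoint of the trace operator. -/
noncomputable def gradTraceAdjoint : L2Mean d →L[ℂ] gradSpace d :=
  haveI := completeSpace_gradSpace hd
  ContinuousLinearMap.adjoint (gradTrace hd)

theorem inner_gradTraceAdjoint (v : gradSpace d) (f : L2Mean d) :
    inner ℂ v (gradTraceAdjoint hd f) = inner ℂ (gradTrace hd v) f := by
  have := completeSpace_gradSpace hd
  exact ContinuousLinearMap.adjoint_inner_right _ _ _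

theorem inner_gradTraceAdjoint_left (f : L2Mean d) (v : gradSpace d) :
    inner ℂ (gradTraceAdjoint hd f) v = inner ℂ f (gradTrace hd v) := by
  have := completeSpace_gradSpace hd
  exact ContinuousLinearMap.adjoint_inner_left _ _ _

/-- Subtracting a constant makes the trace mean-free and changes neither the gradient nor pairings
with mean-free currents. Testing the weak equation in the mean-free space is therefore enough. -/
theorem exists_mean_sub {v : Triple d} (hv : v ∈ sobolevH1 d) :
    ∃ v' ∈ meanFreeH1 d, v'.2.1 = v.2.1 ∧
      ∀ f : L2Mean d, inner ℂ v'.2.2 (f : L2Sphere d) = inner ℂ v.2.2 (f : L2Sphere d) := by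
  obtain ⟨y, hy, z, hz, hyz⟩ := Submodule.exists_add_mem_mem_orthogonal
    (K := Submodule.span ℂ {Lp.const 2 (surfaceMeasure d) (1 : ℂ)}) v.2.2
  obtain ⟨a, rfl⟩ := Submodule.mem_span_singleton.mp hy
  set c : Triple d := polyTriple (MvPolynomial.C a) with hc
  have hc2 : c.2.2 = a • Lp.const 2 (surfaceMeasure d) (1 : ℂ) := by
    rw [hc, polyTriple_trace, restrictToSphere_C]
  have hc1 : c.2.1 = 0 := by
    refine Lp.ext ?_
    filter_upwards [coeFn_polyTriple_grad (MvPolynomial.C a : MvPolynomial (Fin d) ℂ),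
      Lp.coeFn_zero (EuclideanSpace ℂ (Fin d)) 2 (ballMeasure d)] with x h1 h2
    rw [hc, h1, h2, grad_polyFun]
    ext i
    simp [polyFun]
  refine ⟨v - c, mem_meanFreeH1.mpr ⟨?_, ?_⟩, ?_, fun f => ?_⟩
  · have : v - c ∈ (smoothSubmodule d).topologicalClosure :=
      Submodule.sub_mem _ hv (polyTriple_mem _)
    exact this
  · have : (v - c).2.2 = z := by
      rw [Prod.snd_sub, Prod.snd_sub, hc2, hyz, add_sub_cancel_left]
    rw [this]
    exact hz
  · rw [Prod.snd_sub, Prod.fst_sub, hc1, sub_zero]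
  · rw [Prod.snd_sub, Prod.snd_sub, hc2, inner_sub_left, f.2 _ hy, sub_zero]

theorem isNeumannSolution_iff (γ : LInfBall d) (f : L2Mean d) (w : Triple d) :
    IsNeumannSolution γ f w ↔ ∃ hw : w ∈ meanFreeH1 d,
      neumannOp hd γ (gradEquiv hd ⟨w, hw⟩) = gradTraceAdjoint hd f := by
  constructor
  · rintro ⟨h1, h2, h3⟩
    refine ⟨⟨h1, h2⟩, ext_inner_left ℂ fun v => ?_⟩
    obtain ⟨v, rfl⟩ := (gradEquiv hd).surjective v
    rw [inner_neumannOp, inner_gradTraceAdjoint, gradEquiv_coe, gradEquiv_coe,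
      h3 v v.2.1, Submodule.coe_inner, gradTrace_gradEquiv]
  · rintro ⟨hw, h⟩
    refine ⟨hw.1, hw.2, fun v hv => ?_⟩
    obtain ⟨v', hv', h1, h2⟩ := exists_mean_sub hv
    have h3 : inner ℂ (gradEquiv hd ⟨v', hv'⟩) _ = inner ℂ (gradEquiv hd ⟨v', hv'⟩) _ :=
      congrArg (inner ℂ (gradEquiv hd ⟨v', hv'⟩)) h
    rw [inner_neumannOp, inner_gradTraceAdjoint, gradEquiv_coe, gradEquiv_coe,
      Submodule.coe_inner, gradTrace_gradEquiv] at h3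
    rw [← h1, h3, h2]

/-- The solution operator of the Neumann problem. -/
noncomputable def neumannToDirichlet (γ : LInfBall d) : L2Mean d →L[ℂ] L2Mean d :=
  gradTrace hd ∘L Ring.inverse (neumannOp hd γ) ∘L gradTraceAdjoint hd

theorem isNDMap_neumannToDirichlet {γ : LInfBall d} (hγ : IsUnit (neumannOp hd γ)) :
    IsNDMap γ (neumannToDirichlet hd γ) := by
  have hsol : ∀ (f : L2Mean d) (w : Triple d) (hw : w ∈ meanFreeH1 d),
      neumannOp hd γ (gradEquiv hd ⟨w, hw⟩) = gradTraceAdjoint hd f →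
      gradEquiv hd ⟨w, hw⟩ = Ring.inverse (neumannOp hd γ) (gradTraceAdjoint hd f) := by
    intro f w hw h
    rw [← h, ← gradSpace_mul_apply, Ring.inverse_mul_cancel _ hγ, gradSpace_one_apply]
  intro f
  refine ⟨?_, ?_⟩
  · set v := Ring.inverse (neumannOp hd γ) (gradTraceAdjoint hd f) with hv
    refine ⟨(gradEquiv hd).symm v, ?_, ?_⟩
    · refine (isNeumannSolution_iff hd γ f _).mpr ⟨((gradEquiv hd).symm v).2, ?_⟩
      rw [Subtype.coe_eta, ContinuousLinearEquiv.apply_symm_apply, hv, ← gradSpace_mul_apply,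
        Ring.mul_inverse_cancel _ hγ, gradSpace_one_apply]
    · intro w hw
      obtain ⟨hw1, hw2⟩ := (isNeumannSolution_iff hd γ f w).mp hw
      rw [hv, ← hsol f w hw1 hw2, ContinuousLinearEquiv.symm_apply_apply]
  · intro w hw
    obtain ⟨hw1, hw2⟩ := (isNeumannSolution_iff hd γ f w).mp hw
    change (gradTrace hd (Ring.inverse (neumannOp hd γ) (gradTraceAdjoint hd f)) : L2Sphere d) = _
    rw [← hsol f w hw1 hw2, gradTrace_gradEquiv]

/-- Needed because `ndMap` is an arbitrary choice among operators with this property. -/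
theorem IsNDMap.unique {γ : LInfBall d} {S T : L2Mean d →L[ℂ] L2Mean d} (hS : IsNDMap γ S)
    (hT : IsNDMap γ T) : S = T := by
  ext1 f
  obtain ⟨w, hw, -⟩ := (hS f).1
  exact Subtype.ext (((hS f).2 w hw).trans ((hT f).2 w hw).symm)

theorem isNDMap_ndMap {γ : LInfBall d} (hγ : IsUnit (neumannOp hd γ)) :
    IsNDMap γ (ndMap d γ) := by
  have h : ∃ T : L2Mean d →L[ℂ] L2Mean d, IsNDMap γ T := ⟨_, isNDMap_neumannToDirichlet hd hγ⟩
  rw [ndMap, dif_pos h]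
  exact h.choose_spec

theorem ndMap_eq {γ : LInfBall d} (hγ : IsUnit (neumannOp hd γ)) :
    ndMap d γ = neumannToDirichlet hd γ :=
  (isNDMap_ndMap hd hγ).unique (isNDMap_neumannToDirichlet hd hγ)

include hd in
theorem isUnit_neumannOp_one : IsUnit (neumannOp hd (oneCoeff d)) := by
  rw [neumannOp_one]
  exact isUnit_one

theorem eventually_isUnit_neumannOp : ∀ᶠ γ in 𝓝 (oneCoeff d), IsUnit (neumannOp hd γ) := by
  have := completeSpace_gradSpace hd
  have h : {T : gradSpace d →L[ℂ] gradSpace d | IsUnit T} ∈ 𝓝 (neumannOp hd (oneCoeff d)) :=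
    (Units.isOpen (R := gradSpace d →L[ℂ] gradSpace d)).mem_nhds (isUnit_neumannOp_one hd)
  exact (neumannOp hd).continuous.continuousAt h

/-- Invertibility is an open condition, so near `1` the map coincides with the explicit formula `T
A(γ)⁻¹ T*`, which is differentiable there. -/
theorem exists_hasFDerivAt_ndMap : ∃ L : LInfBall d →L[ℂ] L2Mean d →L[ℂ] L2Mean d,
    HasFDerivAt (ndMap d) L (oneCoeff d) ∧
      ∀ ξ f, L ξ f = -gradTrace hd (neumannOp hd ξ (gradTraceAdjoint hd f)) := by
  have := completeSpace_gradSpace hd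
  obtain ⟨L, hL, hL'⟩ := exists_hasFDerivAt_comp_inverse (neumannOp hd) (gradTrace hd)
    (gradTraceAdjoint hd) (neumannOp_one hd)
  refine ⟨L, hL.congr_of_eventuallyEq ?_, hL'⟩
  filter_upwards [eventually_isUnit_neumannOp hd] with γ hγ
  exact ndMap_eq hd hγ

include hd in
-- At `γ = 1` the weak equation says `∇u = T* f` and `∇v = T* g`, so moving `T` to the other side of
-- the inner product leaves exactly the two gradients.
theorem inner_linearizedND (ξ : LInfBall d) {f g : L2Mean d} {u v : Triple d}
    (hu : IsNeumannSolution (oneCoeff d) f u) (hv : IsNeumannSolution (oneCoeff d) g v) :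
    inner ℂ g (linearizedND d ξ f) =
      -∫ x, ξ x * inner ℂ (v.2.1 x) (u.2.1 x) ∂ballMeasure d := by
  obtain ⟨hu1, hu2⟩ := (isNeumannSolution_iff hd _ f u).mp hu
  obtain ⟨hv1, hv2⟩ := (isNeumannSolution_iff hd _ g v).mp hv
  rw [neumannOp_one, gradSpace_one_apply] at hu2 hv2
  obtain ⟨L, hL, hL'⟩ := exists_hasFDerivAt_ndMap hd
  have h1 : linearizedND d ξ f = -gradTrace hd (neumannOp hd ξ (gradTraceAdjoint hd f)) := by
    have h2 : linearizedND d = L := hL.fderiv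
    rw [h2, hL']
  rw [h1, inner_neg_right, ← inner_gradTraceAdjoint_left,
    inner_neumannOp, ← hu2, ← hv2, gradEquiv_coe, gradEquiv_coe]

include hd in
theorem existsUnique_isNeumannSolution_one (f : L2Mean d) :
    ∃! w : Triple d, IsNeumannSolution (oneCoeff d) f w :=
  (isNDMap_neumannToDirichlet hd (isUnit_neumannOp_one hd) f).1

end

theorem isNeumannSolution_polyTriple {d ℓ : ℕ} (hd : 0 < d) {p : MvPolynomial (Fin d) ℂ}
    (hp : p ∈ harmonicPolys d ℓ) (hℓ : 1 ≤ ℓ) :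
    IsNeumannSolution (oneCoeff d) (restrictToSphere d p) ((ℓ : ℂ)⁻¹ • polyTriple p) := by
  have hmem : (ℓ : ℂ)⁻¹ • polyTriple p ∈ (smoothSubmodule d).topologicalClosure :=
    Submodule.smul_mem _ _ (polyTriple_mem p)
  refine ⟨hmem, ?_, fun v hv => ?_⟩
  · rw [Prod.smul_snd, Prod.smul_snd, polyTriple_trace]
    exact Submodule.smul_mem _ _ (sphericalHarmonics_le_L2Mean hd hℓ (Submodule.mem_map_of_mem hp))
  · have h0 : (ℓ : ℂ) ≠ 0 := by exact_mod_cast (by omega : ℓ ≠ 0)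
    have h1 : ∫ x, oneCoeff d x * inner ℂ (v.2.1 x) (((ℓ : ℂ)⁻¹ • polyTriple p).2.1 x)
        ∂ballMeasure d = inner ℂ v.2.1 ((ℓ : ℂ)⁻¹ • polyTriple p).2.1 := by
      rw [L2.inner_def]
      refine integral_congr_ae ?_
      filter_upwards [Lp.coeFn_const ∞ (ballMeasure d) (1 : ℂ)] with x hx
      rw [oneCoeff, hx]
      simp
    rw [h1, Prod.smul_snd, Prod.smul_fst, inner_smul_right, inner_grad_polyTriple hd hp hv]
    field_simp

/-! ### Operators diagonal in a Hilbert basis -/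

section Diagonal

variable {ι H E : Type*} [NormedAddCommGroup H] [InnerProductSpace ℂ H]
  [NormedAddCommGroup E] [NormedSpace ℂ E]

theorem memℓp_two_of_norm_le (y : lp (fun _ : ι => ℂ) 2) {x : ι → ℂ} {C : ℝ}
    (h : ∀ i, ‖x i‖ ≤ C * ‖y i‖) : Memℓp x 2 := by
  have h0 : 0 < (2 : ℝ≥0∞).toReal := by norm_num
  refine (memℓp_gen_iff h0).mpr ?_
  refine Summable.of_nonneg_of_le (fun i => by positivity) (fun i => ?_)
    (((lp.memℓp y).summable h0).mul_left (C ^ (2 : ℝ≥0∞).toReal))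
  have h1 := h i
  norm_num only [ENNReal.toReal_ofNat, Real.rpow_ofNat]
  rw [← mul_pow]
  gcongr

theorem norm_le_of_norm_apply_le {x y : lp (fun _ : ι => ℂ) 2} {C : ℝ} (hC : 0 ≤ C)
    (h : ∀ i, ‖x i‖ ≤ C * ‖y i‖) : ‖x‖ ≤ C * ‖y‖ := by
  have h1 : ‖x‖ ≤ ‖(C : ℂ) • y‖ := by
    refine lp.norm_mono (by norm_num) fun i => ?_
    rw [lp.coeFn_smul, Pi.smul_apply, norm_smul, Complex.norm_real, Real.norm_of_nonneg hC]
    exact h i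
  refine h1.trans (le_of_eq ?_)
  rw [norm_smul, Complex.norm_real, Real.norm_of_nonneg hC]

/-- The operators that are diagonal in a Hilbert basis, with eigenvalues that depend linearly and
boundedly on a parameter. -/
noncomputable def diagonal (b : HilbertBasis ι ℂ H) (φ : ι → E →ₗ[ℂ] ℂ) (C : ℝ) (hC : 0 ≤ C)
    (hφ : ∀ i x, ‖φ i x‖ ≤ C * ‖x‖) : E →L[ℂ] H →L[ℂ] H :=
  have h : ∀ (x : E) (g : H) (i : ι), ‖φ i x * b.repr g i‖ ≤ C * ‖x‖ * ‖b.repr g i‖ :=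
    fun x g i => by rw [norm_mul]; exact mul_le_mul_of_nonneg_right (hφ i x) (norm_nonneg _)
  LinearMap.mkContinuous₂
    (LinearMap.mk₂ ℂ (fun x g => b.repr.symm
        ⟨fun i => φ i x * b.repr g i, memℓp_two_of_norm_le (b.repr g) (h x g)⟩)
      (fun x y g => by
        rw [← map_add]; congr 1; ext i; exact (congrArg (· * b.repr g i) ((φ i).map_add x y)).trans (add_mul _ _ _))
      (fun c x g => by
        rw [← map_smul]; congr 1; ext i; simp [mul_assoc])
      (fun x g g' => by
        rw [← map_add]; congr 1; ext i; exact (congrArg (fun z : lp (fun _ : ι => ℂ) 2 => φ i x * z i) (map_add b.repr g g')).trans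
          (mul_add _ _ _))
      (fun c x g => by
        rw [← map_smul]; congr 1; ext i; simp [mul_left_comm]))
    C (fun x g => by
      rw [LinearMap.mk₂_apply, LinearIsometryEquiv.norm_map, ← b.repr.norm_map g]
      exact norm_le_of_norm_apply_le (by positivity) (h x g))

theorem inner_diagonal (b : HilbertBasis ι ℂ H) (φ : ι → E →ₗ[ℂ] ℂ) (C : ℝ) (hC : 0 ≤ C)
    (hφ : ∀ i x, ‖φ i x‖ ≤ C * ‖x‖) (x : E) (g : H) (i : ι) :
    inner ℂ (b i) (diagonal b φ C hC hφ x g) = φ i x * inner ℂ (b i) g := by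
  rw [← b.repr_apply_apply, ← b.repr_apply_apply, diagonal, LinearMap.mkContinuous₂_apply,
    LinearMap.mk₂_apply, LinearIsometryEquiv.apply_symm_apply]

theorem diagonal_apply_basis (b : HilbertBasis ι ℂ H) (φ : ι → E →ₗ[ℂ] ℂ) (C : ℝ) (hC : 0 ≤ C)
    (hφ : ∀ i x, ‖φ i x‖ ≤ C * ‖x‖) (x : E) (i : ι) :
    diagonal b φ C hC hφ x (b i) = φ i x • b i := by
  classical
  refine b.repr.injective (lp.ext (funext fun j => ?_))
  rw [b.repr_apply_apply, inner_diagonal, map_smul, lp.coeFn_smul, Pi.smul_apply,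
    b.repr_apply_apply, smul_eq_mul, orthonormal_iff_ite.mp b.orthonormal j i]
  split_ifs with h
  · rw [h]
  · simp

theorem ext_hilbertBasis (b : HilbertBasis ι ℂ H) {T S : H →L[ℂ] H}
    (h : ∀ i, T (b i) = S (b i)) : T = S := by
  refine ContinuousLinearMap.ext_on (s := Set.range b) ?_ (by rintro _ ⟨i, rfl⟩; exact h i)
  exact Submodule.dense_iff_topologicalClosure_eq_top.mpr b.dense_span

theorem inner_apply_of_eigenbasis (b : HilbertBasis ι ℂ H) {T : H →L[ℂ] H} {c : ι → ℂ}
    (h : ∀ i, T (b i) = c i • b i) (g : H) (i : ι) :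
    inner ℂ (b i) (T g) = c i * inner ℂ (b i) g := by
  classical
  suffices hs : (innerSL ℂ (b i)).comp T = c i • innerSL ℂ (b i) from DFunLike.congr_fun hs g
  refine ContinuousLinearMap.ext_on (s := Set.range b)
    (Submodule.dense_iff_topologicalClosure_eq_top.mpr b.dense_span) ?_
  rintro _ ⟨j, rfl⟩
  have hj := orthonormal_iff_ite.mp b.orthonormal i j
  change inner ℂ (b i) (T (b j)) = c i * inner ℂ (b i) (b j)
  rw [h, inner_smul_right, hj]
  split_ifs with hij
  · rw [hij]
  · simp

theorem norm_le_of_eigenbasis (b : HilbertBasis ι ℂ H) {T : H →L[ℂ] H} {c : ι → ℂ}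
    (h : ∀ i, T (b i) = c i • b i) {ε : ℝ} (hε : 0 ≤ ε) (hc : ∀ i, ‖c i‖ ≤ ε) : ‖T‖ ≤ ε := by
  refine T.opNorm_le_bound hε fun g => ?_
  rw [← b.repr.norm_map, ← b.repr.norm_map g]
  refine norm_le_of_norm_apply_le hε fun i => ?_
  rw [b.repr_apply_apply, inner_apply_of_eigenbasis b h, norm_mul, b.repr_apply_apply]
  exact mul_le_mul_of_nonneg_right (hc i) (norm_nonneg _)

/-- The operator is a norm limit of its finite-rank truncations: each difference is again diagonal,
and its norm is at most a bound for the omitted eigenvalues. -/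
theorem isCompactOperator_of_eigenbasis [CompleteSpace H] (b : HilbertBasis ι ℂ H)
    {T : H →L[ℂ] H} {c : ι → ℂ} (h : ∀ i, T (b i) = c i • b i)
    (hc : Tendsto c cofinite (𝓝 0)) : IsCompactOperator T := by
  classical
  let S : Finset ι → H →L[ℂ] H := fun s => ∑ i ∈ s, c i • (innerSL ℂ (b i)).smulRight (b i)
  have hS : ∀ s j, S s (b j) = (if j ∈ s then c j else 0) • b j := by
    intro s j
    have h1 : ∀ i, (c i • (innerSL ℂ (b i)).smulRight (b i)) (b j) =
        if i = j then c j • b j else 0 := by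
      intro i
      have hj := orthonormal_iff_ite.mp b.orthonormal i j
      change c i • inner ℂ (b i) (b j) • b i = _
      rw [hj]
      split_ifs with hij
      · rw [hij, one_smul]
      · simp
    change (∑ i ∈ s, c i • (innerSL ℂ (b i)).smulRight (b i)) (b j) = _
    rw [sum_apply, Finset.sum_congr rfl fun i _ => h1 i, Finset.sum_ite_eq', ite_smul, zero_smul]
  refine isCompactOperator_of_tendsto (l := atTop) (F := S) ?_ (.of_forall fun s => ?_)
  · refine Metric.tendsto_atTop.mpr fun ε hε => ?_
    have h2 : {i | ¬ ‖c i‖ < ε / 2}.Finite := by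
      have := (Metric.tendsto_nhds.mp hc) (ε / 2) (by positivity)
      simp only [dist_zero_right] at this
      exact this
    refine ⟨h2.toFinset, fun s hs => ?_⟩
    rw [dist_eq_norm]
    refine lt_of_le_of_lt (norm_le_of_eigenbasis b (c := fun i => if i ∈ s then 0 else -c i)
      (ε := ε / 2) (fun i => ?_) (by positivity) fun i => ?_) (by linarith)
    · rw [sub_apply, hS, h]
      split_ifs <;> simp
    · split_ifs with hi
      · simp only [norm_zero]; positivity
      · rw [norm_neg]
        by_contra hcon
        exact hi (hs (by simpa using fun h' : ‖c i‖ < ε / 2 => hcon h'.le))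
  · have : S s ∈ compactOperator (RingHom.id ℂ) H H := by
      refine Submodule.sum_mem _ fun i _ => Submodule.smul_mem _ _ ?_
      have h3 : IsCompactOperator (ContinuousLinearMap.toSpanSingleton ℂ (b i)) :=
        isCompactOperator_of_locallyCompactSpace_rng _
      exact h3.comp_clm (innerSL ℂ (b i))
    exact this

end Diagonal

/-! ### The eigenvalues as bounded functionals -/

section EigenvalueFunctional

/-- The eigenvalue of degree `ℓ` as a functional of the perturbation. -/
noncomputable def eigenFunctional (d ℓ : ℕ) : L2Ball d →L[ℂ] ℂ :=
  (-((((2 * ℓ - 2 : ℕ) + d : ℝ) / ℓ : ℝ) : ℂ) * (sphereArea d : ℂ)⁻¹) •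
    innerSL ℂ (radialLp d (monomialC (2 * ℓ - 2)))

theorem eigenFunctional_apply {d ℓ : ℕ} (η : L2Ball d) :
    eigenFunctional d ℓ η = -((((2 * ℓ - 2 : ℕ) + d : ℝ) / ℓ : ℝ) : ℂ) * (sphereArea d : ℂ)⁻¹ *
      inner ℂ (radialLp d (monomialC (2 * ℓ - 2))) η :=
  rfl

theorem eigenvalue_eq_eigenFunctional {d : ℕ} (hd : 0 < d) {h : ℝ → ℂ} {η : L2Ball d}
    (hη : IsRadialProfile h η) {ℓ : ℕ} (hℓ : 1 ≤ ℓ) :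
    eigenvalue d ℓ h = eigenFunctional d ℓ η := by
  have h0 : (sphereArea d : ℂ) ≠ 0 := by exact_mod_cast (sphereArea_pos hd).ne'
  rw [eigenvalue_eq hd hη hℓ, eigenFunctional_apply, inner_radialLp hd hη]
  have h1 : ∀ r : ℝ, star (monomialC (2 * ℓ - 2) r) = (r : ℂ) ^ (2 * ℓ - 2) := fun r => by
    simp [monomialC]
  simp only [h1]
  field_simp

theorem norm_radialLp_monomialC {d : ℕ} (hd : 0 < d) (n : ℕ) :
    ‖radialLp d (monomialC n)‖ ^ 2 = sphereArea d / (2 * n + d) := by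
  have h1 := inner_radialLp hd (isRadialProfile_radialLp (d := d) (monomialC n)) (monomialC n)
  rw [inner_self_eq_norm_sq_to_K] at h1
  have h2 : ∀ r : ℝ, monomialC n r * star (monomialC n r) * ((r ^ (d - 1) : ℝ) : ℂ) =
      ((r ^ (2 * n + (d - 1)) : ℝ) : ℂ) := fun r => by
    simp [monomialC]
    ring
  simp only [h2] at h1
  rw [intervalIntegral.integral_ofReal, integral_pow] at h1
  have h3 : ‖radialLp d (monomialC n)‖ ^ 2 =
      sphereArea d * ((1 ^ (2 * n + (d - 1) + 1) - 0 ^ (2 * n + (d - 1) + 1)) /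
        ((2 * n + (d - 1) : ℕ) + 1)) := by
    refine Complex.ofReal_injective ?_
    rw [Complex.ofReal_pow, Complex.ofReal_mul]
    exact h1
  have h4 : ((2 * n + (d - 1) : ℕ) + 1 : ℝ) = 2 * n + d := by
    have : 2 * n + (d - 1) + 1 = 2 * n + d := by omega
    exact_mod_cast this
  rw [h3, h4, one_pow, zero_pow (by omega)]
  ring

/-- Cauchy-Schwarz. The squared norm of the monomial is the sphere area divided by `2(2ℓ - 2) + d`,
a denominator at least `ℓ`, and the prefactor `(2ℓ - 2 + d)/ℓ` is at most `d + 2`. -/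
theorem norm_eigenFunctional_le {d ℓ : ℕ} (hd : 0 < d) (hℓ : 1 ≤ ℓ) (η : L2Ball d) :
    ‖eigenFunctional d ℓ η‖ ≤ (d + 2) / √(sphereArea d) * ‖η‖ * (ℓ : ℝ) ^ (-(1 / 2) : ℝ) := by
  have hA := sphereArea_pos hd
  have hℓ' : (1 : ℝ) ≤ ℓ := by exact_mod_cast hℓ
  have hd' : (1 : ℝ) ≤ d := by exact_mod_cast hd
  have hn : ((2 * ℓ - 2 : ℕ) : ℝ) = 2 * ℓ - 2 := by
    rw [Nat.cast_sub (by omega)]; push_cast; ring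
  have h1 : ‖radialLp d (monomialC (2 * ℓ - 2))‖ ≤ √(sphereArea d) * (√ℓ)⁻¹ := by
    rw [← div_eq_mul_inv, ← Real.sqrt_div hA.le]
    refine Real.le_sqrt_of_sq_le ?_
    rw [norm_radialLp_monomialC hd, hn]
    gcongr
    linarith
  have h2 : (((2 * ℓ - 2 : ℕ) : ℝ) + d) / ℓ ≤ d + 2 := by
    rw [hn, div_le_iff₀ (by linarith)]
    nlinarith
  have h3 : (ℓ : ℝ) ^ (-(1 / 2) : ℝ) = (√ℓ)⁻¹ := by
    rw [Real.rpow_neg (by positivity), ← Real.sqrt_eq_rpow]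
  have h4 : (sphereArea d)⁻¹ * √(sphereArea d) = (√(sphereArea d))⁻¹ := by
    nth_rewrite 1 [← Real.mul_self_sqrt hA.le]
    have := (Real.sqrt_pos.mpr hA).ne'
    field_simp
  rw [eigenFunctional_apply, norm_mul, norm_mul, norm_neg, norm_inv, Complex.norm_real,
    Complex.norm_real, Real.norm_of_nonneg hA.le, Real.norm_of_nonneg (by positivity), h3]
  calc _ ≤ (d + 2) * (sphereArea d)⁻¹ * ((√(sphereArea d) * (√ℓ)⁻¹) * ‖η‖) := by
        gcongr
        exact (norm_inner_le_norm _ _).trans (by gcongr)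
    _ = (d + 2) * ((sphereArea d)⁻¹ * √(sphereArea d)) * ‖η‖ * (√ℓ)⁻¹ := by ring
    _ = _ := by rw [h4]; ring

theorem norm_eigenFunctional_le_mul_norm {d ℓ : ℕ} (hd : 0 < d) (hℓ : 1 ≤ ℓ) (η : L2Ball d) :
    ‖eigenFunctional d ℓ η‖ ≤ (d + 2) / √(sphereArea d) * ‖η‖ := by
  refine (norm_eigenFunctional_le hd hℓ η).trans (mul_le_of_le_one_right (by positivity) ?_)
  exact Real.rpow_le_one_of_one_le_of_nonpos (by exact_mod_cast hℓ) (by norm_num)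

end EigenvalueFunctional

/-! ### The extension to square-integrable radial perturbations -/

section RadialND

variable {d : ℕ} (hd : 0 < d)

/-- The extension of the linearized Neumann-to-Dirichlet map to square-integrable radial
perturbations. -/
noncomputable def radialND : radial d →L[ℂ] L2Mean d →L[ℂ] L2Mean d :=
  diagonal (harmonicBasis hd (stdHarmonics d))
    (fun i => (eigenFunctional d i.1).toLinearMap ∘ₗ (radial d).subtype)
    ((d + 2) / √(sphereArea d)) (by positivity)
    fun i η => norm_eigenFunctional_le_mul_norm hd i.1.2 (η : L2Ball d)

/-- A mean-free harmonic of degree zero vanishes and is represented by the zero polynomial in degree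
one. This removes the case where `p / ℓ` is meaningless. -/
theorem exists_harmonicPoly_of_mem {ℓ : ℕ} {f : L2Sphere d} (hf : f ∈ L2Mean d)
    (hf' : f ∈ sphericalHarmonics d ℓ) :
    ∃ n, 1 ≤ n ∧ ∃ p ∈ harmonicPolys d n, restrictToSphere d p = f := by
  rcases Nat.eq_zero_or_pos ℓ with rfl | hℓ
  · exact ⟨1, le_rfl, 0, Submodule.zero_mem _, by rw [map_zero, eq_zero_of_mem_L2Mean hf hf']⟩
  · exact ⟨ℓ, hℓ, hf'⟩

theorem inner_harmonicBasis_radialND (η : radial d) (g : L2Mean d)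
    (i : Σ ℓ : ℕ+, Fin (Module.finrank ℂ (sphericalHarmonics d ℓ))) :
    inner ℂ (harmonicBasis hd (stdHarmonics d) i) (radialND hd η g) =
      eigenFunctional d i.1 η * inner ℂ (harmonicBasis hd (stdHarmonics d) i) g :=
  inner_diagonal _ _ _ _ _ η g i

/-- The eigenvalue depends on the degree alone, so the diagonal form does not depend on the basis
used in the construction. -/
theorem radialND_apply_of_harmonic (η : radial d) {ℓ : ℕ} {p : MvPolynomial (Fin d) ℂ}
    (hp : p ∈ harmonicPolys d ℓ) {f : L2Mean d} (hf : restrictToSphere d p = f) :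
    radialND hd η f = eigenFunctional d ℓ η • f := by
  set b := harmonicBasis hd (stdHarmonics d) with hb
  refine b.repr.injective (lp.ext (funext fun i => ?_))
  rw [b.repr_apply_apply, inner_harmonicBasis_radialND, map_smul, lp.coeFn_smul, Pi.smul_apply,
    b.repr_apply_apply, smul_eq_mul]
  by_cases h : ℓ = i.1
  · rw [h]
  · obtain ⟨q, hq, hqi⟩ := exists_harmonicPoly hd (stdHarmonics d) i
    have h0 : inner ℂ (b i) f = 0 := by
      rw [Submodule.coe_inner, ← hf, hb, ← hqi]
      exact inner_restrictToSphere_of_ne hd hp hq h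
    rw [h0, mul_zero, mul_zero]

theorem inner_radialND (η : radial d) {ℓ ℓ' : ℕ} (hℓ : 1 ≤ ℓ) (hℓ' : 1 ≤ ℓ')
    {p q : MvPolynomial (Fin d) ℂ} (hp : p ∈ harmonicPolys d ℓ) (hq : q ∈ harmonicPolys d ℓ')
    {f g : L2Mean d} (hf : restrictToSphere d p = f) (hg : restrictToSphere d q = g)
    {u v : Triple d} (hu : IsNeumannSolution (oneCoeff d) f u)
    (hv : IsNeumannSolution (oneCoeff d) g v) :
    Integrable (fun x => (η : L2Ball d) x * inner ℂ (v.2.1 x) (u.2.1 x)) (ballMeasure d) ∧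
      inner ℂ g (radialND hd η f) =
        -∫ x, (η : L2Ball d) x * inner ℂ (v.2.1 x) (u.2.1 x) ∂ballMeasure d := by
  have hu' : u = (ℓ : ℂ)⁻¹ • polyTriple p :=
    (existsUnique_isNeumannSolution_one hd f).unique hu
      (hf ▸ isNeumannSolution_polyTriple hd hp hℓ)
  have hv' : v = (ℓ' : ℂ)⁻¹ • polyTriple q :=
    (existsUnique_isNeumannSolution_one hd g).unique hv
      (hg ▸ isNeumannSolution_polyTriple hd hq hℓ')
  have h1 : (fun x => (η : L2Ball d) x * inner ℂ (v.2.1 x) (u.2.1 x)) =ᵐ[ballMeasure d]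
      fun x => ((ℓ : ℂ)⁻¹ * (ℓ' : ℂ)⁻¹) *
        ((η : L2Ball d) x * inner ℂ ((polyTriple q).2.1 x) ((polyTriple p).2.1 x)) := by
    filter_upwards [Lp.coeFn_smul (ℓ : ℂ)⁻¹ (polyTriple p).2.1,
      Lp.coeFn_smul (ℓ' : ℂ)⁻¹ (polyTriple q).2.1] with x hx hy
    rw [hu', hv', Prod.smul_snd, Prod.smul_fst, Prod.smul_snd, Prod.smul_fst, hx, hy,
      Pi.smul_apply, Pi.smul_apply, inner_smul_left, inner_smul_right, map_inv₀, map_natCast]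
    ring
  refine ⟨((integrable_mul_inner_polyTriple _ p q).const_mul _).congr h1.symm, ?_⟩
  obtain ⟨h, hη⟩ := η.2
  have hne : (ℓ : ℂ) ≠ 0 := by exact_mod_cast (by omega : ℓ ≠ 0)
  rw [integral_congr_ae h1, integral_const_mul, integral_mul_inner_polyTriple hd hη hp hq hℓ,
    eigenvalue_eq_eigenFunctional hd hη hℓ, radialND_apply_of_harmonic hd η hp hf,
    inner_smul_right, Submodule.coe_inner, ← hf, ← hg]
  by_cases h : ℓ = ℓ'
  · subst h
    field_simp
  · rw [inner_restrictToSphere_of_ne hd hp hq h]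
    ring

/-- Both operators have the same integral as matrix entries in the harmonic basis. -/
theorem extendsLinearizedND_radialND : ExtendsLinearizedND (radialND hd) := by
  intro η ξ hξ
  set b := harmonicBasis hd (stdHarmonics d) with hb
  refine ext_hilbertBasis b fun i => b.repr.injective (lp.ext (funext fun j => ?_))
  obtain ⟨p, hp, hpi⟩ := exists_harmonicPoly hd (stdHarmonics d) i
  obtain ⟨q, hq, hqj⟩ := exists_harmonicPoly hd (stdHarmonics d) j
  have hu := (existsUnique_isNeumannSolution_one hd (b i)).exists.choose_spec
  have hv := (existsUnique_isNeumannSolution_one hd (b j)).exists.choose_spec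
  rw [b.repr_apply_apply, b.repr_apply_apply,
    (inner_radialND hd η i.1.2 j.1.2 hp hq hpi hqj hu hv).2, inner_linearizedND hd ξ hu hv]
  congr 1
  refine integral_congr_ae ?_
  filter_upwards [hξ] with x hx
  rw [hx]

include hd in
-- The Jacobi polynomials are bounded on the ball, so two extensions agree on them, and by
-- continuity on every Jacobi series.
theorem eq_of_extendsLinearizedND {F F' : radial d →L[ℂ] L2Mean d →L[ℂ] L2Mean d}
    (hF : ExtendsLinearizedND F) (hF' : ExtendsLinearizedND F') : F' = F := by
  let ψ : ℕ → radial d := fun k =>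
    ⟨radialLp d (jacobiC d k), jacobiC d k, isRadialProfile_radialLp _⟩
  have hψ : ∀ k, F' (ψ k) = F (ψ k) := by
    intro k
    have h1 : ∀ᵐ x ∂ballMeasure d, (ψ k : L2Ball d) x =
        ((memLp_radial (jacobiC d k) ∞).toLp _ : LInfBall d) x := by
      filter_upwards [coeFn_radialLp (d := d) (jacobiC d k),
        MemLp.coeFn_toLp (memLp_radial (d := d) (jacobiC d k) ∞)] with x hx hy
      rw [hy, hx]
    rw [hF _ _ h1, hF' _ _ h1]
  ext1 η
  obtain ⟨h, hη⟩ := η.2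
  have hs : HasSum (fun k => jacobiCoeff d k h • ψ k) η :=
    (Topology.IsInducing.subtypeVal.hasSum_iff (g := (radial d).subtype) _ _).mp
      (hasSum_jacobi hd hη)
  have hs1 := F.hasSum hs
  have hs2 := F'.hasSum hs
  simp only [map_smul, hψ] at hs1 hs2
  exact hs2.unique hs1

theorem isCompactOperator_radialND (η : radial d) : IsCompactOperator (radialND hd η) := by
  refine isCompactOperator_of_eigenbasis (harmonicBasis hd (stdHarmonics d))
    (fun i => diagonal_apply_basis _ _ _ _ _ η i) ?_
  have h1 : Tendsto (fun ℓ : ℕ => (d + 2) / √(sphereArea d) * ‖η‖ * (ℓ : ℝ) ^ (-(1 / 2) : ℝ))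
      atTop (𝓝 0) := by
    have := ((tendsto_rpow_neg_atTop (y := 1 / 2) (by norm_num)).comp
      tendsto_natCast_atTop_atTop).const_mul ((d + 2) / √(sphereArea d) * ‖η‖)
    rwa [mul_zero] at this
  -- Each degree carries finitely many basis vectors, so leaving all finite index sets forces the
  -- degree to infinity.
  have h2 : Tendsto (fun i : Σ ℓ : ℕ+, Fin (Module.finrank ℂ (sphericalHarmonics d ℓ)) =>
      ((i.1 : ℕ+) : ℕ)) cofinite atTop := by
    rw [← Nat.cofinite_eq_atTop]
    refine PNat.coe_injective.tendsto_cofinite.comp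
      (Tendsto.cofinite_of_finite_preimage_singleton fun ℓ => ?_)
    refine Finite.of_surjective (α := Fin (Module.finrank ℂ (sphericalHarmonics d ℓ)))
      (fun m => ⟨⟨ℓ, m⟩, rfl⟩) ?_
    rintro ⟨⟨ℓ', m⟩, rfl⟩
    exact ⟨m, rfl⟩
  exact squeeze_zero_norm (fun i => norm_eigenFunctional_le hd i.1.2 (η : L2Ball d)) (h1.comp h2)

end RadialND

end RadialEIT

open RadialEIT

theorem theorem2p1 (d : ℕ) (hd : 2 ≤ d) :
    -- the Neumann-to-Dirichlet map is well defined near `γ = 1` and differentiable at `γ = 1`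
    (∀ᶠ γ in 𝓝 (oneCoeff d), IsNDMap γ (ndMap d γ)) ∧
    DifferentiableAt ℂ (ndMap d) (oneCoeff d) ∧
    -- its derivative extends uniquely to the radial perturbations in `L²(B)`
    ∃ F : radial d →L[ℂ] (L2Mean d →L[ℂ] L2Mean d),
      ExtendsLinearizedND F ∧
      (∀ F' : radial d →L[ℂ] (L2Mean d →L[ℂ] L2Mean d), ExtendsLinearizedND F' → F' = F) ∧
      -- the extension is still given by the integral formula on spherical harmonics
      (∀ (η : radial d) (ℓ ℓ' : ℕ) (f g : L2Mean d) (u v : Triple d),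
        (f : L2Sphere d) ∈ sphericalHarmonics d ℓ →
        (g : L2Sphere d) ∈ sphericalHarmonics d ℓ' →
        IsNeumannSolution (oneCoeff d) f u → IsNeumannSolution (oneCoeff d) g v →
        Integrable (fun x => (η : L2Ball d) x * inner ℂ (v.2.1 x) (u.2.1 x)) (ballMeasure d) ∧
        inner ℂ g (F η f) =
          -∫ x, (η : L2Ball d) x * inner ℂ (v.2.1 x) (u.2.1 x) ∂ballMeasure d) ∧
      -- the Jacobi expansion of a radial perturbation
      (∀ (η : radial d) (h : ℝ → ℂ), IsRadialProfile h (η : L2Ball d) →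
        (∀ k : ℕ, IntervalIntegrable
          (fun r => h r * (jacobiP d k r : ℂ) * ((r ^ (d - 1) : ℝ) : ℂ)) volume 0 1) ∧
        Tendsto (fun n : ℕ => eLpNorm (fun x => (η : L2Ball d) x -
            ∑ k ∈ Finset.range n, jacobiCoeff d k h * (jacobiP d k ‖x‖ : ℂ)) 2 (ballMeasure d))
          atTop (𝓝 0)) ∧
      -- the eigenstructure in any orthonormal basis of spherical harmonics
      (∀ (ι : ℕ+ → Type*) [∀ ℓ, Fintype (ι ℓ)]
        (f : ∀ ℓ : ℕ+, OrthonormalBasis (ι ℓ) ℂ (sphericalHarmonics d ℓ)),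
        ∃ b : HilbertBasis (Σ ℓ : ℕ+, ι ℓ) ℂ (L2Mean d),
          (∀ (ℓ : ℕ+) (m : ι ℓ), (b ⟨ℓ, m⟩ : L2Sphere d) = f ℓ m) ∧
          ∀ (η : radial d) (h : ℝ → ℂ), IsRadialProfile h (η : L2Ball d) →
            (∀ (ℓ : ℕ+) (m : ι ℓ), F η (b ⟨ℓ, m⟩) = eigenvalue d ℓ h • b ⟨ℓ, m⟩) ∧
            (∀ g : L2Mean d,
              HasSum (fun i : Σ ℓ : ℕ+, ι ℓ => eigenvalue d i.1 h • inner ℂ (b i) g • b i)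
                (F η g))) ∧
      -- the decay of the eigenvalues, with a constant that depends only on the dimension
      (∃ C : ℝ, ∀ (η : radial d) (h : ℝ → ℂ), IsRadialProfile h (η : L2Ball d) →
        ∀ ℓ : ℕ, 1 ≤ ℓ →
          ‖eigenvalue d ℓ h‖ ≤ C * ‖η‖ * (ℓ : ℝ) ^ (-(1 / 2) : ℝ)) ∧
      -- compactness
      (∀ η : radial d, IsCompactOperator (F η)) := by
  have hd0 : 0 < d := by omega
  refine ⟨(eventually_isUnit_neumannOp hd0).mono fun γ hγ => isNDMap_ndMap hd0 hγ,
    (exists_hasFDerivAt_ndMap hd0).choose_spec.1.differentiableAt, radialND hd0,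
    extendsLinearizedND_radialND hd0,
    fun F' hF' => eq_of_extendsLinearizedND hd0 (extendsLinearizedND_radialND hd0) hF',
    fun η ℓ ℓ' f g u v hf hg hu hv => ?_,
    fun η h hη => ⟨fun k => intervalIntegrable_profile_mul hd0 hη (jacobiC d k),
      tendsto_jacobi hd0 hη⟩,
    fun ι _ f => ⟨harmonicBasis hd0 f, fun ℓ m => harmonicBasis_apply hd0 f ⟨ℓ, m⟩,
      fun η h hη => ?_⟩,
    ⟨(d + 2) / √(sphereArea d), fun η h hη ℓ hℓ => ?_⟩,
    isCompactOperator_radialND hd0⟩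
  · obtain ⟨n, hn, p, hp, hpf⟩ := exists_harmonicPoly_of_mem f.2 hf
    obtain ⟨m, hm, q, hq, hqg⟩ := exists_harmonicPoly_of_mem g.2 hg
    exact inner_radialND hd0 η hn hm hp hq hpf hqg hu hv
  -- The given basis may differ from the one in the construction, but its elements are harmonics of
  -- a fixed degree and hence eigenvectors too.
  · have heig : ∀ i, radialND hd0 η (harmonicBasis hd0 f i) =
        eigenvalue d i.1 h • harmonicBasis hd0 f i := fun i => by
      obtain ⟨p, hp, hpi⟩ := exists_harmonicPoly hd0 f i
      have hv : eigenvalue d i.1 h = eigenFunctional d i.1 η :=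
        eigenvalue_eq_eigenFunctional hd0 hη i.1.2
      exact (radialND_apply_of_harmonic hd0 η hp hpi).trans (congrArg (· • _) hv.symm)
    refine ⟨fun ℓ m => heig ⟨ℓ, m⟩, fun g => ?_⟩
    have hs := (radialND hd0 η).hasSum ((harmonicBasis hd0 f).hasSum_repr g)
    simp only [map_smul, heig, HilbertBasis.repr_apply_apply] at hs
    simpa only [smul_comm (eigenvalue d _ h)] using hs
  · rw [eigenvalue_eq_eigenFunctional hd0 hη hℓ]
    exact norm_eigenFunctional_le hd0 hℓ (η : L2Ball d)
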